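/- Let $G$ be the connected, simply connected Lie group whose Lie algebra has basis $A,B,P,Q,R,S$ and non-zero brackets $[P,Q]=R$, $[P,R]=S$, $[A,P]=\frac12P$, $[B,P]=-\frac12P$, $[B,Q]=Q$, $[A,R]=\frac12R$, $[B,R]=\frac12R$, $[A,S]=S$. Let $G_0=\exp(\mathrm{span}\{A,B,P\})$, identified with $\mathbb R^3$ through $E(a,b,p)=\exp(aA)\exp(bB)\exp(pP)$, and let $H=\exp\mathfrak h$, $\mathfrak h=\mathrm{span}\{Q,R,S\}$, an abelian normal subgroup, so that $G=G_0H$; the Lebesgue measures $da\,db\,dp$ and $da\,db\,dp\,dq\,dr\,ds$ in the coordinates $E(a,b,p)\exp(qQ+rR+sS)$ are left Haar measures of $G_0$ and $G$. For $l\in\mathfrak h^*$ let $\chi_l(\exp x)=e^{il(x)}$ and let $\sigma_l=\mathrm{ind}_H^G\chi_l$, realized on $L^2(G_0)=L^2(\mathbb R^3)$ by $$\sigma_l(g_0x)\xi(y)=\chi_l(y^{-1}g_0xg_0^{-1}y)\,\xi(g_0^{-1}y)\qquad(g_0,y\in G_0,\ x\in H);$$ write also $\sigma_l$ for its integrated form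 $\sigma_l(F)=\int_GF(g)\sigma_l(g)\,dg$ on $L^1(G)$ and for the extension of this to $C^*(G)$. Let $Q^*,R^*,S^*$ be the basis of $\mathfrak h^*$ dual to $Q,R,S$ and put $\pi_{\varepsilon(Q^*+S^*)}=\sigma_{\varepsilon(Q^*+S^*)}$ for $\varepsilon=\pm1$. Let $L^1_c$ be the set of all $F\in L^1(G)$ whose partial Fourier transform $(y,l)\mapsto\int_HF(yx)\chi_l(x)\,dx$ is (after a change on a null set of $y$'s) a $C^\infty$ function with compact support on $G_0\times\mathfrak h^*$. For $\delta>0$ and $k\in\mathbb Z$ put $S_{\delta,1}=\{e^{-a}>\delta^6\}$, $S_{\delta,2}=\{e^{-a}\le\delta^6,\ e^{-b}<\delta\}$, $S_{\delta,3,k}=\{e^{-a}\le\delta^6,\ e^{-b}\ge\delta,\ p\in[\delta^2k,\delta^2k+\delta^2)\}$ and $T_{\delta,3,k}=\{p\in[\delta^2(k-1),\delta^2(k+2))\}$, all subsets of $\mathbb R^3=\{(a,b,p)\}$. Let $M_{\delta,1},M_{\delta,2},M_{\delta,3,k},N_{\delta,3,k}$ be the multiplication operators on $L^2(\mathbb R^3)$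 with the characteristic functions of $S_{\delta,1},S_{\delta,2},S_{\delta,3,k},T_{\delta,3,k}$. Let $\varphi:\mathbb R\to\mathbb R$ be a $C^\infty$ function with support in $[-1,1]$, $\varphi(0)=1$ and $\|\varphi\|_\infty=1$, and let $M_{\tilde\varphi_1}$ be multiplication with $\varphi(e^{-b})$. For $\varepsilon=\pm1$ and $F\in L^1_c$ put $$\sigma_{\varepsilon,\varepsilon,\delta}(F)=\sigma_{\varepsilon S^*}(F)M_{\tilde\varphi_1}M_{\delta,1}+\sigma_{\varepsilon S^*}(F)M_{\delta,2}+\sum_{k\in\mathbb Z}N_{\delta,3,k}\,\sigma_{\varepsilon(1+\delta^4k^2/2)Q^*}(F)\,M_{\delta,3,k},$$ the series being taken in the strong operator topology. **Proposition.** There is an absolute constant $C$ with $0<C\le9$ such that for every $\varepsilon=\pm1$ and every such $\varphi$ the following holds. 1. For all $F\in L^1_c$ and $\delta>0$ the series converges, $\sigma_{\varepsilon,\varepsilon,\delta}(F)$ is a bounded operator, and $$\|\sigma_{\varepsilon,\varepsilon,\delta}(F)\|\le2\|\sigma_{\varepsilon S^*}(F)\|+C\|\sigma_{\varepsilon Q^*}(F)\|.$$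 2. For every $\delta>0$ the map $F\mapsto\sigma_{\varepsilon,\varepsilon,\delta}(F)$ extends uniquely to a bounded linear map from $C^*(G)$ to $\mathcal B(L^2(\mathbb R^3))$, the same inequality holds for all $F\in C^*(G)$, and for every $F\in C^*(G)$ $$\lim_{\delta\to0}\mathrm{dis}\big(\pi_{\varepsilon(Q^*+S^*)}(F)-\sigma_{\varepsilon,\varepsilon,\delta}(F),\ \mathcal K(L^2(\mathbb R^3))\big)=0,$$ where $\mathrm{dis}$ is the distance in operator norm and $\mathcal K$ denotes the compact operators. -/

import Mathlib

open scoped ContDiff Topology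
open MeasureTheory

noncomputable section

/-! ### Unitary representations and the group C*-algebra -/

namespace GroupCStar

/-- A strongly continuous unitary representation of `G` on the Hilbert space `E`. Each operator is
an isometry which is invertible because `G` is a group, so it is unitary. -/
structure UnitaryRep (G : Type) [Group G] [TopologicalSpace G]
    (E : Type) [NormedAddCommGroup E] [InnerProductSpace ℂ E] [CompleteSpace E] where
  toHom : G →* (E →ₗᵢ[ℂ] E)
  continuous_orbit : ∀ ξ : E, Continuous fun g => toHom g ξ

variable {G : Type} [Group G] [TopologicalSpace G] [SecondCountableTopology G]
  [MeasurableSpace G] [BorelSpace G]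

section
variable {E : Type} [NormedAddCommGroup E] [InnerProductSpace ℂ E] [CompleteSpace E]

theorem integrable_orbit (π : UnitaryRep G E) (μ : Measure G) (F : Lp ℂ 1 μ) (ξ : E) :
    Integrable (fun g => F g • π.toHom g ξ) μ := by
  have hF : Integrable (fun g => (F g : ℂ)) μ := L1.integrable_coeFn F
  refine (hF.norm.mul_const ‖ξ‖).mono' ?_ ?_
  · exact hF.aestronglyMeasurable.smul (π.continuous_orbit ξ).aestronglyMeasurable
  · exact Filter.Eventually.of_forall fun g => by simp [norm_smul]

/-- The integrated form `π(F) = ∫ F(g) π(g) dg` of a unitary representation, for `F ∈ L¹(G, μ)`. -/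
def UnitaryRep.integrated (π : UnitaryRep G E) (μ : Measure G) :
    Lp ℂ 1 μ →L[ℂ] E →L[ℂ] E :=
  LinearMap.mkContinuous₂
    (LinearMap.mk₂ ℂ (fun F ξ => ∫ g, F g • π.toHom g ξ ∂μ)
      (by
        intro F F' ξ
        rw [← integral_add (integrable_orbit π μ F ξ) (integrable_orbit π μ F' ξ)]
        refine integral_congr_ae ?_
        filter_upwards [Lp.coeFn_add F F'] with g hg
        rw [hg, Pi.add_apply, add_smul])
      (by
        intro c F ξ
        rw [← integral_smul]
        refine integral_congr_ae ?_
        filter_upwards [Lp.coeFn_smul c F] with g hg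
        rw [hg, Pi.smul_apply, smul_assoc])
      (by
        intro F ξ ξ'
        rw [← integral_add (integrable_orbit π μ F ξ) (integrable_orbit π μ F ξ')]
        simp [smul_add])
      (by
        intro c F ξ
        rw [← integral_smul]
        simp [smul_comm c]))
    1
    (by
      intro F ξ
      rw [LinearMap.mk₂_apply, one_mul, L1.norm_eq_integral_norm, ← integral_mul_const]
      refine (norm_integral_le_integral_norm _).trans_eq ?_
      simp [norm_smul])

theorem UnitaryRep.integrated_apply (π : UnitaryRep G E) (μ : Measure G) (F : Lp ℂ 1 μ) (ξ : E) :
    π.integrated μ F ξ = ∫ g, F g • π.toHom g ξ ∂μ := rfl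

theorem UnitaryRep.norm_integrated_le (π : UnitaryRep G E) (μ : Measure G) (F : Lp ℂ 1 μ) :
    ‖π.integrated μ F‖ ≤ ‖F‖ := by
  refine ((π.integrated μ).le_opNorm F).trans ?_
  have h : ‖π.integrated μ‖ ≤ 1 := LinearMap.mkContinuous₂_norm_le _ zero_le_one _
  simpa using mul_le_mul_of_nonneg_right h (norm_nonneg F)

end

/-- The numbers `‖π(F)‖`, where `π` runs through all unitary representations of `G`. -/
def repNorms (μ : Measure G) (F : Lp ℂ 1 μ) : Set ℝ :=
  {c | ∃ (E : Type) (_ : NormedAddCommGroup E) (_ : InnerProductSpace ℂ E) (_ : CompleteSpace E)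
    (π : UnitaryRep G E), c = ‖π.integrated μ F‖}

theorem repNorms_nonempty (μ : Measure G) (F : Lp ℂ 1 μ) : (repNorms μ F).Nonempty :=
  ⟨_, ℂ, inferInstance, inferInstance, inferInstance, ⟨1, fun _ => continuous_const⟩, rfl⟩

theorem repNorms_bddAbove (μ : Measure G) (F : Lp ℂ 1 μ) : BddAbove (repNorms μ F) := by
  refine ⟨‖F‖, ?_⟩
  rintro c ⟨E, _, _, _, π, rfl⟩
  exact π.norm_integrated_le μ F

/-- The (maximal) C*-norm `F ↦ sup_π ‖π(F)‖` on `L¹(G)`. -/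
def cstarSeminorm (μ : Measure G) : Seminorm ℂ (Lp ℂ 1 μ) :=
  Seminorm.ofSMulLE (fun F => sSup (repNorms μ F))
    (by
      refine le_antisymm (csSup_le (repNorms_nonempty μ 0) ?_)
        (Real.sSup_nonneg ?_)
      · rintro c ⟨E, _, _, _, π, rfl⟩
        simp
      · rintro c ⟨E, _, _, _, π, rfl⟩
        exact norm_nonneg _)
    (by
      intro F F'
      refine csSup_le (repNorms_nonempty μ _) ?_
      rintro c ⟨E, _, _, _, π, rfl⟩
      rw [map_add]
      exact (norm_add_le _ _).trans (add_le_add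
        (le_csSup (repNorms_bddAbove μ F) ⟨E, _, _, ‹_›, π, rfl⟩)
        (le_csSup (repNorms_bddAbove μ F') ⟨E, _, _, ‹_›, π, rfl⟩)))
    (by
      intro z F
      refine csSup_le (repNorms_nonempty μ _) ?_
      rintro c ⟨E, _, _, _, π, rfl⟩
      rw [map_smul, norm_smul]
      exact mul_le_mul_of_nonneg_left
        (le_csSup (repNorms_bddAbove μ F) ⟨E, _, _, ‹_›, π, rfl⟩) (norm_nonneg z))

/-- `L¹(G)` equipped with the C*-norm instead of the `L¹`-norm. -/
def PreCStar {G : Type} [Group G] [TopologicalSpace G] [IsTopologicalGroup G] [MeasurableSpace G]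
    (μ : Measure G) [μ.IsHaarMeasure] : Type := Lp ℂ 1 μ

variable [IsTopologicalGroup G] (μ : Measure G) [μ.IsHaarMeasure]

instance : SeminormedAddCommGroup (PreCStar μ) :=
  (cstarSeminorm μ).toAddGroupSeminorm.toSeminormedAddCommGroup

instance : Module ℂ (PreCStar μ) := inferInstanceAs (Module ℂ (Lp ℂ 1 μ))

instance : NormedSpace ℂ (PreCStar μ) where
  norm_smul_le z F := (map_smul_eq_mul (cstarSeminorm μ) z F).le

/-- (The underlying Banach space of) the group C*-algebra `C*(G)`: the completion of `L¹(G)` for the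
C*-norm. -/
abbrev CStar : Type := UniformSpace.Completion (PreCStar μ)

/-- The canonical map `L¹(G) → C*(G)`. -/
def ofL1 : Lp ℂ 1 μ →ₗ[ℂ] CStar μ :=
  (UniformSpace.Completion.toComplL : PreCStar μ →L[ℂ] CStar μ).toLinearMap

theorem norm_ofL1 (F : Lp ℂ 1 μ) : ‖ofL1 μ F‖ = sSup (repNorms μ F) :=
  UniformSpace.Completion.norm_coe (E := PreCStar μ) F

theorem denseRange_ofL1 : DenseRange (ofL1 μ) :=
  UniformSpace.Completion.denseRange_coe (α := PreCStar μ)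

section
variable {E : Type} [NormedAddCommGroup E] [InnerProductSpace ℂ E] [CompleteSpace E]

theorem norm_integrated_le_ofL1 (π : UnitaryRep G E) (F : Lp ℂ 1 μ) :
    ‖π.integrated μ F‖ ≤ ‖ofL1 μ F‖ := by
  rw [norm_ofL1]
  exact le_csSup (repNorms_bddAbove μ F) ⟨E, _, _, ‹_›, π, rfl⟩

/-- The extension of the integrated form of a unitary representation from `L¹(G)` to `C*(G)`. -/
def UnitaryRep.onCStar (π : UnitaryRep G E) : CStar μ →L[ℂ] E →L[ℂ] E :=
  (π.integrated μ).toLinearMap.extendOfNorm (ofL1 μ)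

theorem UnitaryRep.onCStar_ofL1 (π : UnitaryRep G E) (F : Lp ℂ 1 μ) :
    π.onCStar μ (ofL1 μ F) = π.integrated μ F :=
  LinearMap.extendOfNorm_eq (denseRange_ofL1 μ)
    ⟨1, fun F => by simpa using norm_integrated_le_ofL1 μ π F⟩ F

end

end GroupCStar

/-! ### The group -/

namespace G6

/-- The subgroup `G₀ = exp(span{A, B, P})` in the coordinates
`(a, b, p) ↦ E(a, b, p) = exp(aA) exp(bB) exp(pP)`. -/
def G₀ : Type := ℝ × ℝ × ℝ

instance : TopologicalSpace G₀ := inferInstanceAs (TopologicalSpace (ℝ × ℝ × ℝ))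
instance : SecondCountableTopology G₀ := inferInstanceAs (SecondCountableTopology (ℝ × ℝ × ℝ))
instance : T2Space G₀ := inferInstanceAs (T2Space (ℝ × ℝ × ℝ))
instance : LocallyCompactSpace G₀ := inferInstanceAs (LocallyCompactSpace (ℝ × ℝ × ℝ))
instance : MeasureSpace G₀ := inferInstanceAs (MeasureSpace (ℝ × ℝ × ℝ))
instance : BorelSpace G₀ := inferInstanceAs (BorelSpace (ℝ × ℝ × ℝ))

/-- `E(a,b,p) E(a',b',p') = E(a + a', b + b', e^{(b' - a')/2} p + p')`, because
`[A, P] = P/2`, `[B, P] = -P/2`, `[A, B] = 0`. -/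
instance : Group G₀ where
  mul x y := (x.1 + y.1, x.2.1 + y.2.1, Real.exp ((y.2.1 - y.1) / 2) * x.2.2 + y.2.2)
  one := (0, 0, 0)
  inv x := (-x.1, -x.2.1, -(Real.exp ((x.1 - x.2.1) / 2) * x.2.2))
  mul_assoc x y z := by
    refine Prod.ext (add_assoc _ _ _) (Prod.ext (add_assoc _ _ _) ?_)
    change Real.exp ((z.2.1 - z.1) / 2) * (Real.exp ((y.2.1 - y.1) / 2) * x.2.2 + y.2.2) + z.2.2
      = Real.exp (((y.2.1 + z.2.1) - (y.1 + z.1)) / 2) * x.2.2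
        + (Real.exp ((z.2.1 - z.1) / 2) * y.2.2 + z.2.2)
    rw [show ((y.2.1 + z.2.1) - (y.1 + z.1)) / 2 = (z.2.1 - z.1) / 2 + (y.2.1 - y.1) / 2 by ring,
      Real.exp_add]
    ring
  one_mul x := by
    refine Prod.ext (zero_add _) (Prod.ext (zero_add _) ?_)
    change Real.exp ((x.2.1 - x.1) / 2) * 0 + x.2.2 = x.2.2
    ring
  mul_one x := by
    refine Prod.ext (add_zero _) (Prod.ext (add_zero _) ?_)
    change Real.exp (((0 : ℝ) - 0) / 2) * x.2.2 + 0 = x.2.2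
    simp
  inv_mul_cancel x := by
    refine Prod.ext (neg_add_cancel _) (Prod.ext (neg_add_cancel _) ?_)
    change Real.exp ((x.2.1 - x.1) / 2) * (-(Real.exp ((x.1 - x.2.1) / 2) * x.2.2)) + x.2.2 = 0
    rw [mul_neg, ← mul_assoc, ← Real.exp_add,
      show (x.2.1 - x.1) / 2 + (x.1 - x.2.1) / 2 = 0 by ring, Real.exp_zero]
    ring

theorem mul_def (x y : G₀) :
    x * y = (x.1 + y.1, x.2.1 + y.2.1, Real.exp ((y.2.1 - y.1) / 2) * x.2.2 + y.2.2) := rfl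

theorem inv_def (x : G₀) :
    x⁻¹ = (-x.1, -x.2.1, -(Real.exp ((x.1 - x.2.1) / 2) * x.2.2)) := rfl

instance : IsTopologicalGroup G₀ where
  continuous_mul := by
    change Continuous fun z : (ℝ × ℝ × ℝ) × (ℝ × ℝ × ℝ) =>
      ((z.1.1 + z.2.1, z.1.2.1 + z.2.2.1,
        Real.exp ((z.2.2.1 - z.2.1) / 2) * z.1.2.2 + z.2.2.2) : ℝ × ℝ × ℝ)
    fun_prop
  continuous_inv := by
    change Continuous fun x : ℝ × ℝ × ℝ =>
      ((-x.1, -x.2.1, -(Real.exp ((x.1 - x.2.1) / 2) * x.2.2)) : ℝ × ℝ × ℝ)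
    fun_prop

/-- Lebesgue measure `da db dp` is a left Haar measure of `G₀`. -/
instance : (volume : Measure G₀).IsHaarMeasure where
  lt_top_of_isCompact := fun K hK =>
    IsCompact.measure_lt_top (α := ℝ × ℝ × ℝ) (μ := volume) hK
  map_mul_left_eq_self g := by
    have h : MeasurePreserving (fun x : ℝ × ℝ × ℝ => (g.1 + x.1,
        (g.2.1 + x.2.1, Real.exp ((x.2.1 - x.1) / 2) * g.2.2 + x.2.2))) := by
      refine MeasurePreserving.skew_product (g := fun a (q : ℝ × ℝ) =>
        (g.2.1 + q.1, Real.exp ((q.1 - a) / 2) * g.2.2 + q.2))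
        (measurePreserving_add_left volume g.1) (by fun_prop) (Filter.Eventually.of_forall ?_)
      intro a
      exact (MeasurePreserving.skew_product (g := fun b p =>
        Real.exp ((b - a) / 2) * g.2.2 + p)
        (measurePreserving_add_left volume g.2.1) (by fun_prop)
        (Filter.Eventually.of_forall fun b =>
          (measurePreserving_add_left volume (Real.exp ((b - a) / 2) * g.2.2)).map_eq)).map_eq
    exact h.map_eq
  open_pos U hU hne := IsOpen.measure_ne_zero (X := ℝ × ℝ × ℝ) volume hU hne

/-- The Lie algebra `𝔥 = span{Q, R, S}` in the coordinates `(q, r, s) ↦ qQ + rR + sS`; the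
abelian normal subgroup `H = exp 𝔥` is identified with it through `exp`. -/
abbrev h : Type := ℝ × ℝ × ℝ

/-- `Ad(g⁻¹)` on `𝔥` for `g = E(a, b, p)`, that is
`exp(-p ad P) exp(-b ad B) exp(-a ad A)`, where `ad A = diag(0, 1/2, 1)`, `ad B = diag(1, 1/2, 0)`
and `ad P : Q ↦ R ↦ S ↦ 0`. -/
def adInv (g : G₀) (x : h) : h :=
  (Real.exp (-g.2.1) * x.1,
   Real.exp (-(g.1 + g.2.1) / 2) * x.2.1 - Real.exp (-g.2.1) * g.2.2 * x.1,
   Real.exp (-g.1) * x.2.2 - Real.exp (-(g.1 + g.2.1) / 2) * g.2.2 * x.2.1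
     + Real.exp (-g.2.1) * g.2.2 ^ 2 / 2 * x.1)

theorem adInv_mul (g g' : G₀) (x : h) : adInv (g * g') x = adInv g' (adInv g x) := by
  have e1 : ∀ u v : ℝ, Real.exp (-(u + v)) = Real.exp (-u / 2) ^ 2 * Real.exp (-v / 2) ^ 2 := by
    intro u v
    rw [← Real.exp_nat_mul, ← Real.exp_nat_mul, ← Real.exp_add]
    congr 1
    push_cast
    ring
  have e2 : ∀ u v : ℝ, Real.exp (-(u + v) / 2) = Real.exp (-u / 2) * Real.exp (-v / 2) := by
    intro u v
    rw [← Real.exp_add]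
    congr 1
    ring
  have e3 : ∀ u : ℝ, Real.exp (-u) = Real.exp (-u / 2) ^ 2 := by
    intro u
    rw [← Real.exp_nat_mul]
    congr 1
    push_cast
    ring
  have e4 : ∀ u v : ℝ, Real.exp ((u - v) / 2) = (Real.exp (-u / 2))⁻¹ * Real.exp (-v / 2) := by
    intro u v
    rw [← Real.exp_neg, ← Real.exp_add]
    congr 1
    ring
  have hne := (Real.exp_pos (-g'.2.1 / 2)).ne'
  simp only [adInv, mul_def, e1, e2, e3, e4]
  refine Prod.ext ?_ (Prod.ext ?_ ?_)
  · simp only []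
    ring
  · simp only []
    field_simp
    ring
  · simp only []
    field_simp
    ring

theorem adInv_one (x : h) : adInv 1 x = x := by
  change adInv ((0, 0, 0) : ℝ × ℝ × ℝ) x = x
  simp [adInv]

theorem adInv_add (g : G₀) (x y : h) : adInv g (x + y) = adInv g x + adInv g y := by
  refine Prod.ext ?_ (Prod.ext ?_ ?_) <;> simp [adInv] <;> ring

theorem adInv_zero (g : G₀) : adInv g 0 = 0 := by
  simp [adInv]

theorem adInv_neg (g : G₀) (x : h) : adInv g (-x) = -adInv g x := by
  refine Prod.ext ?_ (Prod.ext ?_ ?_) <;> simp [adInv] <;> ring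

/-- The simply connected Lie group `G = G₀ ⋉ H` of the Lie algebra spanned by `A, B, P, Q, R, S`
with `[P,Q] = R`, `[P,R] = S`, `[A,P] = P/2`, `[B,P] = -P/2`, `[B,Q] = Q`, `[A,R] = R/2`,
`[B,R] = R/2`, `[A,S] = S` and all other brackets of basis vectors zero, in the coordinates
`((a,b,p), (q,r,s)) ↦ E(a,b,p) exp(qQ + rR + sS)`. -/
def G : Type := G₀ × h

instance : TopologicalSpace G := inferInstanceAs (TopologicalSpace (G₀ × h))
instance : SecondCountableTopology G := inferInstanceAs (SecondCountableTopology (G₀ × h))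
instance : MeasureSpace G := inferInstanceAs (MeasureSpace (G₀ × h))
instance : BorelSpace G := inferInstanceAs (BorelSpace (G₀ × h))

/-- `(g x)(g' x') = (g g') (g'⁻¹ x g') x'` for `g, g' ∈ G₀` and `x, x' ∈ H`. -/
instance : Group G where
  mul u v := (u.1 * v.1, adInv v.1 u.2 + v.2)
  one := (1, 0)
  inv u := (u.1⁻¹, -adInv u.1⁻¹ u.2)
  mul_assoc u v w := by
    refine Prod.ext (mul_assoc _ _ _) ?_
    change adInv w.1 (adInv v.1 u.2 + v.2) + w.2 = adInv (v.1 * w.1) u.2 + (adInv w.1 v.2 + w.2)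
    rw [adInv_add, adInv_mul, add_assoc]
  one_mul u := by
    refine Prod.ext (one_mul _) ?_
    change adInv u.1 0 + u.2 = u.2
    rw [adInv_zero, zero_add]
  mul_one u := by
    refine Prod.ext (mul_one _) ?_
    change adInv 1 u.2 + 0 = u.2
    rw [adInv_one, add_zero]
  inv_mul_cancel u := by
    refine Prod.ext (inv_mul_cancel _) ?_
    change adInv u.1 (-adInv u.1⁻¹ u.2) + u.2 = 0
    rw [adInv_neg, ← adInv_mul, inv_mul_cancel, adInv_one, neg_add_cancel]

theorem mul_def' (u v : G) : u * v = (u.1 * v.1, adInv v.1 u.2 + v.2) := rfl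

theorem continuous_adInv : Continuous fun z : G₀ × h => adInv z.1 z.2 := by
  change Continuous fun z : (ℝ × ℝ × ℝ) × (ℝ × ℝ × ℝ) =>
    ((Real.exp (-z.1.2.1) * z.2.1,
      Real.exp (-(z.1.1 + z.1.2.1) / 2) * z.2.2.1 - Real.exp (-z.1.2.1) * z.1.2.2 * z.2.1,
      Real.exp (-z.1.1) * z.2.2.2 - Real.exp (-(z.1.1 + z.1.2.1) / 2) * z.1.2.2 * z.2.2.1
        + Real.exp (-z.1.2.1) * z.1.2.2 ^ 2 / 2 * z.2.1) : ℝ × ℝ × ℝ)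
  fun_prop

theorem continuous_fst' : Continuous fun u : G => u.1 := continuous_fst (X := G₀) (Y := h)

theorem continuous_snd' : Continuous fun u : G => u.2 := continuous_snd (X := G₀) (Y := h)

instance : IsTopologicalGroup G where
  continuous_mul := by
    change Continuous fun z : G × G => ((z.1.1 * z.2.1, adInv z.2.1 z.1.2 + z.2.2) : G₀ × h)
    refine Continuous.prodMk ?_ ?_
    · exact (continuous_fst'.comp continuous_fst).mul (continuous_fst'.comp continuous_snd)
    · exact (continuous_adInv.comp ((continuous_fst'.comp continuous_snd).prodMk
        (continuous_snd'.comp continuous_fst))).add (continuous_snd'.comp continuous_snd)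
  continuous_inv := by
    change Continuous fun u : G => ((u.1⁻¹, -adInv u.1⁻¹ u.2) : G₀ × h)
    refine Continuous.prodMk ?_ ?_
    · exact continuous_fst'.inv
    · exact (continuous_adInv.comp (continuous_fst'.inv.prodMk continuous_snd')).neg

/-- Lebesgue measure `da db dp dq dr ds` is a left Haar measure of `G`. -/
instance : (volume : Measure G).IsHaarMeasure where
  lt_top_of_isCompact := fun K hK =>
    IsCompact.measure_lt_top (α := (ℝ × ℝ × ℝ) × ℝ × ℝ × ℝ) (μ := volume) hK
  map_mul_left_eq_self g := by
    have h : MeasurePreserving (fun u : G₀ × h => (g.1 * u.1, adInv u.1 g.2 + u.2)) := by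
      refine MeasurePreserving.skew_product (g := fun (y : G₀) (x : h) => adInv y g.2 + x)
        (measurePreserving_mul_left volume g.1) ?_ (Filter.Eventually.of_forall fun y =>
          ((measurePreserving_add_left (G := ℝ) volume _).prod
            ((measurePreserving_add_left (G := ℝ) volume _).prod
              (measurePreserving_add_left (G := ℝ) volume _))).map_eq)
      exact ((continuous_adInv.comp (continuous_fst.prodMk continuous_const)).add
        continuous_snd).measurable
    exact h.map_eq
  open_pos U hU hne :=
    have h₁ : (volume : Measure (ℝ × ℝ × ℝ)).IsOpenPosMeasure := inferInstance
    have h₂ : ((volume : Measure (ℝ × ℝ × ℝ)).prod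
      (volume : Measure (ℝ × ℝ × ℝ))).IsOpenPosMeasure := Measure.prod.instIsOpenPosMeasure
    h₂.open_pos U hU hne

/-- The value `l(x)` for `l = q*Q* + r*R* + s*S* ∈ 𝔥*`, written `(q*, r*, s*)`, and `x ∈ 𝔥`. -/
def pair (l : ℝ × ℝ × ℝ) (x : h) : ℝ := l.1 * x.1 + l.2.1 * x.2.1 + l.2.2 * x.2.2

/-- The coadjoint action `(Ad*(g) l)(x) = l(Ad(g⁻¹) x)` on `𝔥*` in coordinates. -/
theorem pair_adInv (l : ℝ × ℝ × ℝ) (g : G₀) (x : h) :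
    pair l (adInv g x) = pair
      (Real.exp (-g.2.1) * (l.1 - g.2.2 * l.2.1 + g.2.2 ^ 2 / 2 * l.2.2),
       Real.exp (-(g.1 + g.2.1) / 2) * (l.2.1 - g.2.2 * l.2.2),
       Real.exp (-g.1) * l.2.2) x := by
  simp only [pair, adInv]
  ring

/-- The unitary character `χ_l(exp x) = e^{i l(x)}` of `H`. -/
def χ (l : ℝ × ℝ × ℝ) (x : h) : ℂ := Complex.exp (Complex.I * (pair l x : ℝ))

theorem norm_χ (l : ℝ × ℝ × ℝ) (x : h) : ‖χ l x‖ = 1 := by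
  rw [χ, mul_comm]
  exact Complex.norm_exp_ofReal_mul_I _

theorem χ_add (l : ℝ × ℝ × ℝ) (x y : h) : χ l (x + y) = χ l x * χ l y := by
  rw [χ, χ, χ, ← Complex.exp_add]
  congr 1
  simp only [pair, Prod.fst_add, Prod.snd_add]
  push_cast
  ring

theorem χ_zero (l : ℝ × ℝ × ℝ) : χ l 0 = 1 := by
  simp [χ, pair]

theorem continuous_χ (l : ℝ × ℝ × ℝ) : Continuous (χ l) := by
  unfold χ pair
  fun_prop

/-! ### Multiplication operators and induced representations on `L²(G₀) = L²(ℝ³)` -/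

instance : (volume : Measure G₀).InnerRegularCompactLTTop :=
  inferInstanceAs (volume : Measure (ℝ × ℝ × ℝ)).InnerRegularCompactLTTop

/-- The Hilbert space `L²(ℝ³)`, where `ℝ³` is identified with `G₀` through `(a,b,p) ↦ E(a,b,p)`. -/
abbrev L2 : Type := Lp ℂ 2 (volume : Measure G₀)

theorem memLp_mul {m : G₀ → ℂ} (hm : Measurable m) (hb : ∀ x, ‖m x‖ ≤ 1) (ξ : L2) :
    MemLp (fun x => m x * ξ x) 2 volume := by
  refine (Lp.memLp ξ).mono (hm.aestronglyMeasurable.mul (Lp.aestronglyMeasurable ξ)) ?_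
  refine Filter.Eventually.of_forall fun x => ?_
  rw [norm_mul]
  exact mul_le_of_le_one_left (norm_nonneg _) (hb x)

/-- The multiplication operator `ξ ↦ m ξ` on `L²(ℝ³)`. -/
def mulOp (m : G₀ → ℂ) (hm : Measurable m) (hb : ∀ x, ‖m x‖ ≤ 1) : L2 →L[ℂ] L2 :=
  LinearMap.mkContinuous
    { toFun := fun ξ => (memLp_mul hm hb ξ).toLp _
      map_add' := by
        intro ξ η
        refine Lp.ext ?_
        filter_upwards [(memLp_mul hm hb (ξ + η)).coeFn_toLp, (memLp_mul hm hb ξ).coeFn_toLp,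
          (memLp_mul hm hb η).coeFn_toLp, Lp.coeFn_add ξ η,
          Lp.coeFn_add ((memLp_mul hm hb ξ).toLp _) ((memLp_mul hm hb η).toLp _)]
          with x h1 h2 h3 h4 h5
        rw [h1, h5, Pi.add_apply, h2, h3, h4, Pi.add_apply, mul_add]
      map_smul' := by
        intro c ξ
        refine Lp.ext ?_
        filter_upwards [(memLp_mul hm hb (c • ξ)).coeFn_toLp, (memLp_mul hm hb ξ).coeFn_toLp,
          Lp.coeFn_smul c ξ, Lp.coeFn_smul c ((memLp_mul hm hb ξ).toLp _)] with x h1 h2 h3 h4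
        rw [RingHom.id_apply, h1, h4, Pi.smul_apply, h2, h3, Pi.smul_apply, smul_eq_mul,
          smul_eq_mul, mul_left_comm] }
    1
    (by
      intro ξ
      rw [one_mul]
      refine Lp.norm_le_norm_of_ae_le ?_
      filter_upwards [(memLp_mul hm hb ξ).coeFn_toLp] with x h1
      change ‖((memLp_mul hm hb ξ).toLp _ : G₀ → ℂ) x‖ ≤ _
      rw [h1, norm_mul]
      exact mul_le_of_le_one_left (norm_nonneg _) (hb x))

theorem coeFn_mulOp {m : G₀ → ℂ} (hm : Measurable m) (hb : ∀ x, ‖m x‖ ≤ 1) (ξ : L2) :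
    mulOp m hm hb ξ =ᵐ[volume] fun x => m x * ξ x :=
  (memLp_mul hm hb ξ).coeFn_toLp

theorem norm_mulOp_apply_le {m : G₀ → ℂ} (hm : Measurable m) (hb : ∀ x, ‖m x‖ ≤ 1) (ξ : L2) :
    ‖mulOp m hm hb ξ‖ ≤ ‖ξ‖ := by
  refine Lp.norm_le_norm_of_ae_le ?_
  filter_upwards [coeFn_mulOp hm hb ξ] with x h1
  rw [h1, norm_mul]
  exact mul_le_of_le_one_left (norm_nonneg _) (hb x)

/-- The multiplication operator `M_S` with the characteristic function of a measurable set `S`. -/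
def indOp (S : Set G₀) (hS : MeasurableSet S) : L2 →L[ℂ] L2 :=
  mulOp (S.indicator fun _ => 1) (measurable_const.indicator hS) (fun x => by
    by_cases hx : x ∈ S <;> simp [hx])

/-- Multiplication by functions bounded by `1` that depend continuously on a parameter is strongly
continuous. -/
theorem continuous_mulOp_param {X : Type} [TopologicalSpace X] [FirstCountableTopology X]
    (m : X → G₀ → ℂ) (hm : ∀ t, Measurable (m t)) (hb : ∀ t x, ‖m t x‖ ≤ 1)
    (hc : ∀ x, Continuous fun t => m t x) (ξ : L2) :
    Continuous fun t => mulOp (m t) (hm t) (hb t) ξ := by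
  rw [continuous_iff_continuousAt]
  intro t₀
  rw [ContinuousAt, tendsto_iff_norm_sub_tendsto_zero]
  have key : ∀ t, ‖mulOp (m t) (hm t) (hb t) ξ - mulOp (m t₀) (hm t₀) (hb t₀) ξ‖ ^ 2
      = ∫ x, ‖(m t x - m t₀ x) * ξ x‖ ^ 2 := by
    intro t
    rw [← @inner_self_eq_norm_sq ℂ, L2.inner_def, ← integral_re (L2.integrable_inner _ _)]
    refine integral_congr_ae ?_
    filter_upwards [Lp.coeFn_sub (mulOp (m t) (hm t) (hb t) ξ) (mulOp (m t₀) (hm t₀) (hb t₀) ξ),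
      coeFn_mulOp (hm t) (hb t) ξ, coeFn_mulOp (hm t₀) (hb t₀) ξ] with x h1 h2 h3
    rw [inner_self_eq_norm_sq, h1, Pi.sub_apply, h2, h3, sub_mul]
  have hlim : Filter.Tendsto (fun t => ∫ x, ‖(m t x - m t₀ x) * ξ x‖ ^ 2) (𝓝 t₀) (𝓝 0) := by
    have h0 : (0 : ℝ) = ∫ x : G₀, ‖(m t₀ x - m t₀ x) * ξ x‖ ^ 2 := by simp
    rw [h0]
    refine tendsto_integral_filter_of_dominated_convergence (fun x => (2 * ‖ξ x‖) ^ 2) ?_ ?_ ?_ ?_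
    · refine Filter.Eventually.of_forall fun t => ?_
      exact ((((hm t).sub (hm t₀)).aestronglyMeasurable.mul
        (Lp.aestronglyMeasurable ξ)).norm.pow 2)
    · refine Filter.Eventually.of_forall fun t => Filter.Eventually.of_forall fun x => ?_
      rw [Real.norm_of_nonneg (by positivity), norm_mul]
      gcongr
      calc ‖m t x - m t₀ x‖ ≤ ‖m t x‖ + ‖m t₀ x‖ := norm_sub_le _ _
        _ ≤ 2 := by linarith [hb t x, hb t₀ x]
    · simp only [mul_pow]
      exact ((Lp.memLp ξ).integrable_norm_pow two_ne_zero).const_mul _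
    · refine Filter.Eventually.of_forall fun x => ?_
      exact (((((hc x).sub continuous_const).mul continuous_const).norm).pow 2).tendsto t₀
  have hsq := hlim.sqrt
  rw [Real.sqrt_zero] at hsq
  refine hsq.congr fun t => ?_
  rw [← key, Real.sqrt_sq (norm_nonneg _)]

/-- Left translation `ξ ↦ ξ(g⁻¹ ·)` on `L²(G₀)`. -/
def translate (g : G₀) (ξ : L2) : L2 := DomMulAct.mk g⁻¹ • ξ

theorem coeFn_translate (g : G₀) (ξ : L2) :
    translate g ξ =ᵐ[volume] fun y => ξ (g⁻¹ * y) :=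
  DomMulAct.smul_Lp_ae_eq (DomMulAct.mk g⁻¹) ξ

/-- The function `y ↦ χ_l(y⁻¹ g₀ x g₀⁻¹ y)` for `g = g₀ x` with `g₀ ∈ G₀`, `x ∈ H`. -/
def phase (l : ℝ × ℝ × ℝ) (g : G) (y : G₀) : ℂ := χ l (adInv (g.1⁻¹ * y) g.2)

theorem continuous_phase (l : ℝ × ℝ × ℝ) : Continuous fun z : G × G₀ => phase l z.1 z.2 :=
  (continuous_χ l).comp (continuous_adInv.comp
    ((((continuous_fst'.comp continuous_fst).inv).mul continuous_snd).prodMk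
      (continuous_snd'.comp continuous_fst)))

theorem continuous_phase_left (l : ℝ × ℝ × ℝ) (y : G₀) : Continuous fun g : G => phase l g y :=
  (continuous_χ l).comp (continuous_adInv.comp
    ((continuous_fst'.inv.mul continuous_const).prodMk continuous_snd'))

theorem measurable_phase (l : ℝ × ℝ × ℝ) (g : G) : Measurable (phase l g) :=
  ((continuous_phase l).comp (continuous_const.prodMk continuous_id)).measurable

theorem norm_phase (l : ℝ × ℝ × ℝ) (g : G) (y : G₀) : ‖phase l g y‖ = 1 := norm_χ _ _

/-- The operator of `ind_H^G χ_l` at `g = g₀ x`, with `g₀ ∈ G₀` and `x ∈ H`: it sends `ξ` to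
`y ↦ χ_l(y⁻¹ g₀ x g₀⁻¹ y) ξ(g₀⁻¹ y)`. -/
def indOperator (l : ℝ × ℝ × ℝ) (g : G) (ξ : L2) : L2 :=
  mulOp (phase l g) (measurable_phase l g) (fun y => (norm_phase l g y).le) (translate g.1 ξ)

theorem coeFn_indOperator (l : ℝ × ℝ × ℝ) (g : G) (ξ : L2) :
    indOperator l g ξ =ᵐ[volume] fun y => χ l (adInv (g.1⁻¹ * y) g.2) * ξ (g.1⁻¹ * y) := by
  filter_upwards [coeFn_mulOp (measurable_phase l g) (fun y => (norm_phase l g y).le)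
    (translate g.1 ξ), coeFn_translate g.1 ξ] with y h1 h2
  rw [indOperator, h1, h2, phase]

theorem norm_indOperator (l : ℝ × ℝ × ℝ) (g : G) (ξ : L2) : ‖indOperator l g ξ‖ = ‖ξ‖ := by
  have h : ‖translate g.1 ξ‖ = ‖ξ‖ := DomMulAct.norm_smul_Lp _ _
  rw [← h, Lp.norm_def, Lp.norm_def]
  congr 1
  refine eLpNorm_congr_norm_ae ?_
  filter_upwards [coeFn_mulOp (measurable_phase l g) (fun y => (norm_phase l g y).le)
    (translate g.1 ξ)] with y h1
  rw [indOperator, h1, norm_mul, norm_phase, one_mul]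

theorem continuous_translate (ξ : L2) : Continuous fun g : G => translate g.1 ξ := by
  have : Fact ((2 : ENNReal) ≠ ⊤) := ⟨ENNReal.ofNat_ne_top⟩
  have h : ContinuousSMul G₀ᵈᵐᵃ L2 := Lp.instContinuousSMulDomMulAct
  have h1 : Continuous fun g : G => DomMulAct.mk g.1⁻¹ :=
    DomMulAct.continuous_mk.comp continuous_fst'.inv
  exact h.continuous_smul.comp (h1.prodMk continuous_const)

theorem continuous_indOperator (l : ℝ × ℝ × ℝ) (ξ : L2) :
    Continuous fun g : G => indOperator l g ξ := by
  rw [continuous_iff_continuousAt]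
  intro g₀
  have h1 : Filter.Tendsto (fun g : G => ‖translate g.1 ξ - translate g₀.1 ξ‖) (𝓝 g₀) (𝓝 0) :=
    tendsto_iff_norm_sub_tendsto_zero.1 ((continuous_translate ξ).tendsto g₀)
  have h2 := tendsto_iff_norm_sub_tendsto_zero.1 ((continuous_mulOp_param (phase l)
    (measurable_phase l) (fun g y => (norm_phase l g y).le) (continuous_phase_left l)
    (translate g₀.1 ξ)).tendsto g₀)
  have h3 := h1.add h2
  rw [add_zero] at h3
  refine tendsto_iff_norm_sub_tendsto_zero.2
    (squeeze_zero (fun _ => norm_nonneg _) (fun g => ?_) h3)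
  have h4 : indOperator l g ξ - indOperator l g₀ ξ
      = mulOp (phase l g) (measurable_phase l g) (fun y => (norm_phase l g y).le)
          (translate g.1 ξ - translate g₀.1 ξ)
        + (mulOp (phase l g) (measurable_phase l g) (fun y => (norm_phase l g y).le)
            (translate g₀.1 ξ)
          - mulOp (phase l g₀) (measurable_phase l g₀) (fun y => (norm_phase l g₀ y).le)
            (translate g₀.1 ξ)) := by
    rw [map_sub, indOperator, indOperator]
    abel
  rw [h4]
  exact (norm_add_le _ _).trans (add_le_add (norm_mulOp_apply_le _ _ _) le_rfl)

/-- The unitary representation `ind_H^G χ_l` of `G`, realized on `L²(G/H, χ_l) = L²(G₀)`. It is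
`π_l` for `l = ε(Q* + S*)` and `σ_l` for `l = εS*` and `l ∈ ℝ Q*`. -/
def indRep (l : ℝ × ℝ × ℝ) : GroupCStar.UnitaryRep G L2 where
  toHom :=
    { toFun := fun g =>
        { toFun := indOperator l g
          map_add' := fun ξ η => by
            simp only [indOperator, translate]
            rw [smul_add, map_add]
          map_smul' := fun c ξ => by
            simp only [indOperator, translate, RingHom.id_apply]
            rw [smul_comm, map_smul]
          norm_map' := norm_indOperator l g }
      map_one' := by
        refine LinearIsometry.ext fun ξ => Lp.ext ?_
        filter_upwards [coeFn_indOperator l 1 ξ] with y h1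
        change indOperator l 1 ξ y = ξ y
        rw [h1]
        change χ l (adInv ((1 : G₀)⁻¹ * y) 0) * ξ ((1 : G₀)⁻¹ * y) = ξ y
        rw [adInv_zero, χ_zero, one_mul, inv_one, one_mul]
      map_mul' := by
        intro g g'
        refine LinearIsometry.ext fun ξ => Lp.ext ?_
        have hq := (measurePreserving_mul_left (volume : Measure G₀)
          g.1⁻¹).quasiMeasurePreserving.ae (coeFn_indOperator l g' ξ)
        filter_upwards [coeFn_indOperator l (g * g') ξ, coeFn_indOperator l g (indOperator l g' ξ),
          hq] with y h1 h2 h3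
        change indOperator l (g * g') ξ y = indOperator l g (indOperator l g' ξ) y
        rw [h1, h2, h3]
        change χ l (adInv ((g.1 * g'.1)⁻¹ * y) (adInv g'.1 g.2 + g'.2)) * ξ ((g.1 * g'.1)⁻¹ * y) = _
        rw [adInv_add, χ_add, ← adInv_mul, mul_inv_rev, mul_assoc, mul_assoc,
          mul_inv_cancel_left] }
  continuous_orbit := continuous_indOperator l

/-! ### The operators attached to the open orbits -/

/-- The partial Fourier transform `F̂(y, l) = ∫_𝔥 F(y exp x) χ_l(exp x) dx`. -/
def partialFourier (F : G → ℂ) (y : G₀) (l : ℝ × ℝ × ℝ) : ℂ := ∫ x : h, F (y, x) * χ l x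

/-- The space `L¹_c` of all `F ∈ L¹(G)` whose partial Fourier transform is (for almost every
`y ∈ G/H = ℝ³`, as `F` is only defined almost everywhere) a smooth function with compact support on
`G/H × 𝔥* = ℝ³ × ℝ³`. -/
def L1c : Set (Lp ℂ 1 (volume : Measure G)) :=
  {F | ∃ Φ : (ℝ × ℝ × ℝ) × (ℝ × ℝ × ℝ) → ℂ, ContDiff ℝ ∞ Φ ∧ HasCompactSupport Φ ∧
    ∀ᵐ y : G₀, ∀ l : ℝ × ℝ × ℝ, partialFourier F y l = Φ (y, l)}

/-- `S_{δ,1} = {(a,b,p) : e^{-a} > δ⁶}`. -/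
def S₁ (δ : ℝ) : Set G₀ := {y | δ ^ 6 < Real.exp (-y.1)}

/-- `S_{δ,2} = {(a,b,p) : e^{-a} ≤ δ⁶, e^{-b} < δ}`. -/
def S₂ (δ : ℝ) : Set G₀ := {y | Real.exp (-y.1) ≤ δ ^ 6 ∧ Real.exp (-y.2.1) < δ}

/-- `S_{δ,3,k} = [log(δ⁻⁶), ∞) × (-∞, log(δ⁻¹)] × [δ²k, δ²k + δ²)`. -/
def S₃ (δ : ℝ) (k : ℤ) : Set G₀ :=
  {y | Real.log (1 / δ ^ 6) ≤ y.1 ∧ y.2.1 ≤ Real.log (1 / δ) ∧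
    y.2.2 ∈ Set.Ico (δ ^ 2 * k) (δ ^ 2 * k + δ ^ 2)}

/-- `L_{δ,k} = ℝ × ℝ × [δ²k, δ²k + δ²)`. -/
def L (δ : ℝ) (k : ℤ) : Set G₀ := {y | y.2.2 ∈ Set.Ico (δ ^ 2 * k) (δ ^ 2 * k + δ ^ 2)}

/-- `T_{δ,3,k} = L_{δ,k-1} ∪ L_{δ,k} ∪ L_{δ,k+1}`. -/
def T₃ (δ : ℝ) (k : ℤ) : Set G₀ := L δ (k - 1) ∪ L δ k ∪ L δ (k + 1)

theorem measurable_a : Measurable fun y : G₀ => y.1 :=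
  measurable_fst (α := ℝ) (β := ℝ × ℝ)

theorem measurable_b : Measurable fun y : G₀ => y.2.1 :=
  (measurable_fst (α := ℝ) (β := ℝ)).comp (measurable_snd (α := ℝ) (β := ℝ × ℝ))

theorem measurable_p : Measurable fun y : G₀ => y.2.2 :=
  (measurable_snd (α := ℝ) (β := ℝ)).comp (measurable_snd (α := ℝ) (β := ℝ × ℝ))

theorem measurableSet_S₁ (δ : ℝ) : MeasurableSet (S₁ δ) :=
  measurableSet_lt measurable_const measurable_a.neg.exp

theorem measurableSet_S₂ (δ : ℝ) : MeasurableSet (S₂ δ) :=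
  (measurableSet_le measurable_a.neg.exp measurable_const).inter
    (measurableSet_lt measurable_b.neg.exp measurable_const)

theorem measurableSet_L (δ : ℝ) (k : ℤ) : MeasurableSet (L δ k) :=
  measurable_p measurableSet_Ico

theorem measurableSet_S₃ (δ : ℝ) (k : ℤ) : MeasurableSet (S₃ δ k) :=
  (measurableSet_le measurable_const measurable_a).inter
    ((measurableSet_le measurable_b measurable_const).inter (measurableSet_L δ k))

theorem measurableSet_T₃ (δ : ℝ) (k : ℤ) : MeasurableSet (T₃ δ k) :=
  ((measurableSet_L δ (k - 1)).union (measurableSet_L δ k)).union (measurableSet_L δ (k + 1))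

/-- `M_{δ,1}`. -/
def M₁ (δ : ℝ) : L2 →L[ℂ] L2 := indOp (S₁ δ) (measurableSet_S₁ δ)

/-- `M_{δ,2}`. -/
def M₂ (δ : ℝ) : L2 →L[ℂ] L2 := indOp (S₂ δ) (measurableSet_S₂ δ)

/-- `M_{δ,3,k}`. -/
def M₃ (δ : ℝ) (k : ℤ) : L2 →L[ℂ] L2 := indOp (S₃ δ k) (measurableSet_S₃ δ k)

/-- `N_{δ,3,k}`. -/
def N₃ (δ : ℝ) (k : ℤ) : L2 →L[ℂ] L2 := indOp (T₃ δ k) (measurableSet_T₃ δ k)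

/-- A real `C^∞` function `φ` on `ℝ` with support in `[-1, 1]`, `φ(0) = 1` and `‖φ‖_∞ = 1`. -/
structure IsCutoff (φ : ℝ → ℝ) : Prop where
  smooth : ContDiff ℝ ∞ φ
  support_subset : Function.support φ ⊆ Set.Icc (-1) 1
  map_zero : φ 0 = 1
  norm_le : ∀ t, |φ t| ≤ 1

/-- Multiplication with `(a,b,p) ↦ φ(e^{-b})`. -/
def Mφ (φ : ℝ → ℝ) (hφ : IsCutoff φ) : L2 →L[ℂ] L2 :=
  mulOp (fun y => (φ (Real.exp (-y.2.1)) : ℂ))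
    (Complex.measurable_ofReal.comp (hφ.smooth.continuous.measurable.comp measurable_b.neg.exp))
    (fun y => by simpa using hφ.norm_le _)

/-- `σ_l(F)` for `F ∈ L¹(G)`. -/
def σ (l : ℝ × ℝ × ℝ) : Lp ℂ 1 (volume : Measure G) →L[ℂ] L2 →L[ℂ] L2 :=
  (indRep l).integrated volume

/-- `σ_l(F)` for `F ∈ C*(G)`. -/
def σStar (l : ℝ × ℝ × ℝ) : GroupCStar.CStar (volume : Measure G) →L[ℂ] L2 →L[ℂ] L2 :=
  (indRep l).onCStar volume

/-- `R` is the operator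
`σ_{δ,3}(F) = ∑_{k ∈ ℤ} N_{δ,3,k} ∘ σ_{ε(1 + δ⁴k²/2)Q*}(F) ∘ M_{δ,3,k}`,
the series converging in the strong operator topology. -/
def IsSigma₃ (ε δ : ℝ) (F : Lp ℂ 1 (volume : Measure G)) (R : L2 →L[ℂ] L2) : Prop :=
  ∀ ξ : L2, HasSum
    (fun k : ℤ => N₃ δ k (σ (ε * (1 + δ ^ 4 * (k : ℝ) ^ 2 / 2), 0, 0) F (M₃ δ k ξ))) (R ξ)

/-- `T` is the operator `σ_{ε,ε,δ}(F) = σ_{εS*}(F) ∘ M_φ̃₁ ∘ M_{δ,1} + σ_{εS*}(F) ∘ M_{δ,2}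
+ σ_{δ,3}(F)`. It is unique, since a strongly convergent series has only one sum. -/
def IsSigma (ε : ℝ) (φ : ℝ → ℝ) (hφ : IsCutoff φ) (δ : ℝ) (F : Lp ℂ 1 (volume : Measure G))
    (T : L2 →L[ℂ] L2) : Prop :=
  ∃ R : L2 →L[ℂ] L2, IsSigma₃ ε δ F R ∧
    T = (σ (0, 0, ε) F).comp ((Mφ φ hφ).comp (M₁ δ)) + (σ (0, 0, ε) F).comp (M₂ δ) + R

end G6

end

noncomputable section

/-! ### Sums of operators with orthogonal ranges -/

section OrthogonalSums

variable {E : Type*} [NormedAddCommGroup E] [InnerProductSpace ℂ E]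

theorem norm_sq_sum_of_pairwise_inner_eq_zero {ι : Type*} {x : ι → E}
    (hx : ∀ i j, i ≠ j → inner ℂ (x i) (x j) = 0) (s : Finset ι) :
    ‖∑ i ∈ s, x i‖ ^ 2 = ∑ i ∈ s, ‖x i‖ ^ 2 := by
  classical
  have h : inner ℂ (∑ i ∈ s, x i) (∑ i ∈ s, x i) = ∑ i ∈ s, inner ℂ (x i) (x i) := by
    rw [sum_inner]
    refine Finset.sum_congr rfl fun i hi => ?_
    rw [inner_sum]
    exact Finset.sum_eq_single_of_mem i hi fun j _ hj => hx i j hj.symm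
  have h' := congrArg Complex.re h
  rw [Complex.re_sum] at h'
  rw [← @inner_self_eq_norm_sq ℂ]
  simp only [← @inner_self_eq_norm_sq ℂ]
  exact h'

variable [CompleteSpace E]

theorem summable_of_pairwise_inner_eq_zero {ι : Type*} {x : ι → E}
    (hx : ∀ i j, i ≠ j → inner ℂ (x i) (x j) = 0) {c : ℝ} (hc : 0 ≤ c)
    (hb : ∀ s : Finset ι, ∑ i ∈ s, ‖x i‖ ^ 2 ≤ c ^ 2) :
    Summable x ∧ ‖∑' i, x i‖ ≤ c := by
  have hs : Summable fun i => ‖x i‖ ^ 2 :=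
    summable_of_sum_le (fun i => by positivity) hb
  have h1 : Summable x := by
    rw [summable_iff_vanishing_norm] at hs ⊢
    intro ε hε
    obtain ⟨s, hs⟩ := hs (ε ^ 2) (by positivity)
    refine ⟨s, fun t ht => ?_⟩
    have h2 := hs t ht
    rw [← norm_sq_sum_of_pairwise_inner_eq_zero hx, Real.norm_of_nonneg (by positivity)] at h2
    exact lt_of_pow_lt_pow_left₀ 2 hε.le h2
  refine ⟨h1, le_of_tendsto h1.hasSum.norm (Filter.Eventually.of_forall fun s => ?_)⟩
  refine le_of_sq_le_sq ?_ hc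
  rw [norm_sq_sum_of_pairwise_inner_eq_zero hx]
  exact hb s

/-- A series `∑ P_k A_k Q_k` with mutually orthogonal ranges of the contractions `P_k` and
`∑ ‖Q_k x‖² ≤ ‖x‖²` converges strongly as soon as the `A_k` are uniformly bounded. -/
theorem summable_orthogonal_comp {ι : Type*} {P Q A : ι → E →L[ℂ] E} {c : ℝ} (hc : 0 ≤ c)
    (hP : ∀ i j, i ≠ j → ∀ x y, inner ℂ (P i x) (P j y) = 0) (hP1 : ∀ i x, ‖P i x‖ ≤ ‖x‖)
    (hQ : ∀ (s : Finset ι) x, ∑ i ∈ s, ‖Q i x‖ ^ 2 ≤ ‖x‖ ^ 2)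
    (hA : ∀ i x, ‖A i (Q i x)‖ ≤ c * ‖Q i x‖) (x : E) :
    Summable (fun i => P i (A i (Q i x))) ∧ ‖∑' i, P i (A i (Q i x))‖ ≤ c * ‖x‖ := by
  refine summable_of_pairwise_inner_eq_zero (fun i j hij => hP i j hij _ _) (by positivity) ?_
  intro s
  calc ∑ i ∈ s, ‖P i (A i (Q i x))‖ ^ 2 ≤ ∑ i ∈ s, c ^ 2 * ‖Q i x‖ ^ 2 := by
        refine Finset.sum_le_sum fun i _ => ?_
        rw [← mul_pow]
        gcongr
        exact (hP1 i _).trans (hA i x)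
    _ = c ^ 2 * ∑ i ∈ s, ‖Q i x‖ ^ 2 := (Finset.mul_sum _ _ _).symm
    _ ≤ c ^ 2 * ‖x‖ ^ 2 := by gcongr; exact hQ s x
    _ = (c * ‖x‖) ^ 2 := by ring

end OrthogonalSums

namespace G6

/-! ### Multiplication operators -/

theorem mulOp_mulOp {m m' : G₀ → ℂ} (hm : Measurable m) (hb : ∀ x, ‖m x‖ ≤ 1)
    (hm' : Measurable m') (hb' : ∀ x, ‖m' x‖ ≤ 1) (hb'' : ∀ x, ‖(m * m') x‖ ≤ 1) (ξ : L2) :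
    mulOp m hm hb (mulOp m' hm' hb' ξ) = mulOp (m * m') (hm.mul hm') hb'' ξ := by
  refine Lp.ext ?_
  filter_upwards [coeFn_mulOp hm hb (mulOp m' hm' hb' ξ), coeFn_mulOp hm' hb' ξ,
    coeFn_mulOp (hm.mul hm') hb'' ξ] with x h1 h2 h3
  rw [h1, h2, h3, Pi.mul_apply, mul_assoc]

theorem coeFn_indOp {S : Set G₀} (hS : MeasurableSet S) (ξ : L2) :
    indOp S hS ξ =ᵐ[volume] S.indicator ξ := by
  filter_upwards [coeFn_mulOp (measurable_const.indicator hS) _ ξ] with x h1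
  rw [indOp, h1]
  by_cases hx : x ∈ S <;> simp [hx]

theorem norm_indOp_apply_le {S : Set G₀} (hS : MeasurableSet S) (ξ : L2) :
    ‖indOp S hS ξ‖ ≤ ‖ξ‖ := norm_mulOp_apply_le _ _ _

theorem norm_mulOp_le {m : G₀ → ℂ} (hm : Measurable m) (hb : ∀ x, ‖m x‖ ≤ 1) :
    ‖mulOp m hm hb‖ ≤ 1 :=
  ContinuousLinearMap.opNorm_le_bound _ zero_le_one fun ξ => by
    simpa using norm_mulOp_apply_le hm hb ξ

theorem norm_indOp_le {S : Set G₀} (hS : MeasurableSet S) : ‖indOp S hS‖ ≤ 1 := norm_mulOp_le _ _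

theorem inner_indOp_eq_zero {S T : Set G₀} (hS : MeasurableSet S) (hT : MeasurableSet T)
    (hd : Disjoint S T) (ξ η : L2) : inner ℂ (indOp S hS ξ) (indOp T hT η) = 0 := by
  rw [L2.inner_def]
  refine integral_eq_zero_of_ae ?_
  filter_upwards [coeFn_indOp hS ξ, coeFn_indOp hT η] with x h1 h2
  rw [h1, h2]
  by_cases hx : x ∈ S
  · simp [Set.indicator_of_notMem (Set.disjoint_left.1 hd hx)]
  · simp [Set.indicator_of_notMem hx]

theorem sum_indOp {ι : Type*} {S : ι → Set G₀} (hS : ∀ i, MeasurableSet (S i))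
    (hd : Pairwise fun i j => Disjoint (S i) (S j)) (s : Finset ι) (ξ : L2) :
    ∑ i ∈ s, indOp (S i) (hS i) ξ
      = indOp (⋃ i ∈ s, S i) (s.measurableSet_biUnion fun i _ => hS i) ξ := by
  classical
  refine Lp.ext ?_
  have h : ∀ᵐ x : G₀, ∀ i ∈ s, indOp (S i) (hS i) ξ x = (S i).indicator ξ x :=
    (Finset.eventually_all s).2 fun i _ => coeFn_indOp (hS i) ξ
  filter_upwards [h, coeFn_indOp (s.measurableSet_biUnion fun i _ => hS i) ξ,
    Lp.coeFn_finsetSum s fun i => indOp (S i) (hS i) ξ] with x h1 h2 h3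
  rw [h2, h3, Finset.sum_apply, Finset.sum_congr rfl h1,
    Finset.indicator_biUnion_apply s S (fun i _ j _ hij => hd hij)]

theorem sum_norm_sq_indOp_le {ι : Type*} {S : ι → Set G₀} (hS : ∀ i, MeasurableSet (S i))
    (hd : Pairwise fun i j => Disjoint (S i) (S j)) (s : Finset ι) (ξ : L2) :
    ∑ i ∈ s, ‖indOp (S i) (hS i) ξ‖ ^ 2 ≤ ‖ξ‖ ^ 2 := by
  rw [← norm_sq_sum_of_pairwise_inner_eq_zero
    (fun i j hij => inner_indOp_eq_zero (hS i) (hS j) (hd hij) ξ ξ), sum_indOp hS hd]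
  gcongr
  exact norm_indOp_apply_le _ _

/-! ### The strips in the variable `p` -/

theorem pairwise_disjoint_L (δ : ℝ) : Pairwise fun j k => Disjoint (L δ j) (L δ k) := by
  have key : ∀ j k : ℤ, j < k → Disjoint (L δ j) (L δ k) := by
    intro j k hjk
    refine Set.disjoint_left.2 fun y hj hk => ?_
    have h1 : (j : ℝ) + 1 ≤ k := by exact_mod_cast hjk
    have h2 := mul_le_mul_of_nonneg_left h1 (sq_nonneg δ)
    have h3 := hj.2
    have h4 := hk.1
    linarith
  intro j k hjk
  rcases lt_or_gt_of_ne hjk with h | h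
  · exact key j k h
  · exact (key k j h).symm

theorem pairwise_disjoint_S₃ (δ : ℝ) : Pairwise fun j k => Disjoint (S₃ δ j) (S₃ δ k) :=
  fun _ _ hjk => (pairwise_disjoint_L δ hjk).mono (fun _ h => h.2.2) (fun _ h => h.2.2)

theorem N₃_apply (δ : ℝ) (k : ℤ) (ξ : L2) :
    N₃ δ k ξ = indOp (L δ (k - 1)) (measurableSet_L δ _) ξ + indOp (L δ k) (measurableSet_L δ _) ξ
      + indOp (L δ (k + 1)) (measurableSet_L δ _) ξ := by
  have d1 := pairwise_disjoint_L δ (show k - 1 ≠ k by omega)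
  have d2 := pairwise_disjoint_L δ (show k - 1 ≠ k + 1 by omega)
  have d3 := pairwise_disjoint_L δ (show k ≠ k + 1 by omega)
  refine Lp.ext ?_
  filter_upwards [coeFn_indOp (measurableSet_T₃ δ k) ξ,
    coeFn_indOp (measurableSet_L δ (k - 1)) ξ, coeFn_indOp (measurableSet_L δ k) ξ,
    coeFn_indOp (measurableSet_L δ (k + 1)) ξ,
    Lp.coeFn_add (indOp (L δ (k - 1)) (measurableSet_L δ _) ξ
      + indOp (L δ k) (measurableSet_L δ _) ξ) (indOp (L δ (k + 1)) (measurableSet_L δ _) ξ),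
    Lp.coeFn_add (indOp (L δ (k - 1)) (measurableSet_L δ _) ξ)
      (indOp (L δ k) (measurableSet_L δ _) ξ)] with x h1 h2 h3 h4 h5 h6
  rw [N₃, h1, h5, Pi.add_apply, h6, Pi.add_apply, h2, h3, h4, T₃,
    Set.indicator_union_of_disjoint (Disjoint.union_left d2 d3),
    Set.indicator_union_of_disjoint d1]

/-- The series `∑ N_{δ,3,k} A_k M_{δ,3,k}` converges strongly, with norm at most `3 sup ‖A_k‖`. -/
theorem summable_N₃_comp_M₃ (δ : ℝ) {A : ℤ → L2 →L[ℂ] L2} {c : ℝ} (hc : 0 ≤ c)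
    (hA : ∀ k ξ, ‖A k (M₃ δ k ξ)‖ ≤ c * ‖M₃ δ k ξ‖) (ξ : L2) :
    Summable (fun k => N₃ δ k (A k (M₃ δ k ξ))) ∧
      ‖∑' k, N₃ δ k (A k (M₃ δ k ξ))‖ ≤ 3 * c * ‖ξ‖ := by
  have key : ∀ j : ℤ, Summable (fun k : ℤ => indOp (L δ (k + j)) (measurableSet_L δ _)
      (A k (M₃ δ k ξ))) ∧ ‖∑' k : ℤ, indOp (L δ (k + j)) (measurableSet_L δ _)
      (A k (M₃ δ k ξ))‖ ≤ c * ‖ξ‖ := fun j =>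
    summable_orthogonal_comp (P := fun k => indOp (L δ (k + j)) (measurableSet_L δ _))
      (Q := M₃ δ) hc
      (fun k k' hk x y => inner_indOp_eq_zero _ _ (pairwise_disjoint_L δ (by omega)) x y)
      (fun k x => norm_indOp_apply_le _ _)
      (fun s x => sum_norm_sq_indOp_le (measurableSet_S₃ δ) (pairwise_disjoint_S₃ δ) s x) hA ξ
  obtain ⟨s1, b1⟩ := key (-1)
  obtain ⟨s2, b2⟩ := key 0
  obtain ⟨s3, b3⟩ := key 1
  have he : (fun k => N₃ δ k (A k (M₃ δ k ξ))) = fun k =>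
      indOp (L δ (k + -1)) (measurableSet_L δ _) (A k (M₃ δ k ξ))
      + indOp (L δ (k + 0)) (measurableSet_L δ _) (A k (M₃ δ k ξ))
      + indOp (L δ (k + 1)) (measurableSet_L δ _) (A k (M₃ δ k ξ)) := by
    funext k
    rw [N₃_apply]
    simp only [add_zero, ← sub_eq_add_neg]
  rw [he]
  refine ⟨(s1.add s2).add s3, ?_⟩
  rw [(s1.add s2).tsum_add s3, s1.tsum_add s2]
  exact (norm_add₃_le).trans (by linarith)

/-! ### The extension to the group C*-algebra -/

theorem σStar_ofL1 (l : ℝ × ℝ × ℝ) (F : Lp ℂ 1 (volume : Measure G)) :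
    σStar l (GroupCStar.ofL1 volume F) = σ l F :=
  GroupCStar.UnitaryRep.onCStar_ofL1 _ _ _

theorem norm_σStar_le (l : ℝ × ℝ × ℝ) (F : GroupCStar.CStar (volume : Measure G)) :
    ‖σStar l F‖ ≤ ‖F‖ := by
  refine (GroupCStar.denseRange_ofL1 (volume : Measure G)).induction_on
    (p := fun F => ‖σStar l F‖ ≤ ‖F‖) F
    (isClosed_le (σStar l).continuous.norm continuous_norm) fun F => ?_
  rw [σStar_ofL1]
  exact GroupCStar.norm_integrated_le_ofL1 volume (indRep l) F

/-! ### Right translation by `E(t, t, 0)` -/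

/-- The element `E(t, t, 0)`. -/
def diag (t : ℝ) : G₀ := ((t, t, 0) : ℝ × ℝ × ℝ)

theorem mul_diag (t : ℝ) (y : G₀) :
    y * diag t = ((y.1 + t, y.2.1 + t, y.2.2) : ℝ × ℝ × ℝ) := by
  rw [mul_def, diag]
  simp
  rfl

theorem measurePreserving_mul_diag (t : ℝ) :
    MeasurePreserving (fun y : G₀ => y * diag t) := by
  simp only [mul_diag]
  exact (measurePreserving_add_right (volume : Measure ℝ) t).prod
    ((measurePreserving_add_right (volume : Measure ℝ) t).prod (MeasurePreserving.id _))

/-- Right translation `ξ ↦ ξ(· E(t, t, 0))` on `L²(G₀)`. -/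
def rightDiag (t : ℝ) : L2 →ₗᵢ[ℂ] L2 :=
  Lp.compMeasurePreservingₗᵢ ℂ _ (measurePreserving_mul_diag t)

theorem coeFn_rightDiag (t : ℝ) (ξ : L2) :
    rightDiag t ξ =ᵐ[volume] fun y => ξ (y * diag t) :=
  Lp.coeFn_compMeasurePreserving ξ (measurePreserving_mul_diag t)

theorem χ_adInv_diag (c t : ℝ) (x : h) :
    χ (c, 0, 0) (adInv (diag t) x) = χ (Real.exp (-t) * c, 0, 0) x := by
  simp only [χ, pair, adInv, diag]
  congr 3
  ring

theorem rightDiag_indOperator (c t : ℝ) (g : G) (ξ : L2) :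
    rightDiag t (indOperator (c, 0, 0) g ξ)
      = indOperator (Real.exp (-t) * c, 0, 0) g (rightDiag t ξ) := by
  refine Lp.ext ?_
  have h1 := (measurePreserving_mul_diag t).quasiMeasurePreserving.ae
    (coeFn_indOperator (c, 0, 0) g ξ)
  have h2 := (measurePreserving_mul_left (volume : Measure G₀)
    g.1⁻¹).quasiMeasurePreserving.ae (coeFn_rightDiag t ξ)
  filter_upwards [coeFn_rightDiag t (indOperator (c, 0, 0) g ξ), h1, h2,
    coeFn_indOperator (Real.exp (-t) * c, 0, 0) g (rightDiag t ξ)] with y h3 h4 h5 h6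
  rw [h3, h4, h6, h5, ← mul_assoc, adInv_mul, χ_adInv_diag]

theorem rightDiag_σ (c t : ℝ) (F : Lp ℂ 1 (volume : Measure G)) (ξ : L2) :
    rightDiag t (σ (c, 0, 0) F ξ) = σ (Real.exp (-t) * c, 0, 0) F (rightDiag t ξ) := by
  rw [σ, σ, GroupCStar.UnitaryRep.integrated_apply, GroupCStar.UnitaryRep.integrated_apply]
  refine ((rightDiag t).toContinuousLinearMap.integral_comp_comm
    (GroupCStar.integrable_orbit _ _ F ξ)).symm.trans (integral_congr_ae ?_)
  refine Filter.Eventually.of_forall fun g => ?_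
  change rightDiag t (F g • indOperator (c, 0, 0) g ξ) = _
  rw [map_smul, rightDiag_indOperator]
  rfl

theorem rightDiag_σStar (c t : ℝ) (F : GroupCStar.CStar (volume : Measure G)) (ξ : L2) :
    rightDiag t (σStar (c, 0, 0) F ξ) = σStar (Real.exp (-t) * c, 0, 0) F (rightDiag t ξ) := by
  refine (GroupCStar.denseRange_ofL1 (volume : Measure G)).induction_on
    (p := fun F => rightDiag t (σStar (c, 0, 0) F ξ)
      = σStar (Real.exp (-t) * c, 0, 0) F (rightDiag t ξ)) F
    (isClosed_eq ?_ ?_) fun F => ?_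
  · exact (rightDiag t).continuous.comp ((σStar (c, 0, 0)).continuous.clm_apply continuous_const)
  · exact (σStar (Real.exp (-t) * c, 0, 0)).continuous.clm_apply continuous_const
  · rw [σStar_ofL1, σStar_ofL1, rightDiag_σ]

/-- The representations `σ_{cQ*}` for `c` of the same sign have the same norms. -/
theorem norm_σStar_mul_le {c : ℝ} (hc : 0 < c) (ε : ℝ)
    (F : GroupCStar.CStar (volume : Measure G)) :
    ‖σStar (ε * c, 0, 0) F‖ ≤ ‖σStar (ε, 0, 0) F‖ := by
  refine ContinuousLinearMap.opNorm_le_bound _ (norm_nonneg _) fun ξ => ?_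
  have h := rightDiag_σStar (ε * c) (Real.log c) F ξ
  have hc' : Real.exp (-Real.log c) * (ε * c) = ε := by
    rw [Real.exp_neg, Real.exp_log hc]
    field_simp
  rw [hc'] at h
  rw [← (rightDiag (Real.log c)).norm_map, h]
  refine (ContinuousLinearMap.le_opNorm _ _).trans_eq ?_
  rw [(rightDiag (Real.log c)).norm_map]

/-! ### The operators `σ_{ε,ε,δ}(F)` for `F ∈ C*(G)` -/

theorem one_add_pos (δ : ℝ) (k : ℤ) : 0 < 1 + δ ^ 4 * (k : ℝ) ^ 2 / 2 := by
  have : 0 ≤ δ ^ 4 * (k : ℝ) ^ 2 / 2 := by positivity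
  linarith

theorem summable_sigma₃ (ε δ : ℝ) (F : GroupCStar.CStar (volume : Measure G)) (ξ : L2) :
    Summable (fun k : ℤ =>
      N₃ δ k (σStar (ε * (1 + δ ^ 4 * (k : ℝ) ^ 2 / 2), 0, 0) F (M₃ δ k ξ))) ∧
    ‖∑' k : ℤ, N₃ δ k (σStar (ε * (1 + δ ^ 4 * (k : ℝ) ^ 2 / 2), 0, 0) F (M₃ δ k ξ))‖
      ≤ 3 * ‖σStar (ε, 0, 0) F‖ * ‖ξ‖ :=
  summable_N₃_comp_M₃ δ
    (A := fun k => σStar (ε * (1 + δ ^ 4 * (k : ℝ) ^ 2 / 2), 0, 0) F) (norm_nonneg _)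
    (fun k _ => (ContinuousLinearMap.le_opNorm _ _).trans (mul_le_mul_of_nonneg_right
      (norm_σStar_mul_le (one_add_pos δ k) ε F) (norm_nonneg _))) ξ

/-- `F ↦ ∑ N_{δ,3,k} σ_{ε(1 + δ⁴k²/2)Q*}(F) M_{δ,3,k}` on `C*(G)`. -/
def sigma₃ (ε δ : ℝ) : GroupCStar.CStar (volume : Measure G) →L[ℂ] L2 →L[ℂ] L2 :=
  LinearMap.mkContinuous₂
    (LinearMap.mk₂ ℂ (fun F ξ => ∑' k : ℤ,
        N₃ δ k (σStar (ε * (1 + δ ^ 4 * (k : ℝ) ^ 2 / 2), 0, 0) F (M₃ δ k ξ)))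
      (fun F F' ξ => by
        rw [← (summable_sigma₃ ε δ F ξ).1.tsum_add (summable_sigma₃ ε δ F' ξ).1]
        simp)
      (fun c F ξ => by
        rw [← (summable_sigma₃ ε δ F ξ).1.tsum_const_smul c]
        simp)
      (fun F ξ ξ' => by
        rw [← (summable_sigma₃ ε δ F ξ).1.tsum_add (summable_sigma₃ ε δ F ξ').1]
        simp)
      (fun c F ξ => by
        rw [← (summable_sigma₃ ε δ F ξ).1.tsum_const_smul c]
        simp))
    3
    (fun F ξ => (summable_sigma₃ ε δ F ξ).2.trans (by gcongr; exact norm_σStar_le _ F))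

theorem hasSum_sigma₃ (ε δ : ℝ) (F : GroupCStar.CStar (volume : Measure G)) (ξ : L2) :
    HasSum (fun k : ℤ =>
      N₃ δ k (σStar (ε * (1 + δ ^ 4 * (k : ℝ) ^ 2 / 2), 0, 0) F (M₃ δ k ξ))) (sigma₃ ε δ F ξ) :=
  (summable_sigma₃ ε δ F ξ).1.hasSum

theorem norm_sigma₃_le (ε δ : ℝ) (F : GroupCStar.CStar (volume : Measure G)) :
    ‖sigma₃ ε δ F‖ ≤ 3 * ‖σStar (ε, 0, 0) F‖ :=
  ContinuousLinearMap.opNorm_le_bound _ (by positivity) fun ξ => (summable_sigma₃ ε δ F ξ).2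

/-- The operators `σ_{ε,ε,δ}(F)` for `F ∈ C*(G)`. -/
def sigmaStar (ε : ℝ) (φ : ℝ → ℝ) (hφ : IsCutoff φ) (δ : ℝ) :
    GroupCStar.CStar (volume : Measure G) →L[ℂ] L2 →L[ℂ] L2 :=
  ((ContinuousLinearMap.compL ℂ L2 L2 L2).flip ((Mφ φ hφ).comp (M₁ δ) + M₂ δ)).comp
    (σStar (0, 0, ε)) + sigma₃ ε δ

theorem sigmaStar_apply (ε : ℝ) (φ : ℝ → ℝ) (hφ : IsCutoff φ) (δ : ℝ)
    (F : GroupCStar.CStar (volume : Measure G)) :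
    sigmaStar ε φ hφ δ F = (σStar (0, 0, ε) F).comp ((Mφ φ hφ).comp (M₁ δ))
      + (σStar (0, 0, ε) F).comp (M₂ δ) + sigma₃ ε δ F := by
  rw [← ContinuousLinearMap.comp_add]
  rfl

theorem isSigma_sigmaStar (ε : ℝ) (φ : ℝ → ℝ) (hφ : IsCutoff φ) (δ : ℝ)
    (F : Lp ℂ 1 (volume : Measure G)) :
    IsSigma ε φ hφ δ F (sigmaStar ε φ hφ δ (GroupCStar.ofL1 volume F)) := by
  refine ⟨sigma₃ ε δ (GroupCStar.ofL1 volume F), fun ξ => ?_, ?_⟩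
  · simpa only [σStar_ofL1] using hasSum_sigma₃ ε δ (GroupCStar.ofL1 volume F) ξ
  · rw [sigmaStar_apply, σStar_ofL1]

theorem IsSigma.unique {ε : ℝ} {φ : ℝ → ℝ} {hφ : IsCutoff φ} {δ : ℝ}
    {F : Lp ℂ 1 (volume : Measure G)} {T T' : L2 →L[ℂ] L2} (hT : IsSigma ε φ hφ δ F T)
    (hT' : IsSigma ε φ hφ δ F T') : T = T' := by
  obtain ⟨R, hR, rfl⟩ := hT
  obtain ⟨R', hR', rfl⟩ := hT'
  rw [ContinuousLinearMap.ext fun ξ => (hR ξ).unique (hR' ξ)]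

theorem norm_sigmaStar_le (ε : ℝ) (φ : ℝ → ℝ) (hφ : IsCutoff φ) (δ : ℝ)
    (F : GroupCStar.CStar (volume : Measure G)) :
    ‖sigmaStar ε φ hφ δ F‖ ≤ 2 * ‖σStar (0, 0, ε) F‖ + 3 * ‖σStar (ε, 0, 0) F‖ := by
  have h1 : ‖(σStar (0, 0, ε) F).comp ((Mφ φ hφ).comp (M₁ δ))‖ ≤ ‖σStar (0, 0, ε) F‖ := by
    refine (ContinuousLinearMap.opNorm_comp_le _ _).trans
      (mul_le_of_le_one_right (norm_nonneg _) ?_)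
    exact (ContinuousLinearMap.opNorm_comp_le _ _).trans
      (mul_le_one₀ (norm_mulOp_le _ _) (norm_nonneg _) (norm_indOp_le _))
  have h2 : ‖(σStar (0, 0, ε) F).comp (M₂ δ)‖ ≤ ‖σStar (0, 0, ε) F‖ :=
    (ContinuousLinearMap.opNorm_comp_le _ _).trans
      (mul_le_of_le_one_right (norm_nonneg _) (norm_indOp_le _))
  rw [sigmaStar_apply]
  refine norm_add₃_le.trans ?_
  linarith [norm_sigma₃_le ε δ F]

/-! ### Integrals of multiplication operators -/

theorem integral_smul_mulOp {X : Type} [TopologicalSpace X] [SecondCountableTopology X]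
    [MeasurableSpace X] [BorelSpace X] (μ : Measure X) [SFinite μ] {u : X → ℂ}
    (hu : Integrable u μ) {m : X → G₀ → ℂ} (hm : Continuous (Function.uncurry m))
    (hm' : ∀ x, Measurable (m x)) (hb : ∀ x y, ‖m x y‖ ≤ 1) {M : G₀ → ℂ} (hM : Measurable M)
    (hMb : ∀ y, ‖M y‖ ≤ 1) (hMeq : ∀ y, M y = ∫ x, u x * m x y ∂μ) (ξ : L2) :
    ∫ x, u x • mulOp (m x) (hm' x) (hb x) ξ ∂μ = mulOp M hM hMb ξ := by
  have hc : Continuous fun x => mulOp (m x) (hm' x) (hb x) ξ :=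
    continuous_mulOp_param m hm' hb (fun y => hm.comp (Continuous.prodMk_left y)) ξ
  have hint : Integrable (fun x => u x • mulOp (m x) (hm' x) (hb x) ξ) μ := by
    refine (hu.norm.mul_const ‖ξ‖).mono' (hu.aestronglyMeasurable.smul hc.aestronglyMeasurable) ?_
    refine Filter.Eventually.of_forall fun x => ?_
    rw [norm_smul]
    exact mul_le_mul_of_nonneg_left (norm_mulOp_apply_le _ _ _) (norm_nonneg _)
  refine ext_inner_left ℂ fun η => ?_
  rw [← integral_inner hint, L2.inner_def]
  have h1 : ∀ x, inner ℂ η (u x • mulOp (m x) (hm' x) (hb x) ξ)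
      = ∫ y, u x * m x y * inner ℂ (η y) (ξ y) := by
    intro x
    rw [inner_smul_right, L2.inner_def, ← integral_const_mul]
    refine integral_congr_ae ?_
    filter_upwards [coeFn_mulOp (hm' x) (hb x) ξ] with y hy
    rw [hy, mul_assoc, ← smul_eq_mul (m x y) (ξ y), inner_smul_right]
  have h2 : ∀ᵐ y : G₀, inner ℂ (η y) (mulOp M hM hMb ξ y)
      = ∫ x, u x * m x y * inner ℂ (η y) (ξ y) ∂μ := by
    filter_upwards [coeFn_mulOp hM hMb ξ] with y hy
    rw [hy, ← smul_eq_mul (M y) (ξ y), inner_smul_right, hMeq, integral_mul_const]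
  rw [integral_congr_ae h2]
  simp only [h1]
  refine integral_integral_swap ?_
  have h3 : Integrable (fun z : X × G₀ => u z.1 * inner ℂ (η z.2) (ξ z.2)) (μ.prod volume) :=
    hu.mul_prod (L2.integrable_inner η ξ)
  have h4 := h3.bdd_mul (c := 1) hm.aestronglyMeasurable
    (Filter.Eventually.of_forall fun z => hb z.1 z.2)
  refine h4.congr (Filter.Eventually.of_forall fun z => ?_)
  simp only [Function.uncurry]
  ring

/-! ### The left regular representation of `G₀` -/

/-- The left regular representation of `G₀`. -/
def leftReg : GroupCStar.UnitaryRep G₀ L2 where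
  toHom :=
    { toFun := fun g =>
        { toFun := translate g
          map_add' := fun ξ η => smul_add _ _ _
          map_smul' := fun c ξ => smul_comm _ _ _
          norm_map' := fun ξ => DomMulAct.norm_smul_Lp _ _ }
      map_one' := by
        refine LinearIsometry.ext fun ξ => Lp.ext ?_
        filter_upwards [coeFn_translate 1 ξ] with y h1
        change translate 1 ξ y = ξ y
        rw [h1, inv_one, one_mul]
      map_mul' := by
        intro g g'
        refine LinearIsometry.ext fun ξ => Lp.ext ?_
        have hq := (measurePreserving_mul_left (volume : Measure G₀)
          g⁻¹).quasiMeasurePreserving.ae (coeFn_translate g' ξ)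
        filter_upwards [coeFn_translate (g * g') ξ, coeFn_translate g (translate g' ξ), hq]
          with y h1 h2 h3
        change translate (g * g') ξ y = translate g (translate g' ξ) y
        rw [h1, h2, h3, mul_inv_rev, mul_assoc] }
  continuous_orbit := fun ξ => by
    have : Fact ((2 : ENNReal) ≠ ⊤) := ⟨ENNReal.ofNat_ne_top⟩
    have h : ContinuousSMul G₀ᵈᵐᵃ L2 := Lp.instContinuousSMulDomMulAct
    have h1 : Continuous fun g : G₀ => DomMulAct.mk g⁻¹ :=
      DomMulAct.continuous_mk.comp continuous_inv
    exact h.continuous_smul.comp (h1.prodMk continuous_const)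

theorem leftReg_apply (g : G₀) (ξ : L2) : leftReg.toHom g ξ = translate g ξ := rfl

theorem integrable_smul_leftReg {f : G₀ → ℂ} (hf : Integrable f) (ξ : L2) :
    Integrable fun g => f g • leftReg.toHom g ξ := by
  refine (hf.norm.mul_const ‖ξ‖).mono'
    (hf.aestronglyMeasurable.smul (leftReg.continuous_orbit ξ).aestronglyMeasurable) ?_
  exact Filter.Eventually.of_forall fun g => by simp [norm_smul]

/-- Left convolution by an integrable function on `G₀`. -/
def conv (f : G₀ → ℂ) (hf : Integrable f) : L2 →L[ℂ] L2 :=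
  leftReg.integrated volume (hf.toL1 f)

theorem conv_apply {f : G₀ → ℂ} (hf : Integrable f) (ξ : L2) :
    conv f hf ξ = ∫ g, f g • leftReg.toHom g ξ := by
  rw [conv, GroupCStar.UnitaryRep.integrated_apply]
  refine integral_congr_ae ?_
  filter_upwards [hf.coeFn_toL1] with g hg
  rw [hg]

/-! ### Product functions on `G = G₀ H` -/

/-- The Fourier transform `∫_𝔥 u(x) e^{iλ(x)} dx` on `𝔥`. -/
def hat (u : h → ℂ) (l : ℝ × ℝ × ℝ) : ℂ := ∫ x : h, u x * χ l x

/-- The coadjoint action of `G₀` on `𝔥*`. -/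
def coad (l : ℝ × ℝ × ℝ) (z : G₀) : ℝ × ℝ × ℝ :=
  (Real.exp (-z.2.1) * (l.1 - z.2.2 * l.2.1 + z.2.2 ^ 2 / 2 * l.2.2),
    Real.exp (-(z.1 + z.2.1) / 2) * (l.2.1 - z.2.2 * l.2.2), Real.exp (-z.1) * l.2.2)

theorem continuous_coad (l : ℝ × ℝ × ℝ) : Continuous (coad l) := by
  change Continuous fun z : ℝ × ℝ × ℝ =>
    ((Real.exp (-z.2.1) * (l.1 - z.2.2 * l.2.1 + z.2.2 ^ 2 / 2 * l.2.2),
      Real.exp (-(z.1 + z.2.1) / 2) * (l.2.1 - z.2.2 * l.2.2),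
      Real.exp (-z.1) * l.2.2) : ℝ × ℝ × ℝ)
  fun_prop

theorem χ_adInv (l : ℝ × ℝ × ℝ) (z : G₀) (x : h) : χ l (adInv z x) = χ (coad l z) x := by
  rw [χ, χ, pair_adInv]
  rfl

theorem indOperator_mk (l : ℝ × ℝ × ℝ) (g : G₀) (x : h) (hm : Measurable fun z => χ (coad l z) x)
    (hb : ∀ z, ‖χ (coad l z) x‖ ≤ 1) (ξ : L2) :
    indOperator l (g, x) ξ = leftReg.toHom g (mulOp (fun z => χ (coad l z) x) hm hb ξ) := by
  rw [leftReg_apply]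
  refine Lp.ext ?_
  have hq := (measurePreserving_mul_left (volume : Measure G₀)
    g⁻¹).quasiMeasurePreserving.ae (coeFn_mulOp hm hb ξ)
  filter_upwards [coeFn_indOperator l (g, x) ξ,
    coeFn_translate g (mulOp (fun z => χ (coad l z) x) hm hb ξ), hq] with y h1 h2 h3
  rw [h1, h2, h3, χ_adInv]

theorem norm_hat_le (u : h → ℂ) (l : ℝ × ℝ × ℝ) :
    ‖hat u l‖ ≤ ∫ x, ‖u x‖ := by
  refine (norm_integral_le_integral_norm _).trans_eq ?_
  simp [norm_χ]

theorem continuous_χ_uncurry : Continuous fun z : (ℝ × ℝ × ℝ) × h => χ z.1 z.2 := by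
  unfold χ pair
  fun_prop

theorem continuous_hat {u : h → ℂ} (hu : Integrable u) : Continuous (hat u) := by
  refine continuous_of_dominated (bound := fun x => ‖u x‖) (fun l => ?_) (fun l => ?_) hu.norm ?_
  · exact hu.aestronglyMeasurable.mul (continuous_χ l).aestronglyMeasurable
  · exact Filter.Eventually.of_forall fun x => by rw [norm_mul, norm_χ, mul_one]
  · exact Filter.Eventually.of_forall fun x => continuous_const.mul
      (continuous_χ_uncurry.comp (Continuous.prodMk_left x))

theorem integrable_tensor {f : G₀ → ℂ} (hf : Integrable f) {u : h → ℂ} (hu : Integrable u) :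
    Integrable (fun g : G => f g.1 * u g.2) :=
  hf.mul_prod hu

/-- The element `f ⊗ u` of `L¹(G)`. -/
def tensor (f : G₀ → ℂ) (hf : Integrable f) (u : h → ℂ) (hu : Integrable u) :
    Lp ℂ 1 (volume : Measure G) :=
  (integrable_tensor hf hu).toL1 _

/-- `σ_l(f ⊗ u)` is multiplication by `z ↦ û(Ad*(z) l)` followed by left convolution by `f`. -/
theorem σ_tensor (l : ℝ × ℝ × ℝ) {f : G₀ → ℂ} (hf : Integrable f) {u : h → ℂ} (hu : Integrable u)
    (hm : Measurable fun z => hat u (coad l z)) (hb : ∀ z, ‖hat u (coad l z)‖ ≤ 1) :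
    σ l (tensor f hf u hu) = (conv f hf).comp (mulOp (fun z => hat u (coad l z)) hm hb) := by
  refine ContinuousLinearMap.ext fun ξ => ?_
  rw [ContinuousLinearMap.comp_apply, conv_apply, σ, GroupCStar.UnitaryRep.integrated_apply]
  have h1 : (fun g : G => (tensor f hf u hu) g • (indRep l).toHom g ξ) =ᵐ[volume]
      fun g : G => (f g.1 * u g.2) • (indRep l).toHom g ξ := by
    filter_upwards [(integrable_tensor hf hu).coeFn_toL1] with g hg
    rw [tensor, hg]
  have h2 := (GroupCStar.integrable_orbit (indRep l) volume (tensor f hf u hu) ξ).congr h1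
  refine (integral_congr_ae h1).trans ?_
  refine (integral_prod (μ := (volume : Measure G₀)) (ν := (volume : Measure h))
    (fun g : G₀ × h => (f g.1 * u g.2) • (indRep l).toHom g ξ) h2).trans ?_
  refine integral_congr_ae (Filter.Eventually.of_forall fun g => ?_)
  have hc : Continuous (Function.uncurry fun (x : h) (z : G₀) => χ (coad l z) x) :=
    continuous_χ_uncurry.comp (((continuous_coad l).comp continuous_snd).prodMk continuous_fst)
  have h3 := integral_smul_mulOp (volume : Measure h) hu
    (m := fun x z => χ (coad l z) x) hc
    (fun x => (hc.comp (Continuous.prodMk_right x)).measurable)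
    (fun x z => (norm_χ _ _).le) hm hb (fun z => rfl) ξ
  change ∫ x : h, (f g * u x) • indOperator l (g, x) ξ = _
  rw [← h3]
  have h4 : ∀ x : h, (f g * u x) • indOperator l (g, x) ξ
      = f g • (leftReg.toHom g).toContinuousLinearMap (u x • mulOp (fun z => χ (coad l z) x)
        (hc.comp (Continuous.prodMk_right x)).measurable (fun z => (norm_χ _ _).le) ξ) := by
    intro x
    rw [map_smul, mul_smul, indOperator_mk l g x
      (hc.comp (Continuous.prodMk_right x)).measurable (fun z => (norm_χ _ _).le)]
    rfl
  simp only [h4]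
  rw [integral_smul, ContinuousLinearMap.integral_comp_comm]
  · rfl
  · refine (hu.norm.mul_const ‖ξ‖).mono' (hu.aestronglyMeasurable.smul
      (continuous_mulOp_param _ _ _ (fun z => hc.comp (Continuous.prodMk_left z))
        ξ).aestronglyMeasurable) ?_
    refine Filter.Eventually.of_forall fun x => ?_
    rw [norm_smul]
    exact mul_le_mul_of_nonneg_left (norm_mulOp_apply_le _ _ _) (norm_nonneg _)

end G6

/-! ### Compactness of integral operators with a continuous vector-valued kernel -/

theorem isCompactOperator_of_forall_finiteDimensional_approx {E F : Type*}
    [NormedAddCommGroup E] [NormedSpace ℂ E]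
    [NormedAddCommGroup F] [InnerProductSpace ℂ F] [CompleteSpace F] (T : E →L[ℂ] F)
    (h : ∀ ε > 0, ∃ V : Submodule ℂ F, ∃ _ : FiniteDimensional ℂ V,
      ‖T - V.starProjection.comp T‖ ≤ ε) : IsCompactOperator T := by
  refine isClosed_setOfPred_isCompactOperator.closure_subset
    (show T ∈ closure {S : E →L[ℂ] F | IsCompactOperator S} from ?_)
  refine Metric.mem_closure_iff.2 fun ε hε => ?_
  obtain ⟨V, _, hV⟩ := h (ε / 2) (half_pos hε)
  refine ⟨V.starProjection.comp T, ?_, ?_⟩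
  · exact (isCompactOperator_of_locallyCompactSpace_rng V.subtypeL).comp_clm
      (V.orthogonalProjectionOnto.comp T)
  · rw [dist_eq_norm]
    linarith

theorem setIntegral_norm_le_mul_norm {α : Type*} [MeasurableSpace α] {μ : Measure α} {B : Set α}
    (hB : MeasurableSet B) (hμB : μ B ≠ ⊤) (ξ : Lp ℂ 2 μ) :
    ∫ x in B, ‖ξ x‖ ∂μ ≤ ‖indicatorConstLp 2 hB hμB (1 : ℝ)‖ * ‖ξ‖ := by
  have h := L2.inner_indicatorConstLp_one (𝕜 := ℝ) hB hμB ((Lp.memLp ξ).norm.toLp _)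
  have h2 : ∫ x in B, ‖ξ x‖ ∂μ = ∫ x in B, ((Lp.memLp ξ).norm.toLp _) x ∂μ := by
    refine integral_congr_ae (ae_restrict_of_ae ?_)
    filter_upwards [(Lp.memLp ξ).norm.coeFn_toLp] with x hx
    rw [hx]
  rw [h2, ← h]
  refine (real_inner_le_norm _ _).trans_eq ?_
  congr 1
  rw [Lp.norm_toLp, eLpNorm_norm, Lp.norm_def]

theorem integrableOn_of_memLp_two {α : Type*} [MeasurableSpace α] {μ : Measure α} {B : Set α}
    (hμB : μ B ≠ ⊤) (ξ : Lp ℂ 2 μ) : IntegrableOn ξ B μ := by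
  have : IsFiniteMeasure (μ.restrict B) := ⟨by rw [Measure.restrict_apply_univ]; exact hμB.lt_top⟩
  exact ((Lp.memLp ξ).restrict B).integrable one_le_two

theorem isCompactOperator_of_continuous_kernel {α : Type*} [TopologicalSpace α]
    [MeasurableSpace α] {μ : Measure α} {F : Type*} [NormedAddCommGroup F]
    [InnerProductSpace ℂ F] [CompleteSpace F] {B : Set α} (hB : IsCompact B)
    (hBm : MeasurableSet B) (hμB : μ B ≠ ⊤) {κ : α → F} (hκ : ContinuousOn κ B)
    (T : Lp ℂ 2 μ →L[ℂ] F)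
    (hT : ∀ ξ η, inner ℂ η (T ξ) = ∫ x in B, ξ x * inner ℂ η (κ x) ∂μ) :
    IsCompactOperator T := by
  set c := ‖indicatorConstLp 2 hBm hμB (1 : ℝ)‖ with hc
  refine isCompactOperator_of_forall_finiteDimensional_approx T fun ε hε => ?_
  obtain ⟨t, ht, hcov⟩ := Metric.totallyBounded_iff.1
    (hB.image_of_continuousOn hκ).totallyBounded (ε / (c + 1)) (by positivity)
  have hfin : FiniteDimensional ℂ (Submodule.span ℂ t) := FiniteDimensional.span_of_finite ℂ ht
  refine ⟨Submodule.span ℂ t, hfin, ?_⟩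
  set V := Submodule.span ℂ t
  have hdist : ∀ x ∈ B, ‖κ x - V.starProjection (κ x)‖ ≤ ε / (c + 1) := by
    intro x hx
    obtain ⟨v, hv, hxv⟩ := Set.mem_iUnion₂.1 (hcov (Set.mem_image_of_mem κ hx))
    rw [Submodule.starProjection_minimal]
    refine (ciInf_le ⟨0, ?_⟩ (⟨v, Submodule.subset_span hv⟩ : V)).trans ?_
    · rintro _ ⟨w, rfl⟩
      exact norm_nonneg _
    · rw [← dist_eq_norm]
      exact hxv.le
  refine ContinuousLinearMap.opNorm_le_bound _ hε.le fun ξ => ?_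
  have hsym : ∀ η w : F, inner ℂ η (w - V.starProjection w)
      = inner ℂ (η - V.starProjection η) w := by
    intro η w
    rw [inner_sub_left, inner_sub_right, Submodule.inner_starProjection_left_eq_right]
  have key : ∀ η, ‖inner ℂ η ((T - V.starProjection.comp T) ξ)‖
      ≤ ε / (c + 1) * ‖η‖ * (c * ‖ξ‖) := by
    intro η
    have h1 : inner ℂ η ((T - V.starProjection.comp T) ξ)
        = ∫ x in B, ξ x * inner ℂ η (κ x - V.starProjection (κ x)) ∂μ := by
      change inner ℂ η (T ξ - V.starProjection (T ξ)) = _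
      rw [hsym, hT]
      simp only [hsym]
    rw [h1]
    refine (norm_integral_le_of_norm_le (g := fun x => ε / (c + 1) * ‖η‖ * ‖ξ x‖)
      ((integrableOn_of_memLp_two hμB ξ).norm.const_mul _) ?_).trans ?_
    · filter_upwards [ae_restrict_mem hBm] with x hx
      rw [norm_mul, mul_comm]
      refine mul_le_mul_of_nonneg_right ((norm_inner_le_norm _ _).trans ?_) (norm_nonneg _)
      rw [mul_comm]
      exact mul_le_mul_of_nonneg_right (hdist x hx) (norm_nonneg _)
    · rw [integral_const_mul]
      exact mul_le_mul_of_nonneg_left (setIntegral_norm_le_mul_norm hBm hμB ξ) (by positivity)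
  set v := (T - V.starProjection.comp T) ξ
  have h2 := key v
  rw [inner_self_eq_norm_sq_to_K, norm_pow, RCLike.norm_ofReal, abs_norm] at h2
  rcases (norm_nonneg v).eq_or_lt with h0 | h0
  · rw [← h0]
    positivity
  · refine (le_of_mul_le_mul_left (?_ : ‖v‖ * ‖v‖ ≤ ‖v‖ * (ε / (c + 1) * (c * ‖ξ‖))) h0).trans ?_
    · linarith
    · rw [div_mul_eq_mul_div, div_le_iff₀ (by positivity)]
      have : 0 ≤ ε * ‖ξ‖ := by positivity
      nlinarith

namespace G6

/-! ### Right translations of `G₀` -/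

theorem map_mul_right_volume (z : G₀) :
    Measure.map (fun g : G₀ => g * z) volume
      = ENNReal.ofReal (Real.exp (-(z.2.1 - z.1) / 2)) • (volume : Measure G₀) := by
  set c := Real.exp ((z.2.1 - z.1) / 2) with hc
  have hc0 : c ≠ 0 := (Real.exp_pos _).ne'
  have h3 : Measure.map (fun p : ℝ => c * p + z.2.2) volume
      = ENNReal.ofReal (Real.exp (-(z.2.1 - z.1) / 2)) • (volume : Measure ℝ) := by
    have : (fun p : ℝ => c * p + z.2.2) = (fun p => p + z.2.2) ∘ (c * ·) := rfl
    rw [this, ← Measure.map_map (by fun_prop) (by fun_prop), Real.map_volume_mul_left hc0,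
      Measure.map_smul, map_add_right_eq_self, abs_of_pos (inv_pos.2 (Real.exp_pos _)),
      ← Real.exp_neg, neg_div]
  have h2 := Measure.map_prod_map (volume : Measure ℝ) (volume : Measure ℝ)
    (f := fun b : ℝ => b + z.2.1) (g := fun p : ℝ => c * p + z.2.2) (by fun_prop) (by fun_prop)
  rw [h3, map_add_right_eq_self, Measure.prod_smul_right] at h2
  have h1 := Measure.map_prod_map (volume : Measure ℝ)
    ((volume : Measure ℝ).prod (volume : Measure ℝ))
    (f := fun a : ℝ => a + z.1)
    (g := Prod.map (fun b : ℝ => b + z.2.1) fun p : ℝ => c * p + z.2.2) (by fun_prop) (by fun_prop)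
  rw [← h2, map_add_right_eq_self, Measure.prod_smul_right] at h1
  exact h1.symm

theorem integral_mul_right_eq (z : G₀) (Ψ : G₀ → ℂ) :
    ∫ g, Ψ (g * z) = (Real.exp (-(z.2.1 - z.1) / 2) : ℂ) * ∫ y, Ψ y := by
  have h := integral_map_equiv (μ := (volume : Measure G₀)) (MeasurableEquiv.mulRight z) Ψ
  have h' : Measure.map (MeasurableEquiv.mulRight z) (volume : Measure G₀)
      = ENNReal.ofReal (Real.exp (-(z.2.1 - z.1) / 2)) • (volume : Measure G₀) :=
    map_mul_right_volume z
  rw [h', integral_smul_measure, ENNReal.toReal_ofReal (Real.exp_pos _).le] at h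
  exact h.symm

/-! ### Compactness of convolution operators cut off to compact sets -/

theorem integrable_conv_kernel {f : G₀ → ℂ} (hf : Integrable f) (η ξ : L2) :
    Integrable (Function.uncurry fun g z : G₀ => f g * inner ℂ (η (g * z)) (ξ z))
      (volume.prod volume) := by
  have hcomp : ∀ g : G₀, inner ℂ (translate g⁻¹ η) ξ = ∫ z, inner ℂ (η (g * z)) (ξ z) := by
    intro g
    rw [L2.inner_def]
    refine integral_congr_ae ?_
    filter_upwards [coeFn_translate g⁻¹ η] with z hz
    rw [hz, inv_inv]
  have hint : ∀ g : G₀, Integrable fun z => inner ℂ (η (g * z)) (ξ z) := by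
    intro g
    refine (L2.integrable_inner (𝕜 := ℂ) (translate g⁻¹ η) ξ).congr ?_
    filter_upwards [coeFn_translate g⁻¹ η] with z hz
    rw [hz, inv_inv]
  have hm : AEStronglyMeasurable
      (Function.uncurry fun g z : G₀ => f g * inner ℂ (η (g * z)) (ξ z))
      (volume.prod volume) := by
    refine hf.aestronglyMeasurable.comp_fst.mul (AEStronglyMeasurable.inner ?_ ?_)
    · exact ((Lp.stronglyMeasurable η).comp_measurable
        (continuous_mul (M := G₀)).measurable).aestronglyMeasurable
    · exact (Lp.aestronglyMeasurable ξ).comp_snd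
  rw [integrable_prod_iff hm]
  refine ⟨Filter.Eventually.of_forall fun g => (hint g).const_mul (f g), ?_⟩
  refine (hf.norm.mul_const (‖η‖ * ‖ξ‖)).mono' hm.norm.integral_prod_right' ?_
  refine Filter.Eventually.of_forall fun g => ?_
  rw [Real.norm_of_nonneg (integral_nonneg fun _ => norm_nonneg _)]
  simp only [Function.uncurry, norm_mul, integral_const_mul]
  refine mul_le_mul_of_nonneg_left ?_ (norm_nonneg _)
  have hη := (Lp.memLp (translate g⁻¹ η)).norm
  have hξ := (Lp.memLp ξ).norm
  have h1 : ∫ z, ‖(inner ℂ (η (g * z)) (ξ z) : ℂ)‖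
      ≤ inner ℝ (hη.toLp _) (hξ.toLp _) := by
    rw [L2.inner_def]
    refine integral_mono_ae (hint g).norm (L2.integrable_inner _ _) ?_
    filter_upwards [coeFn_translate g⁻¹ η, hη.coeFn_toLp, hξ.coeFn_toLp] with z h1 h2 h3
    rw [h2, h3, h1, inv_inv]
    refine (norm_inner_le_norm _ _).trans_eq ?_
    simp [mul_comm]
  refine h1.trans ((real_inner_le_norm _ _).trans_eq ?_)
  have h2 : ‖translate g⁻¹ η‖ = ‖η‖ := DomMulAct.norm_smul_Lp _ _
  rw [Lp.norm_toLp, Lp.norm_toLp, eLpNorm_norm, eLpNorm_norm, ← Lp.norm_def, ← Lp.norm_def, h2]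

theorem inner_conv {f : G₀ → ℂ} (hf : Integrable f) (η ξ : L2) :
    inner ℂ η (conv f hf ξ) = ∫ z, ∫ g, f g * inner ℂ (η (g * z)) (ξ z) := by
  rw [conv_apply, ← integral_inner (integrable_smul_leftReg hf ξ),
    ← integral_integral_swap (integrable_conv_kernel hf η ξ)]
  refine integral_congr_ae (Filter.Eventually.of_forall fun g => ?_)
  simp only [inner_smul_right, integral_const_mul]
  congr 1
  rw [L2.inner_def, leftReg_apply,
    ← integral_mul_left_eq_self (fun y => inner ℂ (η y) (translate g ξ y)) g]
  refine integral_congr_ae ?_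
  have hq := (measurePreserving_mul_left (volume : Measure G₀)
    g).quasiMeasurePreserving.ae (coeFn_translate g ξ)
  filter_upwards [hq] with z hz
  rw [hz, inv_mul_cancel_left]

open scoped Pointwise in
theorem isCompactOperator_conv_comp_indOp {f : G₀ → ℂ} (hf : Integrable f) (hfc : Continuous f)
    (hfs : HasCompactSupport f) (hf1 : ∀ g, ‖f g‖ ≤ 1) {B : Set G₀} (hB : IsCompact B) :
    IsCompactOperator ((conv f hf).comp (indOp B hB.measurableSet)) := by
  have hD : IsCompact (tsupport f * B) := hfs.isCompact.mul hB
  have hmc : Continuous fun w : G₀ × G₀ => f (w.2 * w.1⁻¹) :=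
    hfc.comp (continuous_snd.mul continuous_fst.inv)
  set κ' : G₀ → L2 := fun z => mulOp (fun y => f (y * z⁻¹))
    (hmc.comp (Continuous.prodMk_right z)).measurable (fun y => hf1 _)
    (indicatorConstLp 2 hD.measurableSet hD.measure_lt_top.ne 1) with hκ'
  have hκ'c : Continuous κ' := continuous_mulOp_param _ _ _
    (fun y => hmc.comp (Continuous.prodMk_left y)) _
  have hc : Continuous fun z : G₀ => (Real.exp (-(z.2.1 - z.1) / 2) : ℂ) := by
    change Continuous fun z : ℝ × ℝ × ℝ => (Real.exp (-(z.2.1 - z.1) / 2) : ℂ)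
    fun_prop
  refine isCompactOperator_of_continuous_kernel hB hB.measurableSet hB.measure_lt_top.ne
    (hc.smul hκ'c).continuousOn _ fun ξ η => ?_
  rw [ContinuousLinearMap.comp_apply, inner_conv, ← integral_indicator hB.measurableSet]
  refine integral_congr_ae ?_
  filter_upwards [coeFn_indOp hB.measurableSet ξ] with z hz
  simp only [hz]
  by_cases hzB : z ∈ B
  swap
  · simp [Set.indicator_of_notMem hzB]
  simp only [Set.indicator_of_mem hzB]
  have h1 : ∫ g, f g * inner ℂ (η (g * z)) (ξ z)
      = ξ z * ∫ g, (fun y => f (y * z⁻¹) * inner ℂ (η y) (1 : ℂ)) (g * z) := by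
    rw [← integral_const_mul]
    refine integral_congr_ae (Filter.Eventually.of_forall fun g => ?_)
    simp only [mul_inv_cancel_right]
    simp only [RCLike.inner_apply]
    ring
  change _ = ξ z * inner ℂ η ((Real.exp (-(z.2.1 - z.1) / 2) : ℂ) • κ' z)
  rw [inner_smul_right]
  refine h1.trans (congrArg _ ((integral_mul_right_eq z
    fun y => f (y * z⁻¹) * inner ℂ (η y) (1 : ℂ)).trans (congrArg _ ?_)))
  rw [L2.inner_def]
  refine integral_congr_ae ?_
  filter_upwards [coeFn_mulOp (hmc.comp (Continuous.prodMk_right z)).measurable (fun y => hf1 _)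
    (indicatorConstLp 2 hD.measurableSet hD.measure_lt_top.ne 1),
    indicatorConstLp_coeFn (p := 2) (hs := hD.measurableSet) (hμs := hD.measure_lt_top.ne)
      (c := (1 : ℂ))] with y h2 h3
  change κ' z y = f (y * z⁻¹) * _ at h2
  rw [h2, h3]
  by_cases hy : y ∈ tsupport f * B
  · simp [Set.indicator_of_mem hy]
  · have : f (y * z⁻¹) = 0 := by
      by_contra hne
      exact hy ⟨y * z⁻¹, subset_tsupport f hne, z, hzB, inv_mul_cancel_right y z⟩
    simp [this]

/-! ### Splitting `L²(ℝ³)` along the sets `S_{δ,1}`, `S_{δ,2}`, `S_{δ,3,k}` -/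

theorem mulOp_indOp_comm {m : G₀ → ℂ} (hm : Measurable m) (hb : ∀ x, ‖m x‖ ≤ 1) {S : Set G₀}
    (hS : MeasurableSet S) (ξ : L2) :
    mulOp m hm hb (indOp S hS ξ) = indOp S hS (mulOp m hm hb ξ) := by
  refine Lp.ext ?_
  filter_upwards [coeFn_mulOp hm hb (indOp S hS ξ), coeFn_mulOp hm hb ξ, coeFn_indOp hS ξ,
    coeFn_indOp hS (mulOp m hm hb ξ)] with x h1 h2 h3 h4
  rw [h1, h4, h3]
  by_cases hx : x ∈ S <;> simp [hx, h2]

theorem norm_mulOp_sub_mulOp_indOp_le {m m' : G₀ → ℂ} (hm : Measurable m) (hb : ∀ x, ‖m x‖ ≤ 1)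
    (hm' : Measurable m') (hb' : ∀ x, ‖m' x‖ ≤ 1) {S : Set G₀} (hS : MeasurableSet S) {c : ℝ}
    (hc : ∀ x ∈ S, ‖m x - m' x‖ ≤ c) (ξ : L2) :
    ‖mulOp m hm hb (indOp S hS ξ) - mulOp m' hm' hb' (indOp S hS ξ)‖ ≤ c * ‖indOp S hS ξ‖ := by
  refine Lp.norm_le_mul_norm_of_ae_le_mul ?_
  filter_upwards [Lp.coeFn_sub (mulOp m hm hb (indOp S hS ξ)) (mulOp m' hm' hb' (indOp S hS ξ)),
    coeFn_mulOp hm hb (indOp S hS ξ), coeFn_mulOp hm' hb' (indOp S hS ξ), coeFn_indOp hS ξ]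
    with x h1 h2 h3 h4
  rw [h1, Pi.sub_apply, h2, h3, h4, ← sub_mul, norm_mul]
  by_cases hx : x ∈ S
  · exact mul_le_mul_of_nonneg_right (hc x hx) (norm_nonneg _)
  · simp [hx]

theorem hasSum_indOp_iUnion {S : ℤ → Set G₀} (hS : ∀ i, MeasurableSet (S i))
    (hd : Pairwise fun i j => Disjoint (S i) (S j)) (ξ : L2) :
    HasSum (fun i => indOp (S i) (hS i) ξ) (indOp (⋃ i, S i) (MeasurableSet.iUnion hS) ξ) := by
  have hs : Summable fun i => indOp (S i) (hS i) ξ :=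
    (summable_of_pairwise_inner_eq_zero
      (fun i j hij => inner_indOp_eq_zero (hS i) (hS j) (hd hij) ξ ξ) (norm_nonneg ξ)
      (fun s => sum_norm_sq_indOp_le hS hd s ξ)).1
  convert hs.hasSum using 1
  have hind : ∀ {T : Set G₀} (hT : MeasurableSet T) (η : L2),
      inner ℂ η (indOp T hT ξ) = ∫ x in T, inner ℂ (η x) (ξ x) := by
    intro T hT η
    rw [L2.inner_def, ← integral_indicator hT]
    refine integral_congr_ae ?_
    filter_upwards [coeFn_indOp hT ξ] with x hx
    rw [hx]
    by_cases hxT : x ∈ T <;> simp [hxT]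
  refine ext_inner_left ℂ fun η => ?_
  have h1 := (innerSL ℂ η).hasSum hs.hasSum
  have h2 := hasSum_integral_iUnion hS hd
    (f := fun x => inner ℂ (η x) (ξ x)) (L2.integrable_inner η ξ).integrableOn
  rw [hind]
  refine h2.unique (h1.congr_fun fun i => ?_)
  simp [hind]

theorem mem_iUnion_S₃ {δ : ℝ} (hδ : 0 < δ) (y : G₀) :
    y ∈ ⋃ k, S₃ δ k ↔ Real.exp (-y.1) ≤ δ ^ 6 ∧ δ ≤ Real.exp (-y.2.1) := by
  have h1 : Real.log (1 / δ ^ 6) ≤ y.1 ↔ Real.exp (-y.1) ≤ δ ^ 6 := by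
    rw [one_div, Real.log_inv, neg_le, Real.le_log_iff_exp_le (by positivity)]
  have h2 : y.2.1 ≤ Real.log (1 / δ) ↔ δ ≤ Real.exp (-y.2.1) := by
    rw [one_div, Real.log_inv, le_neg, Real.log_le_iff_le_exp hδ]
  rw [Set.mem_iUnion]
  constructor
  · rintro ⟨k, h3, h4, -⟩
    exact ⟨h1.1 h3, h2.1 h4⟩
  · rintro ⟨h3, h4⟩
    refine ⟨⌊y.2.2 / δ ^ 2⌋, h1.2 h3, h2.2 h4, ?_, ?_⟩
    · have := Int.floor_le (y.2.2 / δ ^ 2)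
      rwa [le_div_iff₀' (by positivity)] at this
    · have := Int.lt_floor_add_one (y.2.2 / δ ^ 2)
      rw [div_lt_iff₀' (by positivity)] at this
      linarith

theorem M₁_add_M₂_add {δ : ℝ} (hδ : 0 < δ) (ξ : L2) :
    M₁ δ ξ + M₂ δ ξ + indOp (⋃ k, S₃ δ k) (MeasurableSet.iUnion (measurableSet_S₃ δ)) ξ = ξ := by
  refine Lp.ext ?_
  filter_upwards [Lp.coeFn_add (M₁ δ ξ + M₂ δ ξ)
    (indOp (⋃ k, S₃ δ k) (MeasurableSet.iUnion (measurableSet_S₃ δ)) ξ),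
    Lp.coeFn_add (M₁ δ ξ) (M₂ δ ξ), coeFn_indOp (measurableSet_S₁ δ) ξ,
    coeFn_indOp (measurableSet_S₂ δ) ξ,
    coeFn_indOp (MeasurableSet.iUnion (measurableSet_S₃ δ)) ξ] with y h1 h2 h3 h4 h5
  rw [h1, Pi.add_apply, h2, Pi.add_apply, h5, M₁, M₂, h3, h4]
  have hiff := mem_iUnion_S₃ hδ y
  by_cases ha : δ ^ 6 < Real.exp (-y.1)
  · have e1 : y ∈ S₁ δ := ha
    have e2 : y ∉ S₂ δ := fun h => ha.not_ge h.1
    have e3 : y ∉ ⋃ k, S₃ δ k := fun h => ha.not_ge (hiff.1 h).1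
    rw [Set.indicator_of_mem e1, Set.indicator_of_notMem e2, Set.indicator_of_notMem e3,
      add_zero, add_zero]
  · have e1 : y ∉ S₁ δ := ha
    by_cases hb : Real.exp (-y.2.1) < δ
    · have e2 : y ∈ S₂ δ := ⟨not_lt.1 ha, hb⟩
      have e3 : y ∉ ⋃ k, S₃ δ k := fun h => hb.not_ge (hiff.1 h).2
      rw [Set.indicator_of_notMem e1, Set.indicator_of_mem e2, Set.indicator_of_notMem e3,
        add_zero, zero_add]
    · have e2 : y ∉ S₂ δ := fun h => hb h.2
      have e3 : y ∈ ⋃ k, S₃ δ k := hiff.2 ⟨not_lt.1 ha, not_lt.1 hb⟩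
      rw [Set.indicator_of_notMem e1, Set.indicator_of_notMem e2, Set.indicator_of_mem e3,
        add_zero, zero_add]

/-! ### Supports -/

theorem mul_mem_T₃ {δ P : ℝ} (hδ : 0 < δ) (hδP : δ * P ^ 2 ≤ 1) {g z : G₀} {k : ℤ}
    (hg : |g.2.2| ≤ P) (hz : z ∈ S₃ δ k) : g * z ∈ T₃ δ k := by
  obtain ⟨ha, hb⟩ := (mem_iUnion_S₃ hδ z).1 (Set.mem_iUnion.2 ⟨k, hz⟩)
  obtain ⟨h1, h2⟩ := hz.2.2
  set c := Real.exp ((z.2.1 - z.1) / 2) with hc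
  have hc0 : 0 < c := Real.exp_pos _
  have hcsq : c ^ 2 * Real.exp (-z.2.1) = Real.exp (-z.1) := by
    rw [hc, ← Real.exp_nat_mul, ← Real.exp_add]
    congr 1
    push_cast
    ring
  have hc5 : c ^ 2 ≤ δ ^ 5 := by
    have : c ^ 2 * δ ≤ δ ^ 5 * δ := by
      calc c ^ 2 * δ ≤ c ^ 2 * Real.exp (-z.2.1) := by gcongr
        _ ≤ δ ^ 5 * δ := by rw [hcsq]; linarith [ha]
    exact le_of_mul_le_mul_right this hδ
  have hcP : |c * g.2.2| ≤ δ ^ 2 := by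
    refine abs_le_of_sq_le_sq ?_ (by positivity)
    calc (c * g.2.2) ^ 2 = c ^ 2 * |g.2.2| ^ 2 := by rw [mul_pow, sq_abs]
      _ ≤ δ ^ 5 * P ^ 2 := by gcongr
      _ = δ ^ 4 * (δ * P ^ 2) := by ring
      _ ≤ δ ^ 4 * 1 := by gcongr
      _ = (δ ^ 2) ^ 2 := by ring
  obtain ⟨h3, h4⟩ := abs_le.1 hcP
  have hp : (g * z).2.2 = c * g.2.2 + z.2.2 := rfl
  by_cases hl : c * g.2.2 + z.2.2 < δ ^ 2 * k
  · refine Or.inl (Or.inl ⟨?_, ?_⟩)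
    · rw [hp]; push_cast; linarith
    · rw [hp]; push_cast; linarith
  by_cases hr : c * g.2.2 + z.2.2 < δ ^ 2 * k + δ ^ 2
  · exact Or.inl (Or.inr ⟨not_lt.1 hl, hr⟩)
  · refine Or.inr ⟨?_, ?_⟩
    · rw [hp]; push_cast; linarith
    · rw [hp]; push_cast; linarith

theorem N₃_conv {f : G₀ → ℂ} (hf : Integrable f) {δ P : ℝ} (hδ : 0 < δ) (hδP : δ * P ^ 2 ≤ 1)
    (hfP : ∀ g, f g ≠ 0 → |g.2.2| ≤ P) (k : ℤ) (ξ : L2) :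
    N₃ δ k (conv f hf (M₃ δ k ξ)) = conv f hf (M₃ δ k ξ) := by
  rw [conv_apply, ← ContinuousLinearMap.integral_comp_comm _ (integrable_smul_leftReg hf _)]
  refine integral_congr_ae (Filter.Eventually.of_forall fun g => ?_)
  by_cases hg : f g = 0
  · simp [hg]
  simp only [map_smul]
  congr 1
  rw [leftReg_apply]
  refine Lp.ext ?_
  have hq := (measurePreserving_mul_left (volume : Measure G₀)
    g⁻¹).quasiMeasurePreserving.ae (coeFn_indOp (measurableSet_S₃ δ k) ξ)
  filter_upwards [coeFn_indOp (measurableSet_T₃ δ k) (translate g (M₃ δ k ξ)),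
    coeFn_translate g (M₃ δ k ξ), hq] with y h1 h2 h3
  rw [N₃, h1]
  by_cases hy : y ∈ T₃ δ k
  · rw [Set.indicator_of_mem hy]
  · rw [Set.indicator_of_notMem hy, h2, M₃, h3, Set.indicator_of_notMem]
    intro hz
    refine hy ?_
    have := mul_mem_T₃ hδ hδP (hfP g hg) hz
    rwa [mul_inv_cancel_left] at this

theorem isCompactOperator_conv_comp_mulOp_sub {f : G₀ → ℂ} (hf : Integrable f)
    (hfc : Continuous f) (hfs : HasCompactSupport f) (hf1 : ∀ g, ‖f g‖ ≤ 1) {m m' : G₀ → ℂ}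
    (hm : Measurable m) (hb : ∀ x, ‖m x‖ ≤ 1) (hm' : Measurable m') (hb' : ∀ x, ‖m' x‖ ≤ 1)
    {S : Set G₀} (hS : MeasurableSet S)
    (h : ∀ η > 0, ∃ B : Set G₀, IsCompact B ∧ ∀ z ∈ S, z ∉ B → ‖m z - m' z‖ ≤ η) :
    IsCompactOperator
      ((conv f hf).comp ((mulOp m hm hb - mulOp m' hm' hb').comp (indOp S hS))) := by
  refine isClosed_setOfPred_isCompactOperator.closure_subset
    (show _ ∈ closure {T : L2 →L[ℂ] L2 | IsCompactOperator T} from ?_)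
  refine Metric.mem_closure_iff.2 fun η hη => ?_
  set c := ‖conv f hf‖ with hc
  obtain ⟨B, hB, hBη⟩ := h (η / (c + 1)) (by positivity)
  set D := (mulOp m hm hb - mulOp m' hm' hb').comp (indOp S hS) with hD
  refine ⟨((conv f hf).comp (indOp B hB.measurableSet)).comp D,
    (isCompactOperator_conv_comp_indOp hf hfc hfs hf1 hB).comp_clm D, ?_⟩
  have h1 : ‖D - (indOp B hB.measurableSet).comp D‖ ≤ η / (c + 1) := by
    refine ContinuousLinearMap.opNorm_le_bound _ (by positivity) fun ξ => ?_
    refine Lp.norm_le_mul_norm_of_ae_le_mul ?_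
    filter_upwards [Lp.coeFn_sub (D ξ) (indOp B hB.measurableSet (D ξ)),
      coeFn_indOp hB.measurableSet (D ξ), coeFn_indOp hS ξ, coeFn_mulOp hm hb (indOp S hS ξ),
      coeFn_mulOp hm' hb' (indOp S hS ξ),
      Lp.coeFn_sub (mulOp m hm hb (indOp S hS ξ)) (mulOp m' hm' hb' (indOp S hS ξ))]
      with x h1 h2 h3 h4 h5 h6
    have h7 : D ξ x = (m x - m' x) * S.indicator ξ x := by
      change (mulOp m hm hb (indOp S hS ξ) - mulOp m' hm' hb' (indOp S hS ξ) : L2) x = _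
      rw [h6, Pi.sub_apply, h4, h5, h3, sub_mul]
    change ‖(D ξ - indOp B hB.measurableSet (D ξ) : L2) x‖ ≤ _
    rw [h1, Pi.sub_apply, h2]
    by_cases hxB : x ∈ B
    · rw [Set.indicator_of_mem hxB, sub_self, norm_zero]
      positivity
    · rw [Set.indicator_of_notMem hxB, sub_zero, h7]
      by_cases hxS : x ∈ S
      · rw [Set.indicator_of_mem hxS, norm_mul]
        exact mul_le_mul_of_nonneg_right (hBη x hxS hxB) (norm_nonneg _)
      · rw [Set.indicator_of_notMem hxS, mul_zero, norm_zero]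
        positivity
  rw [dist_eq_norm, ContinuousLinearMap.comp_assoc, ← ContinuousLinearMap.comp_sub]
  refine (ContinuousLinearMap.opNorm_comp_le _ _).trans_lt ?_
  calc c * ‖D - (indOp B hB.measurableSet).comp D‖ ≤ c * (η / (c + 1)) := by gcongr
    _ < (c + 1) * (η / (c + 1)) := by
        refine mul_lt_mul_of_pos_right (lt_add_one c) (by positivity)
    _ = η := mul_div_cancel₀ _ (by positivity)

/-! ### Comparison of coadjoint orbits -/

theorem abs_mul_sign {ε : ℝ} (hε : ε = 1 ∨ ε = -1) (t : ℝ) : |t * ε| = |t| := by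
  rcases hε with rfl | rfl <;> simp

theorem coad_add (ε : ℝ) (z : G₀) : coad (ε, 0, ε) z =
    (Real.exp (-z.2.1) * (1 + z.2.2 ^ 2 / 2) * ε, -(Real.exp (-(z.1 + z.2.1) / 2) * z.2.2) * ε,
      Real.exp (-z.1) * ε) := by
  refine Prod.ext ?_ (Prod.ext ?_ rfl) <;> simp only [coad] <;> ring

theorem coad_S (ε : ℝ) (z : G₀) : coad (0, 0, ε) z =
    (Real.exp (-z.2.1) * (z.2.2 ^ 2 / 2) * ε, -(Real.exp (-(z.1 + z.2.1) / 2) * z.2.2) * ε,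
      Real.exp (-z.1) * ε) := by
  refine Prod.ext ?_ (Prod.ext ?_ rfl) <;> simp only [coad] <;> ring

theorem coad_Q (ε c : ℝ) (z : G₀) : coad (ε * c, 0, 0) z = (Real.exp (-z.2.1) * c * ε, 0, 0) := by
  refine Prod.ext ?_ (Prod.ext ?_ ?_) <;> simp only [coad] <;> ring

theorem dist_coad_add_coad_S {ε : ℝ} (hε : ε = 1 ∨ ε = -1) (z : G₀) :
    dist (coad (ε, 0, ε) z) (coad (0, 0, ε) z) = Real.exp (-z.2.1) := by
  have h1 : Real.exp (-z.2.1) * (1 + z.2.2 ^ 2 / 2) * ε - Real.exp (-z.2.1) * (z.2.2 ^ 2 / 2) * ε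
      = Real.exp (-z.2.1) * ε := by ring
  rw [coad_add, coad_S, Prod.dist_eq, dist_self, Real.dist_eq]
  simp only
  rw [h1, abs_mul_sign hε, abs_of_pos (Real.exp_pos _), max_eq_left (Real.exp_pos _).le]

theorem coad_add_bounds {ε R : ℝ} (hε : ε = 1 ∨ ε = -1) {z : G₀} (h : ‖coad (ε, 0, ε) z‖ ≤ R) :
    Real.exp (-z.2.1) * (1 + z.2.2 ^ 2 / 2) ≤ R ∧ Real.exp (-z.1) ≤ R := by
  rw [coad_add] at h
  have h1 := (norm_fst_le _).trans h
  have h2 := (norm_snd_le _).trans ((norm_snd_le _).trans h)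
  rw [Real.norm_eq_abs, abs_mul_sign hε] at h1 h2
  exact ⟨(le_abs_self _).trans h1, (le_abs_self _).trans h2⟩

theorem coad_S_bounds {ε R : ℝ} (hε : ε = 1 ∨ ε = -1) {z : G₀} (h : ‖coad (0, 0, ε) z‖ ≤ R) :
    Real.exp (-z.2.1) * (z.2.2 ^ 2 / 2) ≤ R ∧ Real.exp (-z.1) ≤ R := by
  rw [coad_S] at h
  have h1 := (norm_fst_le _).trans h
  have h2 := (norm_snd_le _).trans ((norm_snd_le _).trans h)
  rw [Real.norm_eq_abs, abs_mul_sign hε] at h1 h2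
  exact ⟨(le_abs_self _).trans h1, (le_abs_self _).trans h2⟩

theorem coad_Q_bounds {ε c R : ℝ} (hε : ε = 1 ∨ ε = -1) {z : G₀}
    (h : ‖coad (ε * c, 0, 0) z‖ ≤ R) : Real.exp (-z.2.1) * c ≤ R := by
  rw [coad_Q] at h
  have h1 := (norm_fst_le _).trans h
  rw [Real.norm_eq_abs, abs_mul_sign hε] at h1
  exact (le_abs_self _).trans h1

theorem norm_le_of_hasCompactSupport {ψ : ℝ × ℝ × ℝ → ℂ} (hψs : HasCompactSupport ψ) :
    ∃ R : ℝ, 1 ≤ R ∧ ∀ l, ψ l ≠ 0 → ‖l‖ ≤ R := by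
  obtain ⟨R, hR⟩ := hψs.isCompact.isBounded.exists_norm_le
  exact ⟨max R 1, le_max_right _ _,
    fun l hl => (hR l (subset_tsupport ψ hl)).trans (le_max_left _ _)⟩

/-- On `S_{δ,1}` the symbols of `π_{ε(Q*+S*)}` and `σ_{εS*}` differ by a function vanishing at
infinity. -/
theorem exists_compact_symbol_sub_le {ε : ℝ} (hε : ε = 1 ∨ ε = -1) {ψ : ℝ × ℝ × ℝ → ℂ}
    (hψ : Continuous ψ) (hψs : HasCompactSupport ψ) (hψ1 : ∀ l, ‖ψ l‖ ≤ 1) {φ : ℝ → ℝ}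
    (hφ : IsCutoff φ) {δ : ℝ} (hδ : 0 < δ) {η : ℝ} (hη : 0 < η) :
    ∃ B : Set G₀, IsCompact B ∧ ∀ z ∈ S₁ δ, z ∉ B →
      ‖ψ (coad (ε, 0, ε) z) - ψ (coad (0, 0, ε) z) * (φ (Real.exp (-z.2.1)) : ℂ)‖ ≤ η := by
  obtain ⟨ρ₁, hρ₁, hu⟩ := Metric.uniformContinuous_iff.1
    (hψs.uniformContinuous_of_continuous hψ) (η / 2) (half_pos hη)
  obtain ⟨ρ₂, hρ₂, hv⟩ := Metric.continuousAt_iff.1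
    (hφ.smooth.continuous.continuousAt (x := 0)) (η / 2) (half_pos hη)
  obtain ⟨R, hR1, hR⟩ := norm_le_of_hasCompactSupport hψs
  set ρ := min ρ₁ ρ₂ with hρ
  have hρ0 : 0 < ρ := lt_min hρ₁ hρ₂
  set P := Real.sqrt (2 * R / ρ) with hP
  refine ⟨(Set.Icc (-Real.log R) (-Real.log (δ ^ 6)) ×ˢ
    (Set.Icc (-Real.log R) (-Real.log ρ) ×ˢ Set.Icc (-P) P) : Set (ℝ × ℝ × ℝ)),
    isCompact_Icc.prod (isCompact_Icc.prod isCompact_Icc), fun z hz hzB => ?_⟩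
  by_cases hb : Real.exp (-z.2.1) < ρ
  · have h1 : ‖ψ (coad (ε, 0, ε) z) - ψ (coad (0, 0, ε) z)‖ < η / 2 := by
      rw [← dist_eq_norm]
      refine hu ?_
      rw [dist_coad_add_coad_S hε]
      exact hb.trans_le (min_le_left _ _)
    have h2 : ‖ψ (coad (0, 0, ε) z) * (1 - (φ (Real.exp (-z.2.1)) : ℂ))‖ ≤ η / 2 := by
      rw [norm_mul]
      refine (mul_le_of_le_one_left (norm_nonneg _) (hψ1 _)).trans ?_
      have h3 := hv (x := Real.exp (-z.2.1)) (by
        rw [dist_zero_right, Real.norm_of_nonneg (Real.exp_pos _).le]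
        exact hb.trans_le (min_le_right _ _))
      rw [hφ.map_zero, dist_comm, Real.dist_eq] at h3
      rw [← Complex.ofReal_one, ← Complex.ofReal_sub, Complex.norm_real]
      exact h3.le
    calc _ = ‖(ψ (coad (ε, 0, ε) z) - ψ (coad (0, 0, ε) z))
          + ψ (coad (0, 0, ε) z) * (1 - (φ (Real.exp (-z.2.1)) : ℂ))‖ := by congr 1; ring
      _ ≤ η := (norm_add_le _ _).trans (by linarith)
  · rw [not_lt] at hb
    have hmem : ∀ (_ : Real.exp (-z.1) ≤ R) (_ : Real.exp (-z.2.1) ≤ R)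
        (_ : Real.exp (-z.2.1) * (z.2.2 ^ 2 / 2) ≤ R), False := by
      intro h1 h2 h3
      have hR0 : 0 < R := by linarith
      have hp : z.2.2 ^ 2 ≤ 2 * R / ρ := by
        rw [le_div_iff₀ hρ0]
        nlinarith [mul_le_mul_of_nonneg_right hb (by positivity : 0 ≤ z.2.2 ^ 2 / 2)]
      have hz' : δ ^ 6 < Real.exp (-z.1) := hz
      refine hzB ⟨⟨?_, ?_⟩, ⟨?_, ?_⟩, abs_le.1 (Real.abs_le_sqrt hp)⟩
      · rw [neg_le]; exact (Real.le_log_iff_exp_le hR0).2 h1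
      · rw [le_neg]; exact ((Real.log_lt_iff_lt_exp (by positivity)).2 hz').le
      · rw [neg_le]; exact (Real.le_log_iff_exp_le hR0).2 h2
      · rw [le_neg]; exact (Real.log_le_iff_le_exp hρ0).2 hb
    have h1 : ψ (coad (ε, 0, ε) z) = 0 := by
      by_contra hne
      obtain ⟨h2, h3⟩ := coad_add_bounds hε (hR _ hne)
      have h4 := Real.exp_pos (-z.2.1)
      have h5 : 0 ≤ Real.exp (-z.2.1) * (z.2.2 ^ 2 / 2) := by positivity
      exact hmem h3 (by linarith) (by linarith)
    have h2 : ψ (coad (0, 0, ε) z) * (φ (Real.exp (-z.2.1)) : ℂ) = 0 := by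
      by_contra hne
      obtain ⟨h2, h3⟩ := coad_S_bounds hε (hR _ (left_ne_zero_of_mul hne))
      have h4 : φ (Real.exp (-z.2.1)) ≠ 0 := fun h0 => hne (by rw [h0]; simp)
      exact hmem h3 ((hφ.support_subset h4).2.trans hR1) h2
    rw [h1, h2, sub_zero, norm_zero]
    exact hη.le

/-- On `S_{δ,3,k}` the coadjoint orbits of `ε(Q* + S*)` and `ε(1 + δ⁴k²/2)Q*` are close. -/
theorem dist_coad_add_coad_Q_le {ε : ℝ} (hε : ε = 1 ∨ ε = -1) {δ R : ℝ} (hδ : 0 < δ)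
    (hδ1 : δ ≤ 1) (hR1 : 1 ≤ R) {k : ℤ} {z : G₀} (hz : z ∈ S₃ δ k)
    (h : ‖coad (ε, 0, ε) z‖ ≤ R ∨ ‖coad (ε * (1 + δ ^ 4 * (k : ℝ) ^ 2 / 2), 0, 0) z‖ ≤ R) :
    dist (coad (ε, 0, ε) z) (coad (ε * (1 + δ ^ 4 * (k : ℝ) ^ 2 / 2), 0, 0) z)
      ≤ δ * (10 * R) := by
  obtain ⟨ha, hb⟩ := (mem_iUnion_S₃ hδ z).1 (Set.mem_iUnion.2 ⟨k, hz⟩)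
  obtain ⟨h1, h2⟩ := hz.2.2
  set p := z.2.2 with hp
  set q := δ ^ 2 * (k : ℝ) with hq
  set Y := Real.exp (-z.2.1) with hY
  have hY0 : 0 < Y := Real.exp_pos _
  have hq4 : δ ^ 4 * (k : ℝ) ^ 2 / 2 = q ^ 2 / 2 := by rw [hq]; ring
  rw [hq4] at h ⊢
  have hδ2 : δ ^ 2 ≤ δ := by nlinarith
  have hδ6 : δ ^ 6 ≤ δ := by
    calc δ ^ 6 ≤ δ ^ 1 := pow_le_pow_of_le_one hδ.le hδ1 (by norm_num)
      _ = δ := pow_one δ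
  have hpq : |p - q| ≤ δ ^ 2 := by
    rw [abs_le]
    constructor <;> linarith
  obtain ⟨hpq1, hpq2⟩ := abs_le.1 hpq
  have key : Y * (1 + p ^ 2 / 2) ≤ 2 * R := by
    rcases h with h | h
    · have := (coad_add_bounds hε h).1
      linarith
    · have h3 := coad_Q_bounds hε h
      have h4 : p ^ 2 ≤ 2 * q ^ 2 + 2 := by nlinarith [sq_nonneg (2 * q - p)]
      have h5 : Y * (1 + p ^ 2 / 2) ≤ Y * (2 * (1 + q ^ 2 / 2)) := by gcongr; linarith
      linarith
  have hYp : Y * |p| ≤ 2 * R := by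
    refine le_trans ?_ key
    gcongr
    nlinarith [sq_nonneg (|p| - 1), sq_abs p]
  have hYR : Y ≤ 2 * R := by nlinarith [mul_nonneg hY0.le (sq_nonneg p)]
  have c1 : |Y * (1 + p ^ 2 / 2) * ε - Y * (1 + q ^ 2 / 2) * ε| ≤ δ * (10 * R) := by
    have e : Y * (1 + p ^ 2 / 2) * ε - Y * (1 + q ^ 2 / 2) * ε
        = Y * ((p - q) * (p + q)) / 2 * ε := by ring
    rw [e, abs_mul_sign hε, abs_div, abs_mul, abs_mul, abs_of_pos hY0, abs_two]
    have h3 : |p + q| ≤ 2 * |p| + 1 := by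
      rw [abs_le]
      have := le_abs_self p
      have := neg_abs_le p
      constructor <;> linarith
    calc Y * (|p - q| * |p + q|) / 2 ≤ Y * (δ * (2 * |p| + 1)) / 2 := by
          gcongr
          exact hpq.trans hδ2
      _ = δ * ((2 * (Y * |p|) + Y) / 2) := by ring
      _ ≤ δ * (10 * R) := by gcongr; linarith
  have c2 : |-(Real.exp (-(z.1 + z.2.1) / 2) * p) * ε| ≤ δ * (10 * R) := by
    rw [abs_mul_sign hε, abs_neg]
    refine abs_le_of_sq_le_sq ?_ (by positivity)
    have e : Real.exp (-(z.1 + z.2.1) / 2) ^ 2 = Real.exp (-z.1) * Y := by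
      rw [hY, ← Real.exp_nat_mul, ← Real.exp_add]
      congr 1
      push_cast
      ring
    calc (Real.exp (-(z.1 + z.2.1) / 2) * p) ^ 2 = Real.exp (-z.1) * (Y * p ^ 2) := by
          rw [mul_pow, e]; ring
      _ ≤ δ ^ 6 * (4 * R) := mul_le_mul ha (by linarith) (by positivity) (by positivity)
      _ ≤ δ ^ 2 * (4 * R) := by
          gcongr ?_ * _
          exact pow_le_pow_of_le_one hδ.le hδ1 (by norm_num)
      _ ≤ (δ * (10 * R)) ^ 2 := by
          rw [mul_pow]
          gcongr
          nlinarith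
  have c3 : |Real.exp (-z.1) * ε| ≤ δ * (10 * R) := by
    rw [abs_mul_sign hε, abs_of_pos (Real.exp_pos _)]
    nlinarith
  rw [coad_add, coad_Q, Prod.dist_eq, Prod.dist_eq, Real.dist_eq, Real.dist_eq, Real.dist_eq]
  simp only [sub_zero]
  exact max_le c1 (max_le c2 c3)

/-- Multiplication with `z ↦ û(Ad*(z) l)`. -/
def symbolOp (u : h → ℂ) (hu : Integrable u) (hu1 : ∫ x, ‖u x‖ ≤ 1) (l : ℝ × ℝ × ℝ) :
    L2 →L[ℂ] L2 :=
  mulOp (fun z => hat u (coad l z)) ((continuous_hat hu).comp (continuous_coad l)).measurable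
    (fun _ => (norm_hat_le u _).trans hu1)

theorem σStar_tensor {f : G₀ → ℂ} (hf : Integrable f) {u : h → ℂ} (hu : Integrable u)
    (hu1 : ∫ x, ‖u x‖ ≤ 1) (l : ℝ × ℝ × ℝ) :
    σStar l (GroupCStar.ofL1 volume (tensor f hf u hu))
      = (conv f hf).comp (symbolOp u hu hu1 l) := by
  rw [σStar_ofL1]
  exact σ_tensor l hf hu _ _

/-- `π_{ε(Q*+S*)}(F) - σ_{ε,ε,δ}(F)`. -/
def defect (ε : ℝ) (φ : ℝ → ℝ) (hφ : IsCutoff φ) (δ : ℝ) :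
    GroupCStar.CStar (volume : Measure G) →L[ℂ] L2 →L[ℂ] L2 :=
  σStar (ε, 0, ε) - sigmaStar ε φ hφ δ

/-- The elements `F` of `C*(G)` for which `π_{ε(Q*+S*)}(F) - σ_{ε,ε,δ}(F)` is asymptotically
compact. -/
def asympCompact (ε : ℝ) (φ : ℝ → ℝ) (hφ : IsCutoff φ) :
    Submodule ℂ (GroupCStar.CStar (volume : Measure G)) where
  carrier := {F | ∀ η > 0, ∀ᶠ δ in 𝓝[>] (0 : ℝ), ∃ K : L2 →L[ℂ] L2, IsCompactOperator K ∧
    ‖defect ε φ hφ δ F - K‖ ≤ η}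
  add_mem' := by
    intro F F' hF hF' η hη
    filter_upwards [hF (η / 2) (half_pos hη), hF' (η / 2) (half_pos hη)]
      with δ ⟨K, hK, hKn⟩ ⟨K', hK', hKn'⟩
    refine ⟨K + K', hK.add hK', ?_⟩
    rw [map_add, add_sub_add_comm]
    exact (norm_add_le _ _).trans (by linarith)
  zero_mem' := by
    intro η hη
    refine Filter.Eventually.of_forall fun δ => ⟨0, isCompactOperator_zero, ?_⟩
    simpa using hη.le
  smul_mem' := by
    intro c F hF η hη
    filter_upwards [hF (η / (‖c‖ + 1)) (by positivity)] with δ ⟨K, hK, hKn⟩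
    refine ⟨c • K, hK.smul c, ?_⟩
    rw [map_smul, ← smul_sub, norm_smul]
    calc ‖c‖ * ‖defect ε φ hφ δ F - K‖ ≤ (‖c‖ + 1) * (η / (‖c‖ + 1)) := by gcongr; linarith
      _ = η := mul_div_cancel₀ _ (by positivity)

theorem norm_defect_le (ε : ℝ) (φ : ℝ → ℝ) (hφ : IsCutoff φ) (δ : ℝ)
    (F : GroupCStar.CStar (volume : Measure G)) : ‖defect ε φ hφ δ F‖ ≤ 6 * ‖F‖ := by
  have h1 := norm_sub_le (σStar (ε, 0, ε) F) (sigmaStar ε φ hφ δ F)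
  have h2 := norm_sigmaStar_le ε φ hφ δ F
  have h3 := norm_σStar_le (ε, 0, ε) F
  have h4 := norm_σStar_le (0, 0, ε) F
  have h5 := norm_σStar_le (ε, 0, 0) F
  exact h1.trans (by linarith)

theorem isClosed_asympCompact (ε : ℝ) (φ : ℝ → ℝ) (hφ : IsCutoff φ) :
    IsClosed (asympCompact ε φ hφ : Set (GroupCStar.CStar (volume : Measure G))) := by
  refine isClosed_of_closure_subset fun F hF η hη => ?_
  obtain ⟨F', hF', hd⟩ := Metric.mem_closure_iff.1 hF (η / 12) (by positivity)
  filter_upwards [hF' (η / 2) (half_pos hη)] with δ ⟨K, hK, hKn⟩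
  refine ⟨K, hK, ?_⟩
  have h1 := norm_defect_le ε φ hφ δ (F - F')
  rw [dist_eq_norm] at hd
  calc ‖defect ε φ hφ δ F - K‖
      = ‖defect ε φ hφ δ (F - F') + (defect ε φ hφ δ F' - K)‖ := by
        rw [map_sub]
        congr 1
        abel
    _ ≤ η := (norm_add_le _ _).trans (by linarith)

theorem tendsto_infDist_of_mem_asympCompact {ε : ℝ} {φ : ℝ → ℝ} {hφ : IsCutoff φ}
    {F : GroupCStar.CStar (volume : Measure G)} (hF : F ∈ asympCompact ε φ hφ) :
    Filter.Tendsto (fun δ : ℝ => Metric.infDist (σStar (ε, 0, ε) F - sigmaStar ε φ hφ δ F)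
      {K : L2 →L[ℂ] L2 | IsCompactOperator K}) (𝓝[>] 0) (𝓝 0) := by
  refine Metric.tendsto_nhds.2 fun η hη => ?_
  filter_upwards [hF (η / 2) (half_pos hη)] with δ ⟨K, hK, hKn⟩
  rw [Real.dist_0_eq_abs, abs_of_nonneg Metric.infDist_nonneg]
  refine (Metric.infDist_le_dist_of_mem (y := K) hK).trans_lt ?_
  rw [dist_eq_norm]
  exact hKn.trans_lt (half_lt_self hη)

theorem ofL1_tensor_mem_asympCompact {f : G₀ → ℂ} (hf : Integrable f) (hfc : Continuous f)
    (hfs : HasCompactSupport f) (hf1 : ∀ g, ‖f g‖ ≤ 1) {u : h → ℂ} (hu : Integrable u)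
    (hu1 : ∫ x, ‖u x‖ ≤ 1) (hus : HasCompactSupport (hat u)) {ε : ℝ} (hε : ε = 1 ∨ ε = -1)
    {φ : ℝ → ℝ} (hφ : IsCutoff φ) :
    GroupCStar.ofL1 volume (tensor f hf u hu) ∈ asympCompact ε φ hφ := by
  intro η' hη'
  set c := ‖conv f hf‖ with hc
  have hc0 : 0 ≤ c := norm_nonneg _
  set η := η' / (4 * (c + 1)) with hηdef
  have hη : 0 < η := by positivity
  have hcη : c * η + 3 * (c * η) ≤ η' := by
    have : 4 * (c + 1) * η = η' := mul_div_cancel₀ _ (by positivity)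
    linarith
  have hψ := continuous_hat hu
  have hψ1 : ∀ l, ‖hat u l‖ ≤ 1 := fun l => (norm_hat_le u l).trans hu1
  obtain ⟨ρ, hρ, huc⟩ := Metric.uniformContinuous_iff.1
    (hus.uniformContinuous_of_continuous hψ) η hη
  obtain ⟨R, hR1, hR⟩ := norm_le_of_hasCompactSupport hus
  obtain ⟨P, hP⟩ : ∃ P : ℝ, ∀ g, f g ≠ 0 → |g.2.2| ≤ P := by
    have hp : Continuous fun g : G₀ => |g.2.2| := by
      change Continuous fun g : ℝ × ℝ × ℝ => |g.2.2|
      fun_prop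
    obtain ⟨P, hP⟩ := hfs.isCompact.bddAbove_image hp.continuousOn
    exact ⟨P, fun g hg => hP (Set.mem_image_of_mem _ (subset_tsupport f hg))⟩
  have e1 : ∀ᶠ δ : ℝ in 𝓝[>] 0, δ * P ^ 2 < 1 := by
    refine ((continuous_id.mul continuous_const).tendsto' 0 0 (by simp)).mono_left
      nhdsWithin_le_nhds |>.eventually_lt_const one_pos
  have e2 : ∀ᶠ δ : ℝ in 𝓝[>] 0, δ * (10 * R) < ρ := by
    refine ((continuous_id.mul continuous_const).tendsto' 0 0 (by simp)).mono_left
      nhdsWithin_le_nhds |>.eventually_lt_const hρ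
  have e3 : ∀ᶠ δ : ℝ in 𝓝[>] 0, δ < min ρ 1 :=
    (Filter.tendsto_id'.2 nhdsWithin_le_nhds).eventually_lt_const (lt_min hρ one_pos)
  filter_upwards [e1, e2, e3, self_mem_nhdsWithin] with δ hδP hδR hδρ hδ0
  have hδ : 0 < δ := hδ0
  have hδ1 : δ ≤ 1 := (hδρ.trans_le (min_le_right _ _)).le
  have hδρ' : δ < ρ := hδρ.trans_le (min_le_left _ _)
  set S := symbolOp u hu hu1 with hS
  set C := conv f hf with hC
  have hφm : Measurable fun y : G₀ => (φ (Real.exp (-y.2.1)) : ℂ) :=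
    Complex.measurable_ofReal.comp (hφ.smooth.continuous.measurable.comp measurable_b.neg.exp)
  have hφb : ∀ y : G₀, ‖(φ (Real.exp (-y.2.1)) : ℂ)‖ ≤ 1 := fun y => by
    simpa using hφ.norm_le _
  have hmm : ∀ l, Measurable fun z => hat u (coad l z) :=
    fun l => (hψ.comp (continuous_coad l)).measurable
  have hbb : ∀ y : G₀, ‖((fun z => hat u (coad (0, 0, ε) z)) *
      fun y : G₀ => (φ (Real.exp (-y.2.1)) : ℂ)) y‖ ≤ 1 := fun y => by
    rw [Pi.mul_apply, norm_mul]
    exact mul_le_one₀ (hψ1 _) (norm_nonneg _) (hφb y)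
  set Mσ := mulOp ((fun z => hat u (coad (0, 0, ε) z)) *
    fun y : G₀ => (φ (Real.exp (-y.2.1)) : ℂ)) ((hmm _).mul hφm) hbb with hMσ
  refine ⟨C.comp ((S (ε, 0, ε) - Mσ).comp (M₁ δ)), ?_, ?_⟩
  · exact isCompactOperator_conv_comp_mulOp_sub hf hfc hfs hf1 _ _ _ _ (measurableSet_S₁ δ)
      fun η hη => exists_compact_symbol_sub_le hε hψ hus hψ1 hφ hδ hη
  set M := indOp (⋃ k, S₃ δ k) (MeasurableSet.iUnion (measurableSet_S₃ δ)) with hM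
  set F := GroupCStar.ofL1 volume (tensor f hf u hu) with hF
  set q : ℤ → ℝ × ℝ × ℝ := fun k => (ε * (1 + δ ^ 4 * (k : ℝ) ^ 2 / 2), 0, 0) with hq
  have hσ : ∀ l, σStar l F = C.comp (S l) := σStar_tensor hf hu hu1
  refine ContinuousLinearMap.opNorm_le_bound _ hη'.le fun ξ => ?_
  have b2 : ‖C (S (ε, 0, ε) (M₂ δ ξ) - S (0, 0, ε) (M₂ δ ξ))‖ ≤ c * η * ‖ξ‖ := by
    have h1 : ‖S (ε, 0, ε) (M₂ δ ξ) - S (0, 0, ε) (M₂ δ ξ)‖ ≤ η * ‖M₂ δ ξ‖ := by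
      refine norm_mulOp_sub_mulOp_indOp_le _ _ _ _ (measurableSet_S₂ δ) (fun z hz => ?_) ξ
      rw [← dist_eq_norm]
      refine (huc ?_).le
      rw [dist_coad_add_coad_S hε]
      exact hz.2.trans hδρ'
    calc _ ≤ c * ‖S (ε, 0, ε) (M₂ δ ξ) - S (0, 0, ε) (M₂ δ ξ)‖ := C.le_opNorm _
      _ ≤ c * (η * ‖ξ‖) := by
        gcongr
        exact h1.trans (by gcongr; exact norm_indOp_apply_le _ _)
      _ = c * η * ‖ξ‖ := by ring
  have b3 : ‖C (S (ε, 0, ε) (M ξ)) - sigma₃ ε δ F ξ‖ ≤ 3 * (c * η) * ‖ξ‖ := by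
    obtain ⟨s1, s2⟩ := summable_N₃_comp_M₃ δ (A := fun k => C.comp (S (ε, 0, ε) - S (q k)))
      (c := c * η) (by positivity) (fun k ζ => by
        have h1 : ‖S (ε, 0, ε) (M₃ δ k ζ) - S (q k) (M₃ δ k ζ)‖ ≤ η * ‖M₃ δ k ζ‖ := by
          refine norm_mulOp_sub_mulOp_indOp_le _ _ _ _ (measurableSet_S₃ δ k) (fun z hz => ?_) ζ
          by_cases h0 : hat u (coad (ε, 0, ε) z) = 0 ∧ hat u (coad (q k) z) = 0
          · rw [h0.1, h0.2, sub_zero, norm_zero]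
            exact hη.le
          rw [← dist_eq_norm]
          refine (huc ((dist_coad_add_coad_Q_le hε hδ hδ1 hR1 hz ?_).trans_lt hδR)).le
          rcases not_and_or.1 h0 with h0 | h0
          · exact Or.inl (hR _ h0)
          · exact Or.inr (hR _ h0)
        calc _ ≤ c * ‖S (ε, 0, ε) (M₃ δ k ζ) - S (q k) (M₃ δ k ζ)‖ := C.le_opNorm _
          _ ≤ c * (η * ‖M₃ δ k ζ‖) := by gcongr
          _ = c * η * ‖M₃ δ k ζ‖ := by ring) ξ
    have h2 := (C.comp (S (ε, 0, ε))).hasSum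
      (hasSum_indOp_iUnion (measurableSet_S₃ δ) (pairwise_disjoint_S₃ δ) ξ)
    have h3 := h2.sub (hasSum_sigma₃ ε δ F ξ)
    have h4 : ∀ k : ℤ, (C.comp (S (ε, 0, ε))) (indOp (S₃ δ k) (measurableSet_S₃ δ k) ξ)
        - N₃ δ k (σStar (ε * (1 + δ ^ 4 * (k : ℝ) ^ 2 / 2), 0, 0) F (M₃ δ k ξ))
        = N₃ δ k (C.comp (S (ε, 0, ε) - S (q k)) (M₃ δ k ξ)) := by
      intro k
      have h5 : S (ε, 0, ε) (M₃ δ k ξ) = M₃ δ k (S (ε, 0, ε) ξ) := mulOp_indOp_comm _ _ _ ξ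
      have h6 : C (S (ε, 0, ε) (M₃ δ k ξ)) = N₃ δ k (C (S (ε, 0, ε) (M₃ δ k ξ))) := by
        rw [h5]
        exact (N₃_conv hf hδ hδP.le hP k _).symm
      rw [hσ]
      change C (S (ε, 0, ε) (M₃ δ k ξ)) - N₃ δ k (C (S (q k) (M₃ δ k ξ)))
        = N₃ δ k (C (S (ε, 0, ε) (M₃ δ k ξ) - S (q k) (M₃ δ k ξ)))
      rw [map_sub, map_sub, ← h6]
    have h5 : C (S (ε, 0, ε) (M ξ)) - sigma₃ ε δ F ξ
        = ∑' k, N₃ δ k (C.comp (S (ε, 0, ε) - S (q k)) (M₃ δ k ξ)) :=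
      h3.tsum_eq.symm.trans (tsum_congr h4)
    rw [h5]
    exact s2
  have h1 : M₁ δ ξ + M₂ δ ξ + M ξ = ξ := M₁_add_M₂_add hδ ξ
  have h4 : C (S (ε, 0, ε) ξ) = C (S (ε, 0, ε) (M₁ δ ξ)) + C (S (ε, 0, ε) (M₂ δ ξ))
      + C (S (ε, 0, ε) (M ξ)) := by
    rw [← map_add, ← map_add, ← map_add, ← map_add, h1]
  have h2 : Mσ (M₁ δ ξ) = S (0, 0, ε) (Mφ φ hφ (M₁ δ ξ)) :=
    (mulOp_mulOp (hmm _) (fun _ => hψ1 _) hφm hφb hbb _).symm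
  have h3 : (defect ε φ hφ δ F - C.comp ((S (ε, 0, ε) - Mσ).comp (M₁ δ))) ξ
      = C (S (ε, 0, ε) (M₂ δ ξ) - S (0, 0, ε) (M₂ δ ξ))
        + (C (S (ε, 0, ε) (M ξ)) - sigma₃ ε δ F ξ) := by
    change σStar (ε, 0, ε) F ξ - sigmaStar ε φ hφ δ F ξ
      - C (S (ε, 0, ε) (M₁ δ ξ) - Mσ (M₁ δ ξ)) = _
    rw [sigmaStar_apply, hσ, hσ, h2]
    change C (S (ε, 0, ε) ξ) - (C (S (0, 0, ε) (Mφ φ hφ (M₁ δ ξ))) + C (S (0, 0, ε) (M₂ δ ξ))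
      + sigma₃ ε δ F ξ) - _ = _
    rw [h4]
    simp only [map_sub]
    abel
  rw [h3]
  refine (norm_add_le _ _).trans ?_
  calc _ ≤ c * η * ‖ξ‖ + 3 * (c * η) * ‖ξ‖ := add_le_add b2 b3
    _ = (c * η + 3 * (c * η)) * ‖ξ‖ := by ring
    _ ≤ η' * ‖ξ‖ := by gcongr

end G6

/-! ### Density of product functions in `L¹` of a product -/

section ProductDensity

variable {α β : Type*} [MeasurableSpace α] [MeasurableSpace β] {μ : Measure α} {ν : Measure β}

theorem tendsto_indicatorConstLp_iUnion_of_monotone {t : ℕ → Set α}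
    (ht : ∀ n, MeasurableSet (t n)) (hmono : Monotone t) (hμt : ∀ n, μ (t n) ≠ ⊤)
    (hμ : μ (⋃ n, t n) ≠ ⊤) (c : ℂ) :
    Filter.Tendsto (fun n => indicatorConstLp 1 (ht n) (hμt n) c) Filter.atTop
      (𝓝 (indicatorConstLp 1 (MeasurableSet.iUnion ht) hμ c)) := by
  refine tendsto_indicatorConstLp_set ENNReal.one_ne_top ?_
  have h1 : ∀ n, μ (symmDiff (t n) (⋃ n, t n)) = μ (⋃ n, t n) - μ (t n) := by
    intro n
    rw [symmDiff_of_le (Set.subset_iUnion t n),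
      measure_sdiff (Set.subset_iUnion t n) (ht n).nullMeasurableSet (hμt n)]
  simp only [h1]
  have h2 := ENNReal.Tendsto.sub (tendsto_const_nhds (x := μ (⋃ n, t n)) (f := Filter.atTop))
    (tendsto_measure_iUnion_atTop (μ := μ) hmono) (Or.inl hμ)
  rwa [tsub_self] at h2

variable [SFinite ν]

theorem indicatorConstLp_mem_of_rect_mem (W : Submodule ℂ (Lp ℂ 1 (μ.prod ν)))
    (hWc : IsClosed (W : Set (Lp ℂ 1 (μ.prod ν)))) {X : Set α} (hX : MeasurableSet X)
    (hμX : μ X ≠ ⊤) {Y : Set β} (hY : MeasurableSet Y) (hνY : ν Y ≠ ⊤)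
    (hW : ∀ (A : Set α) (hA : MeasurableSet A) (_ : μ A ≠ ⊤) (B : Set β) (hB : MeasurableSet B)
      (_ : ν B ≠ ⊤) (hAB : (μ.prod ν) (A ×ˢ B) ≠ ⊤),
      indicatorConstLp 1 (hA.prod hB) hAB (1 : ℂ) ∈ W) {S : Set (α × β)} (hS : MeasurableSet S)
    (hfin : (μ.prod ν) (S ∩ X ×ˢ Y) ≠ ⊤) :
    indicatorConstLp 1 (hS.inter (hX.prod hY)) hfin (1 : ℂ) ∈ W := by
  have hR : (μ.prod ν) (X ×ˢ Y) ≠ ⊤ := by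
    rw [Measure.prod_prod]
    exact ENNReal.mul_ne_top hμX hνY
  have hfin' : ∀ T : Set (α × β), (μ.prod ν) (T ∩ X ×ˢ Y) ≠ ⊤ :=
    fun T => measure_ne_top_of_subset Set.inter_subset_right hR
  have hunion : ∀ {T T' : Set (α × β)} (hT : MeasurableSet T) (hT' : MeasurableSet T'),
      Disjoint T T' → indicatorConstLp 1 (hT.inter (hX.prod hY)) (hfin' T) (1 : ℂ) ∈ W →
      indicatorConstLp 1 (hT'.inter (hX.prod hY)) (hfin' T') (1 : ℂ) ∈ W →
      indicatorConstLp 1 ((hT.union hT').inter (hX.prod hY)) (hfin' _) (1 : ℂ) ∈ W := by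
    intro T T' hT hT' hd h1 h2
    have h3 := indicatorConstLp_disjoint_union (p := 1) (hT.inter (hX.prod hY))
      (hT'.inter (hX.prod hY)) (hfin' T) (hfin' T')
      (hd.mono Set.inter_subset_left Set.inter_subset_left) (1 : ℂ)
    have h4 := W.add_mem h1 h2
    rw [← h3] at h4
    convert h4 using 2
    exact Set.union_inter_distrib_right _ _ _
  induction S, hS using MeasurableSpace.induction_on_inter generateFrom_prod.symm isPiSystem_prod
    with
  | empty =>
    convert W.zero_mem
    simp only [Set.empty_inter]
    exact indicatorConstLp_empty
  | basic T hT =>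
    obtain ⟨A, hA, B, hB, rfl⟩ := hT
    have h1 := hW (A ∩ X) (hA.inter hX) (measure_ne_top_of_subset Set.inter_subset_right hμX)
      (B ∩ Y) (hB.inter hY) (measure_ne_top_of_subset Set.inter_subset_right hνY)
      (by rw [← Set.prod_inter_prod]; exact hfin)
    convert h1 using 2
    exact Set.prod_inter_prod
  | compl T hT ih =>
    have h1 := indicatorConstLp_disjoint_union (p := 1) (hT.inter (hX.prod hY))
      (hT.compl.inter (hX.prod hY)) (hfin' T) (hfin' Tᶜ)
      ((disjoint_compl_right (a := T)).mono Set.inter_subset_left Set.inter_subset_left) (1 : ℂ)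
    have h2 := hW X hX hμX Y hY hνY hR
    have h3 := W.sub_mem h2 (ih (hfin' T))
    convert h3 using 1
    rw [eq_sub_iff_add_eq', ← h1]
    congr 1
    rw [← Set.union_inter_distrib_right, Set.union_compl_self, Set.univ_inter]
  | iUnion T hd hT ih =>
    set t : ℕ → Set (α × β) := fun n => (⋃ i ∈ Finset.range n, T i) ∩ X ×ˢ Y with ht
    have htT : ∀ n, MeasurableSet (⋃ i ∈ Finset.range n, T i) :=
      fun n => (Finset.range n).measurableSet_biUnion fun i _ => hT i
    have htm : ∀ n, MeasurableSet (t n) := fun n => (htT n).inter (hX.prod hY)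
    have hmono : Monotone t := fun m n hmn => Set.inter_subset_inter_left _
      (Set.biUnion_subset_biUnion_left (by simpa using hmn))
    have hUt : ⋃ n, t n = (⋃ i, T i) ∩ X ×ˢ Y := by
      rw [← Set.iUnion_inter]
      congr 1
      ext z
      simp only [Set.mem_iUnion, Finset.mem_range]
      exact ⟨fun ⟨_, i, _, h⟩ => ⟨i, h⟩, fun ⟨i, h⟩ => ⟨i + 1, i, Nat.lt_succ_self i, h⟩⟩
    have hmem : ∀ n, indicatorConstLp 1 (htm n) (hfin' _) (1 : ℂ) ∈ W := by
      intro n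
      induction n with
      | zero =>
        convert W.zero_mem
        simp only [ht, Finset.range_zero, Finset.notMem_empty, Set.iUnion_of_empty,
          Set.iUnion_empty, Set.empty_inter]
        exact indicatorConstLp_empty
      | succ n ihn =>
        have h1 := hunion (hT n) (htT n) (Set.disjoint_iUnion₂_right.2 fun i hi =>
          hd (Finset.mem_range.1 hi).ne') (ih n (hfin' _)) ihn
        convert h1 using 2
        simp only [ht]
        rw [Finset.range_add_one, Finset.set_biUnion_insert]
    have hlim := tendsto_indicatorConstLp_iUnion_of_monotone (μ := μ.prod ν) htm hmono
      (fun n => hfin' _) (by rw [hUt]; exact hfin' _) (1 : ℂ)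
    have h1 := hWc.mem_of_tendsto hlim (Filter.Eventually.of_forall hmem)
    rw [SetLike.mem_coe] at h1
    convert h1 using 2
    exact hUt.symm

theorem L1_prod_eq_top_of_rect_mem [SigmaFinite μ] [SigmaFinite ν]
    (W : Submodule ℂ (Lp ℂ 1 (μ.prod ν)))
    (hWc : IsClosed (W : Set (Lp ℂ 1 (μ.prod ν))))
    (hW : ∀ (A : Set α) (hA : MeasurableSet A) (_ : μ A ≠ ⊤) (B : Set β) (hB : MeasurableSet B)
      (_ : ν B ≠ ⊤) (hAB : (μ.prod ν) (A ×ˢ B) ≠ ⊤),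
      indicatorConstLp 1 (hA.prod hB) hAB (1 : ℂ) ∈ W) : W = ⊤ := by
  have key : ∀ {S : Set (α × β)} (hS : MeasurableSet S) (hfin : (μ.prod ν) S ≠ ⊤),
      indicatorConstLp 1 hS hfin (1 : ℂ) ∈ W := by
    intro S hS hfin
    set t : ℕ → Set (α × β) := fun n => S ∩ spanningSets μ n ×ˢ spanningSets ν n with ht
    have htm : ∀ n, MeasurableSet (t n) := fun n =>
      hS.inter ((measurableSet_spanningSets μ n).prod (measurableSet_spanningSets ν n))
    have hmono : Monotone t := fun m n hmn => Set.inter_subset_inter_right _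
      (Set.prod_mono (monotone_spanningSets μ hmn) (monotone_spanningSets ν hmn))
    have hfin' : ∀ n, (μ.prod ν) (t n) ≠ ⊤ :=
      fun n => measure_ne_top_of_subset Set.inter_subset_left hfin
    have hUt : ⋃ n, t n = S := by
      rw [← Set.inter_iUnion, Set.iUnion_prod_of_monotone (monotone_spanningSets μ)
        (monotone_spanningSets ν), iUnion_spanningSets, iUnion_spanningSets, Set.univ_prod_univ,
        Set.inter_univ]
    have hlim := tendsto_indicatorConstLp_iUnion_of_monotone (μ := μ.prod ν) htm hmono
      hfin' (by rw [hUt]; exact hfin) (1 : ℂ)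
    have h1 := hWc.mem_of_tendsto hlim (Filter.Eventually.of_forall fun n =>
      indicatorConstLp_mem_of_rect_mem W hWc (measurableSet_spanningSets μ n)
        (measure_spanningSets_lt_top μ n).ne (measurableSet_spanningSets ν n)
        (measure_spanningSets_lt_top ν n).ne hW hS (hfin' n))
    rw [SetLike.mem_coe] at h1
    convert h1 using 2
    exact hUt.symm
  refine (Submodule.eq_top_iff').2 fun F => ?_
  refine Lp.induction ENNReal.one_ne_top (fun F => F ∈ W) ?_ ?_ hWc F
  · intro c s hs hμs
    rw [Lp.simpleFunc.coe_indicatorConst]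
    convert W.smul_mem c (key hs hμs.ne) using 1
    refine Lp.ext ?_
    filter_upwards [indicatorConstLp_coeFn (p := 1) (hs := hs) (hμs := hμs.ne) (c := c),
      indicatorConstLp_coeFn (p := 1) (hs := hs) (hμs := hμs.ne) (c := (1 : ℂ)),
      Lp.coeFn_smul c (indicatorConstLp 1 hs hμs.ne (1 : ℂ))] with x h1 h2 h3
    rw [h1, h3, Pi.smul_apply, h2]
    by_cases hx : x ∈ s <;> simp [hx]
  · intro f g hf hg _ h1 h2
    exact W.add_mem h1 h2

variable [SFinite μ]

/-- The product `(x, y) ↦ f x * g y` as a bilinear map on `L¹`. -/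
def L1prod (μ : Measure α) (ν : Measure β) [SFinite μ] [SFinite ν] :
    Lp ℂ 1 μ →L[ℂ] Lp ℂ 1 ν →L[ℂ] Lp ℂ 1 (μ.prod ν) :=
  LinearMap.mkContinuous₂
    (LinearMap.mk₂ ℂ (fun f g => ((L1.integrable_coeFn f).mul_prod
        (L1.integrable_coeFn g)).toL1 _)
      (fun f f' g => by
        rw [← Integrable.toL1_add]
        refine (Integrable.toL1_eq_toL1_iff _ _ _ _).2 ?_
        filter_upwards [Measure.quasiMeasurePreserving_fst.ae (Lp.coeFn_add f f')] with z hz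
        rw [hz, Pi.add_apply, Pi.add_apply, add_mul])
      (fun c f g => by
        rw [← Integrable.toL1_smul]
        refine (Integrable.toL1_eq_toL1_iff _ _ _ _).2 ?_
        filter_upwards [Measure.quasiMeasurePreserving_fst.ae (Lp.coeFn_smul c f)] with z hz
        rw [hz, Pi.smul_apply, smul_eq_mul, smul_eq_mul, mul_assoc])
      (fun f g g' => by
        rw [← Integrable.toL1_add]
        refine (Integrable.toL1_eq_toL1_iff _ _ _ _).2 ?_
        filter_upwards [Measure.quasiMeasurePreserving_snd.ae (Lp.coeFn_add g g')] with z hz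
        rw [hz, Pi.add_apply, Pi.add_apply, mul_add])
      (fun c f g => by
        rw [← Integrable.toL1_smul]
        refine (Integrable.toL1_eq_toL1_iff _ _ _ _).2 ?_
        filter_upwards [Measure.quasiMeasurePreserving_snd.ae (Lp.coeFn_smul c g)] with z hz
        rw [hz, Pi.smul_apply, smul_eq_mul, smul_eq_mul, mul_left_comm]))
    1
    (fun f g => by
      rw [LinearMap.mk₂_apply, one_mul, L1.norm_eq_integral_norm, L1.norm_eq_integral_norm,
        L1.norm_eq_integral_norm, ← integral_prod_mul]
      refine (integral_congr_ae ?_).le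
      filter_upwards [((L1.integrable_coeFn f).mul_prod (L1.integrable_coeFn g)).coeFn_toL1]
        with z hz
      rw [hz, norm_mul])

theorem coeFn_L1prod (f : Lp ℂ 1 μ) (g : Lp ℂ 1 ν) :
    L1prod μ ν f g =ᵐ[μ.prod ν] fun z => f z.1 * g z.2 :=
  ((L1.integrable_coeFn f).mul_prod (L1.integrable_coeFn g)).coeFn_toL1

theorem indicatorConstLp_prod_eq {A : Set α} (hA : MeasurableSet A) (hμA : μ A ≠ ⊤) {B : Set β}
    (hB : MeasurableSet B) (hνB : ν B ≠ ⊤) (hAB : (μ.prod ν) (A ×ˢ B) ≠ ⊤) :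
    indicatorConstLp 1 (hA.prod hB) hAB (1 : ℂ)
      = L1prod μ ν (indicatorConstLp 1 hA hμA 1) (indicatorConstLp 1 hB hνB 1) := by
  refine Lp.ext ?_
  filter_upwards [coeFn_L1prod (indicatorConstLp 1 hA hμA (1 : ℂ))
      (indicatorConstLp 1 hB hνB (1 : ℂ)),
    indicatorConstLp_coeFn (p := 1) (hs := hA.prod hB) (hμs := hAB) (c := (1 : ℂ)),
    Measure.quasiMeasurePreserving_fst.ae (indicatorConstLp_coeFn (p := 1) (hs := hA)
      (hμs := hμA) (c := (1 : ℂ))),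
    Measure.quasiMeasurePreserving_snd.ae (indicatorConstLp_coeFn (p := 1) (hs := hB)
      (hμs := hνB) (c := (1 : ℂ)))] with z h1 h2 h3 h4
  rw [h1, h2, h3, h4]
  by_cases hzA : z.1 ∈ A <;> by_cases hzB : z.2 ∈ B <;> simp [hzA, hzB]

/-- A closed subspace of `L¹(μ × ν)` that contains the products of the elements of two dense sets
is everything. -/
theorem L1_prod_eq_top [SigmaFinite μ] [SigmaFinite ν] (W : Submodule ℂ (Lp ℂ 1 (μ.prod ν)))
    (hWc : IsClosed (W : Set (Lp ℂ 1 (μ.prod ν)))) {D₁ : Set (Lp ℂ 1 μ)} (hD₁ : Dense D₁)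
    {D₂ : Set (Lp ℂ 1 ν)} (hD₂ : Dense D₂) (hW : ∀ f ∈ D₁, ∀ g ∈ D₂, L1prod μ ν f g ∈ W) :
    W = ⊤ := by
  have h1 : ∀ f ∈ D₁, ∀ g, L1prod μ ν f g ∈ W := fun f hf g =>
    hD₂.induction (P := fun g => L1prod μ ν f g ∈ W) (hW f hf)
      (hWc.preimage (L1prod μ ν f).continuous) g
  have h2 : ∀ f g, L1prod μ ν f g ∈ W := fun f g =>
    hD₁.induction (P := fun f => L1prod μ ν f g ∈ W) (fun f hf => h1 f hf g)
      (hWc.preimage ((L1prod μ ν).continuous.clm_apply continuous_const)) f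
  refine L1_prod_eq_top_of_rect_mem W hWc fun A hA hμA B hB hνB hAB => ?_
  rw [indicatorConstLp_prod_eq hA hμA hB hνB hAB]
  exact h2 _ _

end ProductDensity

namespace G6

/-! ### Band-limited functions on `𝔥` -/

instance isAddHaarMeasure_volume_h : (volume : Measure h).IsAddHaarMeasure := by
  have h1 : (volume : Measure (ℝ × ℝ)).IsAddHaarMeasure := inferInstance
  exact @Measure.prod.instIsAddHaarMeasure ℝ _ _ _ (ℝ × ℝ) _ _ _ volume volume _ _ _ _ _ _

/-- The pairing of `𝔥` and `𝔥*`, divided by `-2π`, as a continuous bilinear map. -/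
def pairL : h →L[ℝ] (ℝ × ℝ × ℝ) →L[ℝ] ℝ :=
  let p₁ : ℝ × ℝ × ℝ →L[ℝ] ℝ := ContinuousLinearMap.fst ℝ ℝ (ℝ × ℝ)
  let p₂ : ℝ × ℝ × ℝ →L[ℝ] ℝ :=
    (ContinuousLinearMap.fst ℝ ℝ ℝ).comp (ContinuousLinearMap.snd ℝ ℝ (ℝ × ℝ))
  let p₃ : ℝ × ℝ × ℝ →L[ℝ] ℝ :=
    (ContinuousLinearMap.snd ℝ ℝ ℝ).comp (ContinuousLinearMap.snd ℝ ℝ (ℝ × ℝ))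
  (-(2 * Real.pi)⁻¹) • ((ContinuousLinearMap.mul ℝ ℝ).bilinearComp p₁ p₁
    + (ContinuousLinearMap.mul ℝ ℝ).bilinearComp p₂ p₂
    + (ContinuousLinearMap.mul ℝ ℝ).bilinearComp p₃ p₃)

theorem pairL_apply (x : h) (l : ℝ × ℝ × ℝ) : pairL x l = -(2 * Real.pi)⁻¹ * pair l x := by
  change -(2 * Real.pi)⁻¹ * (x.1 * l.1 + x.2.1 * l.2.1 + x.2.2 * l.2.2) = _
  rw [pair]
  ring

theorem hat_eq_fourierIntegral (u : h → ℂ) :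
    hat u = VectorFourier.fourierIntegral Real.fourierChar volume pairL.toLinearMap₁₂ u := by
  funext l
  rw [hat, VectorFourier.fourierIntegral]
  refine integral_congr_ae (Filter.Eventually.of_forall fun x => ?_)
  change u x * χ l x = Real.fourierChar (-(pairL x l)) • u x
  rw [Circle.smul_def, Real.fourierChar_apply, pairL_apply, smul_eq_mul, mul_comm, χ]
  congr 2
  have : (2 * Real.pi * -(-(2 * Real.pi)⁻¹ * pair l x) : ℝ) = pair l x := by
    have := Real.pi_ne_zero
    field_simp
  rw [this, mul_comm]

theorem contDiff_hat {w : h → ℂ} (hw : Continuous w) (hws : HasCompactSupport w) :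
    ContDiff ℝ ∞ (hat w) := by
  rw [hat_eq_fourierIntegral]
  refine VectorFourier.contDiff_fourierIntegral pairL (N := ⊤) fun n _ => ?_
  exact ((continuous_norm.pow n).mul hw.norm).integrable_of_hasCompactSupport hws.norm.mul_left

/-- There is an integrable function on `ℝ` whose Fourier transform is smooth, compactly supported
and equal to `1` at `0`. -/
theorem exists_bandlimited_real : ∃ k : ℝ → ℂ, Integrable k ∧ ∃ B : ℝ → ℂ, ContDiff ℝ ∞ B ∧
    HasCompactSupport B ∧ B 0 = 1 ∧
    ∀ t : ℝ, ∫ x, k x * Complex.exp (Complex.I * ((t * x : ℝ) : ℂ)) = B t := by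
  let b : ContDiffBump (0 : ℝ) := ⟨1, 2, one_pos, one_lt_two⟩
  have hb : ContDiff ℝ ∞ fun x : ℝ => (b x : ℂ) := Complex.ofRealCLM.contDiff.comp b.contDiff
  have hbs : HasCompactSupport fun x : ℝ => (b x : ℂ) :=
    b.hasCompactSupport.comp_left Complex.ofReal_zero
  set β : SchwartzMap ℝ ℂ := hbs.toSchwartzMap hb with hβ
  set κ : SchwartzMap ℝ ℂ := FourierTransformInv.fourierInv β with hκ
  have hpi : -(2 * Real.pi)⁻¹ ≠ 0 := neg_ne_zero.2 (inv_ne_zero (by positivity))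
  refine ⟨κ, κ.integrable, fun t => (b (t * -(2 * Real.pi)⁻¹) : ℂ), ?_, ?_, ?_, fun t => ?_⟩
  · exact hb.comp (contDiff_id.mul contDiff_const)
  · exact hbs.comp_homeomorph (Homeomorph.mulRight₀ _ hpi)
  · simp [b.one_of_mem_closedBall (Metric.mem_closedBall_self zero_le_one)]
  · have h1 : FourierTransform.fourier κ = β := by
      rw [hκ, FourierTransform.fourier_fourierInv_eq]
    have h2 := congrArg (fun g : SchwartzMap ℝ ℂ => g (t * -(2 * Real.pi)⁻¹)) h1
    simp only [SchwartzMap.fourier_coe] at h2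
    rw [Real.fourier_real_eq_integral_exp_smul] at h2
    refine Eq.trans ?_ h2
    refine integral_congr_ae (Filter.Eventually.of_forall fun x => ?_)
    simp only [smul_eq_mul]
    rw [mul_comm]
    congr 2
    have : -2 * Real.pi * x * (t * -(2 * Real.pi)⁻¹) = t * x := by
      have := Real.pi_ne_zero
      field_simp
    rw [this, mul_comm]

theorem exists_bandlimited : ∃ k : h → ℂ, Integrable k ∧ ContDiff ℝ ∞ (hat k) ∧
    HasCompactSupport (hat k) ∧ hat k 0 = 1 := by
  obtain ⟨k, hk, B, hB, hBs, hB0, hkB⟩ := exists_bandlimited_real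
  have hhat : hat (fun x : h => k x.1 * (k x.2.1 * k x.2.2))
      = fun l => B l.1 * (B l.2.1 * B l.2.2) := by
    funext l
    rw [← hkB, ← hkB, ← hkB, ← integral_prod_mul, ← integral_prod_mul]
    refine integral_congr_ae (Filter.Eventually.of_forall fun x => ?_)
    change k x.1 * (k x.2.1 * k x.2.2) * χ l x = k x.1 * _ * (k x.2.1 * _ * (k x.2.2 * _))
    have : χ l x = Complex.exp (Complex.I * ((l.1 * x.1 : ℝ) : ℂ))
        * (Complex.exp (Complex.I * ((l.2.1 * x.2.1 : ℝ) : ℂ))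
          * Complex.exp (Complex.I * ((l.2.2 * x.2.2 : ℝ) : ℂ))) := by
      rw [χ, pair, ← Complex.exp_add, ← Complex.exp_add]
      congr 1
      push_cast
      ring
    rw [this]
    ring
  refine ⟨fun x => k x.1 * (k x.2.1 * k x.2.2), hk.mul_prod (hk.mul_prod hk), ?_, ?_, ?_⟩
  · rw [hhat]
    exact (hB.comp contDiff_fst).mul ((hB.comp (contDiff_fst.comp contDiff_snd)).mul
      (hB.comp (contDiff_snd.comp contDiff_snd)))
  · rw [hhat]
    refine HasCompactSupport.intro
      (hBs.isCompact.prod (hBs.isCompact.prod hBs.isCompact)) fun l hl => ?_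
    by_contra hne
    refine hl ⟨subset_tsupport B (left_ne_zero_of_mul hne), ?_, ?_⟩
    · exact subset_tsupport B (left_ne_zero_of_mul (right_ne_zero_of_mul hne))
    · exact subset_tsupport B (right_ne_zero_of_mul (right_ne_zero_of_mul hne))
  · rw [hhat]
    simp [hB0]

/-! ### Density of band-limited functions -/

/-- The Fourier transform at `l` as a functional on `L¹(𝔥)`. -/
def hatCLM (l : ℝ × ℝ × ℝ) : Lp ℂ 1 (volume : Measure h) →L[ℂ] ℂ :=
  LinearMap.mkContinuous
    { toFun := fun w => hat w l
      map_add' := fun w w' => by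
        have hi : ∀ w : Lp ℂ 1 (volume : Measure h), Integrable fun x => w x * χ l x := fun w =>
          (L1.integrable_coeFn w).mul_bdd (c := 1) (continuous_χ l).aestronglyMeasurable
            (Filter.Eventually.of_forall fun x => (norm_χ l x).le)
        rw [hat, hat, hat, ← integral_add (hi w) (hi w')]
        refine integral_congr_ae ?_
        filter_upwards [Lp.coeFn_add w w'] with x hx
        rw [hx, Pi.add_apply, add_mul]
      map_smul' := fun c w => by
        rw [RingHom.id_apply, hat, hat, ← integral_smul]
        refine integral_congr_ae ?_
        filter_upwards [Lp.coeFn_smul c w] with x hx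
        rw [hx, Pi.smul_apply, smul_mul_assoc] }
    1
    (fun w => by
      rw [one_mul, L1.norm_eq_integral_norm]
      exact norm_hat_le _ _)

theorem hatCLM_apply (l : ℝ × ℝ × ℝ) (w : Lp ℂ 1 (volume : Measure h)) : hatCLM l w = hat w l := rfl

/-- Translation `w ↦ w(· - s)` on `L¹(𝔥)`. -/
def shift (s : h) (w : Lp ℂ 1 (volume : Measure h)) : Lp ℂ 1 (volume : Measure h) :=
  Lp.compMeasurePreserving (fun x => -s + x) (measurePreserving_add_left volume (-s)) w

theorem coeFn_shift (s : h) (w : Lp ℂ 1 (volume : Measure h)) :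
    shift s w =ᵐ[volume] fun x => w (-s + x) :=
  Lp.coeFn_compMeasurePreserving w (measurePreserving_add_left volume (-s))

theorem continuous_shift (w : Lp ℂ 1 (volume : Measure h)) : Continuous fun s => shift s w := by
  have hf : Continuous fun s : h => (⟨fun x => -s + x, by fun_prop⟩ : C(h, h)) :=
    ContinuousMap.continuous_of_continuous_uncurry _
      (by change Continuous fun z : h × h => -z.1 + z.2; fun_prop)
  exact Continuous.compMeasurePreservingLp (f := fun _ => w) continuous_const hf
    (fun s => measurePreserving_add_left volume (-s)) ENNReal.one_ne_top

theorem shift_zero (w : Lp ℂ 1 (volume : Measure h)) : shift 0 w = w := by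
  refine Lp.ext ?_
  filter_upwards [coeFn_shift 0 w] with x hx
  rw [hx, neg_zero, zero_add]

theorem norm_shift (s : h) (w : Lp ℂ 1 (volume : Measure h)) : ‖shift s w‖ = ‖w‖ :=
  Lp.norm_compMeasurePreserving w (measurePreserving_add_left volume (-s))

theorem hat_shift (s : h) (w : Lp ℂ 1 (volume : Measure h)) (l : ℝ × ℝ × ℝ) :
    hat (shift s w) l = χ l s * hat w l := by
  have h1 : hat (shift s w) l = ∫ x, (fun y => w y * χ l (s + y)) (-s + x) := by
    refine integral_congr_ae ?_
    filter_upwards [coeFn_shift s w] with x hx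
    simp only [hx, add_neg_cancel_left]
  rw [h1, integral_add_left_eq_self (fun y => w y * χ l (s + y)) (-s), hat, ← integral_const_mul]
  refine integral_congr_ae (Filter.Eventually.of_forall fun x => ?_)
  simp only [χ_add]
  ring

theorem dense_bandlimited :
    Dense {w : Lp ℂ 1 (volume : Measure h) | ContDiff ℝ ∞ (hat w) ∧ HasCompactSupport (hat w)} := by
  obtain ⟨k, hk, hkc, hks, hk0⟩ := exists_bandlimited
  have hd := Lp.dense_hasCompactSupport_contDiff (F := ℂ) (μ := (volume : Measure h))
    (p := 1) ENNReal.one_ne_top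
  refine Dense.of_closure (hd.mono ?_)
  rintro w ⟨g, hwg, hgs, hg⟩
  have hw : ContDiff ℝ ∞ (hat w) := by
    have : hat w = hat g := by
      funext l
      refine integral_congr_ae ?_
      filter_upwards [hwg] with x hx
      rw [hx]
    rw [this]
    exact contDiff_hat hg.continuous hgs
  set r : ℕ → ℝ := fun n => ((n : ℝ) + 1)⁻¹ with hr
  have hr0 : ∀ n, r n ≠ 0 := fun n => by positivity
  have hrlim : Filter.Tendsto r Filter.atTop (𝓝 0) := by
    simpa only [hr, one_div] using tendsto_one_div_add_atTop_nhds_zero_nat (𝕜 := ℝ)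
  have hcont : ∀ n, Continuous fun t : h => shift (r n • t) w :=
    fun n => (continuous_shift w).comp (continuous_const_smul (r n))
  have hmeas : ∀ n, AEStronglyMeasurable (fun t : h => k t • shift (r n • t) w) volume :=
    fun n => hk.aestronglyMeasurable.smul (hcont n).aestronglyMeasurable
  have hbound : ∀ n, ∀ t : h, ‖k t • shift (r n • t) w‖ ≤ ‖k t‖ * ‖w‖ := fun n t => by
    rw [norm_smul, norm_shift]
  have hint : ∀ n, Integrable fun t : h => k t • shift (r n • t) w := fun n =>
    (hk.norm.mul_const _).mono' (hmeas n) (Filter.Eventually.of_forall (hbound n))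
  have hk1 : ∫ t, k t = 1 := by
    rw [← hk0]
    refine integral_congr_ae (Filter.Eventually.of_forall fun t => ?_)
    simp [χ, pair]
  have hlim : Filter.Tendsto (fun n => ∫ t : h, k t • shift (r n • t) w) Filter.atTop (𝓝 w) := by
    have h1 : ∫ t : h, k t • w = w := by rw [integral_smul_const, hk1, one_smul]
    have h2 := tendsto_integral_of_dominated_convergence (μ := (volume : Measure h))
      (F := fun n t => k t • shift (r n • t) w) (f := fun t => k t • w) (fun t => ‖k t‖ * ‖w‖) hmeas
      (hk.norm.mul_const _) (fun n => Filter.Eventually.of_forall (hbound n))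
      (Filter.Eventually.of_forall fun t => ?_)
    · rwa [h1] at h2
    · have h3 : Filter.Tendsto (fun n => shift (r n • t) w) Filter.atTop (𝓝 w) := by
        have h4 : Filter.Tendsto (fun n => r n • t) Filter.atTop (𝓝 0) := by
          simpa using hrlim.smul_const t
        have h5 := ((continuous_shift w).tendsto 0).comp h4
        rwa [shift_zero] at h5
      exact h3.const_smul _
  refine mem_closure_of_tendsto hlim (Filter.Eventually.of_forall fun n => ?_)
  have hhat : hat (∫ t : h, k t • shift (r n • t) w : Lp ℂ 1 (volume : Measure h))
      = fun l => hat k (r n • l) * hat w l := by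
    funext l
    rw [← hatCLM_apply, ← ContinuousLinearMap.integral_comp_comm _ (hint n), hat,
      ← integral_mul_const]
    refine integral_congr_ae (Filter.Eventually.of_forall fun t => ?_)
    simp only [map_smul, hatCLM_apply, hat_shift, smul_eq_mul]
    have : χ l (r n • t) = χ (r n • l) t := by
      simp only [χ, pair, Prod.smul_fst, Prod.smul_snd, smul_eq_mul]
      congr 3
      ring
    rw [this, mul_assoc]
  refine ⟨?_, ?_⟩
  · rw [hhat]
    exact (hkc.comp (contDiff_const_smul _)).mul hw
  · rw [hhat]
    exact (hks.comp_smul (hr0 n)).mul_right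

open GroupCStar

theorem norm_ofL1_le (F : Lp ℂ 1 (volume : Measure G)) : ‖ofL1 volume F‖ ≤ ‖F‖ := by
  rw [norm_ofL1]
  refine csSup_le (repNorms_nonempty _ F) ?_
  rintro c ⟨E, _, _, _, π, rfl⟩
  exact π.norm_integrated_le volume F

theorem continuous_ofL1 : Continuous (ofL1 (volume : Measure G)) :=
  AddMonoidHomClass.continuous_of_bound (ofL1 (volume : Measure G)) 1 fun F => by
    simpa using norm_ofL1_le F

/-- `f ⊗ u` belongs to `L¹_c` if `f` is a test function and `û` is a test function. -/
theorem tensor_mem_L1c {f : G₀ → ℂ} (hf : Integrable f)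
    (hfd : ContDiff ℝ ∞ (E := ℝ × ℝ × ℝ) f) (hfs : HasCompactSupport f) {u : h → ℂ}
    (hu : Integrable u) (hud : ContDiff ℝ ∞ (hat u)) (hus : HasCompactSupport (hat u)) :
    tensor f hf u hu ∈ L1c := by
  refine ⟨fun z => f z.1 * hat u z.2,
    (hfd.comp contDiff_fst).mul (hud.comp contDiff_snd), ?_, ?_⟩
  · refine HasCompactSupport.intro (K := tsupport f ×ˢ tsupport (hat u)) (hfs.prod hus) ?_
    rintro ⟨y, l⟩ hz
    have hz' : ¬(y ∈ tsupport f ∧ l ∈ tsupport (hat u)) := hz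
    rcases not_and_or.1 hz' with hz | hz
    · exact mul_eq_zero_of_left (image_eq_zero_of_notMem_tsupport hz) _
    · exact mul_eq_zero_of_right _ (image_eq_zero_of_notMem_tsupport hz)
  · have h1 : ∀ᵐ g : G₀ × h ∂((volume : Measure G₀).prod (volume : Measure h)),
        tensor f hf u hu g = f g.1 * u g.2 := (integrable_tensor hf hu).coeFn_toL1
    filter_upwards [Measure.ae_ae_of_ae_prod h1] with y hy l
    calc partialFourier (tensor f hf u hu) y l = ∫ x : h, f y * (u x * χ l x) :=
          integral_congr_ae (hy.mono fun x hx => by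
            change tensor f hf u hu (y, x) * χ l x = _
            rw [hx, mul_assoc])
      _ = f y * hat u l := integral_const_mul _ _

theorem dense_testFunction : Dense {F : Lp ℂ 1 (volume : Measure G₀) | ∃ g : G₀ → ℂ,
    F =ᵐ[volume] g ∧ HasCompactSupport g ∧ ContDiff ℝ ∞ (E := ℝ × ℝ × ℝ) g} :=
  Lp.dense_hasCompactSupport_contDiff (E := ℝ × ℝ × ℝ) (F := ℂ)
    (μ := (volume : Measure (ℝ × ℝ × ℝ))) (p := 1) ENNReal.one_ne_top

/-- The elements `f ⊗ u` with test functions `f` and `û` span a dense subspace of `C*(G)`. -/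
theorem eq_top_of_tensor_mem (V : Submodule ℂ (CStar (volume : Measure G)))
    (hVc : IsClosed (V : Set (CStar (volume : Measure G))))
    (hV : ∀ (f : G₀ → ℂ) (hf : Integrable f), ContDiff ℝ ∞ (E := ℝ × ℝ × ℝ) f →
      HasCompactSupport f → (∀ y, ‖f y‖ ≤ 1) → ∀ (u : h → ℂ) (hu : Integrable u),
      ContDiff ℝ ∞ (hat u) → HasCompactSupport (hat u) → ∫ x, ‖u x‖ ≤ 1 →
      ofL1 volume (tensor f hf u hu) ∈ V) : V = ⊤ := by
  have hW : V.comap (ofL1 (volume : Measure G)) = ⊤ := by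
    refine L1_prod_eq_top (μ := (volume : Measure G₀)) (ν := (volume : Measure h))
      (V.comap (ofL1 (volume : Measure G))) (hVc.preimage continuous_ofL1)
      dense_testFunction dense_bandlimited ?_
    rintro F ⟨g, hFg, hgs, hgd⟩ w ⟨hwd, hws⟩
    have hgc : Continuous g := hgd.continuous
    obtain ⟨c, hc⟩ := hgs.exists_bound_of_continuous hgc
    have hg : Integrable g := hgc.integrable_of_hasCompactSupport hgs
    have hw : Integrable w := L1.integrable_coeFn w
    set a : ℝ := max c 1 with ha
    have ha0 : 0 < a := zero_lt_one.trans_le (le_max_right _ _)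
    set b : ℝ := max (∫ x, ‖w x‖) 1 with hb
    have hb0 : 0 < b := zero_lt_one.trans_le (le_max_right _ _)
    have hf : Integrable fun y => (a : ℂ)⁻¹ * g y := hg.const_mul _
    have hu : Integrable fun x => (b : ℂ)⁻¹ * w x := hw.const_mul _
    have hhat : hat (fun x => (b : ℂ)⁻¹ * w x) = fun l => (b : ℂ)⁻¹ * hat w l := by
      funext l
      simp only [hat, mul_assoc]
      exact integral_const_mul _ _
    have hmem := hV _ hf (contDiff_const.mul hgd) (hgs.mul_left (f := fun _ => (a : ℂ)⁻¹))
      (fun y => by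
        rw [norm_mul, norm_inv, Complex.norm_of_nonneg ha0.le, inv_mul_le_one₀ ha0]
        exact (hc y).trans (le_max_left _ _)) _ hu
      (by rw [hhat]; exact contDiff_const.mul hwd)
      (by rw [hhat]; exact hws.mul_left (f := fun _ => (b : ℂ)⁻¹))
      (by
        simp only [norm_mul, norm_inv, Complex.norm_of_nonneg hb0.le]
        rw [integral_const_mul, inv_mul_le_one₀ hb0]
        exact le_max_left _ _)
    have heq : L1prod (volume : Measure G₀) (volume : Measure h) F w
        = ((a : ℂ) * b) • tensor _ hf _ hu := by
      refine Lp.ext ?_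
      have h2 : ∀ᵐ z : G₀ × h ∂((volume : Measure G₀).prod (volume : Measure h)),
          tensor _ hf _ hu z = (a : ℂ)⁻¹ * g z.1 * ((b : ℂ)⁻¹ * w z.2) :=
        (integrable_tensor hf hu).coeFn_toL1
      have h3 : ∀ᵐ z : G₀ × h ∂((volume : Measure G₀).prod (volume : Measure h)),
          (((a : ℂ) * b) • tensor _ hf _ hu : Lp ℂ 1 (volume : Measure G)) z
            = ((a : ℂ) * b) • tensor _ hf _ hu z := Lp.coeFn_smul _ _
      filter_upwards [coeFn_L1prod (μ := (volume : Measure G₀)) (ν := (volume : Measure h)) F w,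
        h2, h3, Measure.quasiMeasurePreserving_fst.ae hFg] with z hz1 hz2 hz3 hz4
      refine hz1.trans (Eq.trans ?_ hz3.symm)
      rw [hz2, hz4, smul_eq_mul]
      have := Complex.ofReal_ne_zero.2 ha0.ne'
      have := Complex.ofReal_ne_zero.2 hb0.ne'
      field_simp
    rw [heq]
    exact Submodule.smul_mem _ _ hmem
  rw [eq_top_iff]
  intro F _
  refine (denseRange_ofL1 (volume : Measure G)).induction_on (p := fun F => F ∈ V) F hVc
    fun F' => ?_
  have : F' ∈ V.comap (ofL1 (volume : Measure G)) := hW ▸ Submodule.mem_top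
  exact this

theorem asympCompact_eq_top {ε : ℝ} (hε : ε = 1 ∨ ε = -1) {φ : ℝ → ℝ} (hφ : IsCutoff φ) :
    asympCompact ε φ hφ = ⊤ :=
  eq_top_of_tensor_mem _ (isClosed_asympCompact ε φ hφ) fun _ hf hfd hfs hf1 _ hu _ hus hu1 =>
    ofL1_tensor_mem_asympCompact hf hfd.continuous hfs hf1 hu hu1 hus hε hφ

theorem eq_sigmaStar_of_isSigma {ε : ℝ} {φ : ℝ → ℝ} {hφ : IsCutoff φ} {δ : ℝ}
    {Θ' : CStar (volume : Measure G) →L[ℂ] L2 →L[ℂ] L2}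
    (hΘ : ∀ F ∈ L1c, IsSigma ε φ hφ δ F (Θ' (ofL1 volume F))) :
    Θ' = sigmaStar ε φ hφ δ := by
  have hV := eq_top_of_tensor_mem
    (Θ' - sigmaStar ε φ hφ δ).ker (Θ' - sigmaStar ε φ hφ δ).isClosed_ker
    fun f hf hfd hfs _ u hu hud hus _ => by
      rw [LinearMap.mem_ker]
      change Θ' _ - sigmaStar ε φ hφ δ _ = 0
      rw [sub_eq_zero]
      exact (hΘ _ (tensor_mem_L1c hf hfd hfs hu hud hus)).unique (isSigma_sigmaStar ε φ hφ δ _)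
  refine ContinuousLinearMap.ext fun F => sub_eq_zero.1 ?_
  have : F ∈ (Θ' - sigmaStar ε φ hφ δ).ker := hV ▸ Submodule.mem_top
  exact LinearMap.mem_ker.1 this

end G6

end

theorem proposition5p5 :
    ∃ C : ℝ, 0 < C ∧ C ≤ 9 ∧
      ∀ ε : ℝ, (ε = 1 ∨ ε = -1) → ∀ (φ : ℝ → ℝ) (hφ : G6.IsCutoff φ),
        -- the operators `σ_{ε,ε,δ}(F)` exist for `F ∈ L¹_c` and satisfy the norm bound
        (∀ F ∈ G6.L1c, ∀ δ : ℝ, 0 < δ → ∃ T : G6.L2 →L[ℂ] G6.L2, G6.IsSigma ε φ hφ δ F T ∧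
          ‖T‖ ≤ 2 * ‖G6.σ (0, 0, ε) F‖ + C * ‖G6.σ (ε, 0, 0) F‖) ∧
        -- they extend, uniquely and with the same bound, to `C*(G)`, with the asserted limit
        ∃ Θ : ℝ → GroupCStar.CStar (volume : Measure G6.G) →L[ℂ] G6.L2 →L[ℂ] G6.L2,
          (∀ δ : ℝ, 0 < δ →
            (∀ F ∈ G6.L1c, G6.IsSigma ε φ hφ δ F (Θ δ (GroupCStar.ofL1 volume F))) ∧
            (∀ Θ' : GroupCStar.CStar (volume : Measure G6.G) →L[ℂ] G6.L2 →L[ℂ] G6.L2,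
              (∀ F ∈ G6.L1c, G6.IsSigma ε φ hφ δ F (Θ' (GroupCStar.ofL1 volume F))) →
                Θ' = Θ δ) ∧
            (∀ F : GroupCStar.CStar (volume : Measure G6.G),
              ‖Θ δ F‖ ≤ 2 * ‖G6.σStar (0, 0, ε) F‖ + C * ‖G6.σStar (ε, 0, 0) F‖)) ∧
          ∀ F : GroupCStar.CStar (volume : Measure G6.G),
            Filter.Tendsto
              (fun δ : ℝ => Metric.infDist (G6.σStar (ε, 0, ε) F - Θ δ F)
                {K : G6.L2 →L[ℂ] G6.L2 | IsCompactOperator K})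
              (𝓝[>] 0) (𝓝 0) := by
  refine ⟨3, by norm_num, by norm_num, fun ε hε φ hφ => ⟨fun F _ δ _ =>
    ⟨G6.sigmaStar ε φ hφ δ (GroupCStar.ofL1 volume F), G6.isSigma_sigmaStar ε φ hφ δ F, ?_⟩,
    G6.sigmaStar ε φ hφ, fun δ _ => ⟨fun F _ => G6.isSigma_sigmaStar ε φ hφ δ F,
      fun _ hΘ => G6.eq_sigmaStar_of_isSigma hΘ, G6.norm_sigmaStar_le ε φ hφ δ⟩, fun F =>
    G6.tendsto_infDist_of_mem_asympCompact
      (by rw [G6.asympCompact_eq_top hε hφ]; exact Submodule.mem_top)⟩⟩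
  rw [← G6.σStar_ofL1, ← G6.σStar_ofL1]
  exact G6.norm_sigmaStar_le ε φ hφ δ _
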